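/- **Conventions.** $[n]=\{1,\dots,n\}$, all logarithms are to base 2, and intervals are intervals of integers. A *length-$k$ monotone subsequence* of $f$ in an interval $I$ is a tuple $(i_1,\dots,i_k)\in I^k$ with $i_1<\dots<i_k$ and $f(i_1)<\dots<f(i_k)$; two tuples are *disjoint* if they have no index in common. A function $g:[n]\to\mathbb R$ is *$(12\dots k)$-free* if it has no length-$k$ monotone subsequence in $[n]$, and $f:[n]\to\mathbb R$ is *$\varepsilon$-far* from $(12\dots k)$-free if every $(12\dots k)$-free $g:[n]\to\mathbb R$ satisfies $|\{i\in[n]:f(i)\ne g(i)\}|\ge\varepsilon n$. For a constant $c\in\mathbb N$ write $P_c(k,\varepsilon)=\bigl(c\,(k+\log(1/\varepsilon))\bigr)^c$; this is what $\mathrm{poly}(k,\log(1/\varepsilon))$ stands for. **Growing suffixes.** For $a\in[n]$ let $\eta_a=\lceil\log(n-a)\rceil$ (with $\eta_n=0$) and $S_t(a)=[a+2^{t-1},a+2^t)\cap[n]$ for $1\le t\le\eta_a$. For $\alpha,\beta\in[0,1]$, the index $a$ *starts an $(\alpha,\beta)$-growing suffix* of $f$ if there are sets $D_t\subseteq S_t(a)$,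 $1\le t\le\eta_a$, such that $|D_t|/|S_t(a)|\le\alpha$ for all $t$, $\sum_t|D_t|/|S_t(a)|\ge\beta$, and $f(b)<f(b')$ whenever $b\in D_t$, $b'\in D_{t'}$ and $t<t'$. **Splittable collections.** Let $J$ be an interval, $T\subseteq J^{k_0}$ a set of disjoint length-$k_0$ monotone subsequences of $f$, and $1\le c_0<k_0$. Let $T^{(L)}$ and $T^{(R)}$ be the sets of prefixes of length $c_0$ and of suffixes of length $k_0-c_0$ of the tuples in $T$. The pair $(J,T)$ is *$(c_0,\alpha,\beta)$-splittable*, as witnessed by $(L,M,R)$, if $|T|/|J|\ge\beta$; $f(i_{c_0})<f(j_1)$ for all $(i_1,\dots,i_{c_0})\in T^{(L)}$ and $(j_1,\dots,j_{k_0-c_0})\in T^{(R)}$; and $J$ is partitioned into adjacent intervals $L,M,R$, in this order from left to right, with $|L|\ge\alpha|J|$, $|R|\ge\alpha|J|$, $|M|\ge\lfloor\alpha|J|\rfloor$ (so $M$ may be empty if $\alpha|J|<1$), $T^{(L)}\subseteq L^{c_0}$ and $T^{(R)}\subseteq R^{k_0-c_0}$. Pairs $(I_1,T_1),\dots,(I_s,T_s)$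 with disjoint intervals $I_h$ form a *$(c_0,\alpha,\beta)$-splittable collection of $T$* if each of them is $(c_0,\alpha,\beta)$-splittable and $T_1,\dots,T_s$ partition $T$. **Tree descriptors.** Fix the constant $c$. Let $1\le k_0\le k$, $\delta\in(0,1)$, $I$ an interval, and $T\subseteq I^{k_0}$ a set of disjoint length-$k_0$ monotone subsequences of $f$. A *$(k,k_0,\delta)$-tree descriptor* of $(f,T,I)$ is a triple $(G,\varrho,\mathsf I)$, where $G$ is a rooted binary tree with $k_0$ leaves in which every non-leaf node has a left and a right child, $\varrho$ maps the nodes of $G$ to $\{1,\dots,\lceil\log(1/\delta)\rceil\}$, and $\mathsf I$ maps each node of $G$ to a set of sub-intervals of $I$, such that, with $r$ the root: * if $k_0=1$, then $2^{-\varrho(r)}\le|T|/|I|\le2^{-\varrho(r)+1}$ and $\mathsf I(r)=\{\{t\}:t\in T\}$; * if $k_0>1$ and $c_0$ is the number of leaves of the subtree of the left child of $r$, then the intervals in $\mathsf I(r)=\{I_1,\dots,I_s\}$ are disjoint, the pairs $(I_h,T_h)$ with $T_h=T\cap I_h^{k_0}$ form a $(c_0,\tfrac1{6k},2^{-\varrho(r)})$-splittable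 collection of $T$, $$2^{-\varrho(r)}\sum_{h=1}^s|I_h|\ \ge\ \frac{|T|}{P_c(k,\delta)^{k}},$$ and for each $h$ there is $(L_h,M_h,R_h)$ witnessing that $(I_h,T_h)$ is splittable such that the left subtree, with the restriction of $\varrho$ and with $v\mapsto\{J\in\mathsf I(v):J\subseteq L_h\}$, is a $(k,c_0,\delta)$-tree descriptor of $(f,T_h^{(L)},L_h)$, and the right subtree, with the restriction of $\varrho$ and with $v\mapsto\{J\in\mathsf I(v):J\subseteq R_h\}$, is a $(k,k_0-c_0,\delta)$-tree descriptor of $(f,T_h^{(R)},R_h)$. **Theorem.** For every constant $C>0$ there is a constant $c\in\mathbb N$ such that the following holds for all integers $k\ge1$, $n\ge0$, all $\varepsilon\in(0,1)$ and all $f:[n]\to\mathbb R$ that are $\varepsilon$-far from $(12\dots k)$-free. At least one of the following is true. 1. There are $\alpha\ge\varepsilon/P_c(k,\varepsilon)^{k}$ and a set $H\subseteq[n]$ of indices, each of which starts an $(\alpha,Ck\alpha)$-growing suffix of $f$ (in particular $\alpha,Ck\alpha\in[0,1]$ if $H\neq\emptyset$), with $$\alpha|H|\ \ge\ \frac{\varepsilon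 n}{P_c(k,\varepsilon)^{k}}.$$ 2. There are a set $T\subseteq[n]^k$ of disjoint length-$k$ monotone subsequences of $f$ with $$|T|\ \ge\ \frac{\varepsilon n}{P_c(k,\varepsilon)^{k^2}},$$ a number $\beta\in(0,1)$ with $\beta\ge\varepsilon/P_c(k,\varepsilon)^{k^2}$, and a $(k,k,\beta)$-tree descriptor of $(f,T,[n])$ (with the same constant $c$). -/

import Mathlib

/- Sequences `f : [n] → ℝ` with `[n] = {1, …, n}` are written as functions `f : ℕ → ℝ`; every
notion below only looks at the values of `f` on the interval (a finite set of naturals) it is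
given. -/

/-! ### Monotone subsequences and distance from freeness -/

/-- `x` is a length-`k` monotone subsequence (a `(12…k)`-pattern) of `f` lying in `I`:
`x₁ < … < x_k` are in `I` and `f x₁ < … < f x_k`. -/
def IsMonoTuple (f : ℕ → ℝ) (I : Finset ℕ) {k : ℕ} (x : Fin k → ℕ) : Prop :=
  (∀ i, x i ∈ I) ∧ StrictMono x ∧ StrictMono (fun i => f (x i))

/-- `T ⊆ I^k` is a set of pairwise disjoint monotone subsequences of `f`. -/
def IsDisjointMonoFamily (f : ℕ → ℝ) (I : Finset ℕ) {k : ℕ} (T : Finset (Fin k → ℕ)) : Prop :=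
  (∀ x ∈ T, IsMonoTuple f I x) ∧ ∀ x ∈ T, ∀ y ∈ T, x ≠ y → ∀ i j, x i ≠ y j

/-- `g : [n] → ℝ` is `(12…k)`-free. -/
def IsFree (n k : ℕ) (g : ℕ → ℝ) : Prop :=
  ∀ x : Fin k → ℕ, ¬ IsMonoTuple g (Finset.Icc 1 n) x

open Classical in
/-- `f : [n] → ℝ` is `ε`-far from `(12…k)`-free: every `(12…k)`-free `g : [n] → ℝ` differs from
`f` on at least `ε n` of the `n` indices. -/
def IsFarFromFree (n k : ℕ) (ε : ℝ) (f : ℕ → ℝ) : Prop :=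
  ∀ g : ℕ → ℝ, IsFree n k g →
    ε * (n : ℝ) ≤ (((Finset.Icc 1 n).filter (fun i => f i ≠ g i)).card : ℝ)

/-- The bound `poly(k, log(1/ε))`, with universal constant `c`: any polynomial in `k ≥ 1` and
`log₂(1/ε) ≥ 0` is at most `(c (k + log₂(1/ε)))^c` for a large enough constant `c`. -/
noncomputable def polyLog (c k : ℕ) (ε : ℝ) : ℝ :=
  ((c : ℝ) * ((k : ℝ) + Real.logb 2 (1 / ε))) ^ c

/-! ### Growing suffixes -/

/-- `S_t(a) = [a + 2^(t-1), a + 2^t) ∩ [n]`, for `t ≥ 1`. -/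
def suffixSegment (n a t : ℕ) : Finset ℕ :=
  Finset.Icc 1 n ∩ Finset.Ico (a + 2 ^ (t - 1)) (a + 2 ^ t)

/-- The index set `{1, …, η_a}` of the segments, where `η_a = ⌈log₂ (n - a)⌉`. -/
def suffixScales (n a : ℕ) : Finset ℕ := Finset.Icc 1 (Nat.clog 2 (n - a))

/-- `a ∈ [n]` starts an `(α, β)`-growing suffix of `f : [n] → ℝ`, where `α, β ∈ [0, 1]`. -/
def StartsGrowingSuffix (n : ℕ) (f : ℕ → ℝ) (α β : ℝ) (a : ℕ) : Prop :=
  α ∈ Set.Icc (0 : ℝ) 1 ∧ β ∈ Set.Icc (0 : ℝ) 1 ∧ a ∈ Finset.Icc 1 n ∧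
  ∃ D : ℕ → Finset ℕ,
    (∀ t ∈ suffixScales n a, D t ⊆ suffixSegment n a t) ∧
    (∀ t ∈ suffixScales n a, ((D t).card : ℝ) / ((suffixSegment n a t).card : ℝ) ≤ α) ∧
    β ≤ ∑ t ∈ suffixScales n a, ((D t).card : ℝ) / ((suffixSegment n a t).card : ℝ) ∧
    ∀ t ∈ suffixScales n a, ∀ t' ∈ suffixScales n a, t < t' →
      ∀ b ∈ D t, ∀ b' ∈ D t', f b < f b'

/-! ### Splittable intervals -/

/-- Intervals of natural numbers. -/
def IsInterval (J : Finset ℕ) : Prop := ∃ a b : ℕ, J = Finset.Icc a b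

/-- `T^(L)`: the prefixes of length `c` of the tuples in `T`. -/
def prefixes {c d : ℕ} (T : Finset (Fin (c + d) → ℕ)) : Finset (Fin c → ℕ) :=
  T.image (fun x i => x (Fin.castAdd d i))

/-- `T^(R)`: the suffixes of length `d` of the tuples in `T`. -/
def suffixes {c d : ℕ} (T : Finset (Fin (c + d) → ℕ)) : Finset (Fin d → ℕ) :=
  T.image (fun x j => x (Fin.natAdd c j))

/-- `T ∩ J^k`. -/
def tuplesIn {k : ℕ} (T : Finset (Fin k → ℕ)) (J : Finset ℕ) : Finset (Fin k → ℕ) :=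
  T.filter (fun x => ∀ i, x i ∈ J)

/-- `I` is partitioned into three adjacent intervals `L`, `M`, `R`, from left to right. -/
def IsThreePartition (I L M R : Finset ℕ) : Prop :=
  IsInterval L ∧ IsInterval M ∧ IsInterval R ∧ L ∪ M ∪ R = I ∧
  (∀ a ∈ L, ∀ b ∈ M, a < b) ∧ (∀ a ∈ M, ∀ b ∈ R, a < b) ∧ (∀ a ∈ L, ∀ b ∈ R, a < b)

/-- `(L, M, R)` witnesses that the pair `(I, T)` is `(c, α, β)`-splittable; here the tuples of `T`
have length `k₀ = c + d`. The lower bound on the size of the (middle) buffer interval `M` is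
rounded down to an integer: `M` may be empty when `α |I| < 1`, as it has to be when the elements
of `I` are consecutive entries of a single tuple. -/
def SplitsVia (f : ℕ → ℝ) {c d : ℕ} (α β : ℝ) (I : Finset ℕ) (T : Finset (Fin (c + d) → ℕ))
    (L M R : Finset ℕ) : Prop :=
  β ≤ (T.card : ℝ) / (I.card : ℝ) ∧
  (∀ x ∈ prefixes T, ∀ y ∈ suffixes T, ∀ i : Fin c, ∀ j : Fin d,
    (i : ℕ) + 1 = c → (j : ℕ) = 0 → f (x i) < f (y j)) ∧
  IsThreePartition I L M R ∧
  α * (I.card : ℝ) ≤ (L.card : ℝ) ∧ ⌊α * (I.card : ℝ)⌋₊ ≤ M.card ∧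
  α * (I.card : ℝ) ≤ (R.card : ℝ) ∧
  (∀ x ∈ prefixes T, ∀ i, x i ∈ L) ∧ (∀ y ∈ suffixes T, ∀ j, y j ∈ R)

/-- The pair `(I, T)` is `(c, α, β)`-splittable. -/
def IsSplittable (f : ℕ → ℝ) {c d : ℕ} (α β : ℝ) (I : Finset ℕ)
    (T : Finset (Fin (c + d) → ℕ)) : Prop :=
  IsInterval I ∧ ∃ L M R, SplitsVia f α β I T L M R

/-- For the intervals `J ∈ 𝓙`, the pairs `(J, T ∩ J^k₀)` form a `(c, α, β)`-splittable
collection of `T`: the intervals are disjoint, each pair is splittable, and the sets `T ∩ J^k₀`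
partition `T` (they are disjoint since the intervals are). -/
def IsSplittableCollection (f : ℕ → ℝ) {c d : ℕ} (α β : ℝ) (𝓙 : Finset (Finset ℕ))
    (T : Finset (Fin (c + d) → ℕ)) : Prop :=
  (∀ J ∈ 𝓙, ∀ J' ∈ 𝓙, J ≠ J' → Disjoint J J') ∧
  (∀ J ∈ 𝓙, IsSplittable f α β J (tuplesIn T J)) ∧
  ∀ x ∈ T, ∃ J ∈ 𝓙, x ∈ tuplesIn T J

/-! ### Tree descriptors -/

/-- Rooted binary trees with `k` leaves, in which every non-leaf node has a left child (edge
labeled `0`) and a right child (edge labeled `1`). -/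
inductive BinTree : ℕ → Type
  | leaf : BinTree 1
  | node {c d : ℕ} (l : BinTree c) (r : BinTree d) : BinTree (c + d)

/-- A node of a tree is addressed by the word of edge labels on the path from the root to it
(`false` is the label `0`, `true` is the label `1`); the root is the empty word. -/
def BinTree.IsNode : {k : ℕ} → BinTree k → List Bool → Prop
  | _, .leaf, v => v = []
  | _, .node _ _, [] => True
  | _, .node l _, false :: v => l.IsNode v
  | _, .node _ r, true :: v => r.IsNode v

/-- `(G, ϱ)` is a weighted tree with parameter `δ`: `ϱ` maps the nodes of `G` to
`{1, …, ⌈log₂ (1/δ)⌉}`. -/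
def BinTree.IsWeighted {k₀ : ℕ} (G : BinTree k₀) (δ : ℝ) (ϱ : List Bool → ℕ) : Prop :=
  ∀ v, G.IsNode v → 1 ≤ ϱ v ∧ ϱ v ≤ ⌈Real.logb 2 (1 / δ)⌉₊

/-- The recursive conditions for `(G, ϱ, Iv)` to be a `(k, k₀, δ)`-tree descriptor of `(f, T, I)`.
The constant `C₀` is the one of the bound `poly(k, log(1/δ))`. The labelings of the left subtree
are `v ↦ ϱ (false :: v)` and `v ↦ {J ∈ Iv (false :: v) : J ⊆ L}`, and similarly on the right. -/
def BinTree.Describes (C₀ k : ℕ) (δ : ℝ) (f : ℕ → ℝ) :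
    {k₀ : ℕ} → BinTree k₀ → (List Bool → ℕ) → (List Bool → Finset (Finset ℕ)) →
      Finset (Fin k₀ → ℕ) → Finset ℕ → Prop
  | _, .leaf, ϱ, Iv, T, I =>
      ((1 : ℝ) / 2) ^ ϱ [] ≤ (T.card : ℝ) / (I.card : ℝ) ∧
      (T.card : ℝ) / (I.card : ℝ) ≤ 2 * ((1 : ℝ) / 2) ^ ϱ [] ∧
      Iv [] = T.image (fun x => {x 0})
  | _, .node l r, ϱ, Iv, T, I =>
      (∀ J ∈ Iv [], J ⊆ I) ∧
      IsSplittableCollection f (1 / (6 * (k : ℝ))) (((1 : ℝ) / 2) ^ ϱ []) (Iv []) T ∧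
      (T.card : ℝ) / polyLog C₀ k δ ^ k ≤ ((1 : ℝ) / 2) ^ ϱ [] * ∑ J ∈ Iv [], (J.card : ℝ) ∧
      ∀ J ∈ Iv [], ∃ L M R : Finset ℕ,
        SplitsVia f (1 / (6 * (k : ℝ))) (((1 : ℝ) / 2) ^ ϱ []) J (tuplesIn T J) L M R ∧
        l.Describes C₀ k δ f (fun v => ϱ (false :: v))
          (fun v => (Iv (false :: v)).filter (fun K => K ⊆ L)) (prefixes (tuplesIn T J)) L ∧
        r.Describes C₀ k δ f (fun v => ϱ (true :: v))
          (fun v => (Iv (true :: v)).filter (fun K => K ⊆ R)) (suffixes (tuplesIn T J)) R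

/-- `(G, ϱ, Iv)` is a `(k, k₀, δ)`-tree descriptor of `(f, T, I)`: `(G, ϱ)` is a
`(k₀, δ)`-weighted tree, `Iv` maps nodes of `G` to sets of sub-intervals of `I`, and the recursive
conditions hold. -/
def IsTreeDescriptor (C₀ k : ℕ) (δ : ℝ) (f : ℕ → ℝ) {k₀ : ℕ} (G : BinTree k₀)
    (ϱ : List Bool → ℕ) (Iv : List Bool → Finset (Finset ℕ))
    (T : Finset (Fin k₀ → ℕ)) (I : Finset ℕ) : Prop :=
  G.IsWeighted δ ϱ ∧ (∀ v, G.IsNode v → ∀ J ∈ Iv v, IsInterval J ∧ J ⊆ I) ∧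
  G.Describes C₀ k δ f ϱ Iv T I

/-! Being far from free yields a disjoint family of at least `ε n / k` monotone tuples
(`exists_family_of_far`). The rest is a dichotomy for such families, applied recursively.

Dichotomy (`growing_or_split`). Re-select tuples from the entries of the family greedily in
lexicographic order, and keep those whose longest jump `u < v` between consecutive entries is at one
common position. Let each index `a` in roughly the second quarter of the gap from `u` to `v` count
the tuple with weight `1 / (v - u)`. The total weight is comparable to the number of tuples, and the
second moment is of the same order because the left ends are distinct (`sum_sq_crossingDensity_le`).
Hence a constant fraction of the weight sits at indices `a` of moderate density `s`. At such an `a`,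
sort the tuples by the dyadic scale of `v - a`. If no scale exceeds density `s / K`, the points `v`
form a growing suffix at `a`, as greediness makes `f (v x)` increase between well separated scales
(`IsGapSystem.f_lt`). If some scale is denser, its tuples live in one interval around `a`; prefixes
of those with `f (u x)` below the median and suffixes of those above make this interval splittable
(`exists_splitPiece`). A Vitali covering makes the intervals disjoint.

Recursion (`growing_or_tree`). The dichotomy is repeated on the prefixes and on the suffixes. If
growing suffixes account for half of the family, their weights add up over the disjoint intervals.
Otherwise every remaining interval has a tree on each side, and a pigeonhole over all labeled trees
makes the intervals agree on a single one. This pigeonhole costs `(2 * D + 2) ^ (2 * k)` per level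
and is the source of the exponent `k ^ 2`. The two sides of an interval must carry equally many
tuples, so all sizes are powers of two, to which families can be cut down exactly
(`HasTreeFamily.truncate`). As `f` is smaller on all left entries than on all right ones, left and
right tuples may be paired arbitrarily. So the recursion keeps only index sets, and tuples are
assembled at the end (`HasTreeFamily.exists_describes`). -/

/-! ### Greedy families of disjoint monotone subsequences -/

/-- The indices occurring in the tuples of `T`. -/
def entries {m : ℕ} (T : Finset (Fin m → ℕ)) : Finset ℕ :=
  T.biUnion fun x => Finset.univ.image x

lemma mem_entries {m : ℕ} {T : Finset (Fin m → ℕ)} {a : ℕ} :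
    a ∈ entries T ↔ ∃ x ∈ T, ∃ i, x i = a := by
  simp [entries]

lemma card_entries_le {m : ℕ} (T : Finset (Fin m → ℕ)) : (entries T).card ≤ m * T.card := by
  rw [mul_comm]
  refine Finset.card_biUnion_le_card_mul _ _ _ fun x _ => ?_
  exact Finset.card_image_le.trans (by simp)

/-- A disjoint family of monotone subsequences that is selected greedily in lexicographic order:
it is maximal, and an entry cannot be replaced by an earlier one from a later tuple. -/
lemma exists_lex_greedy (f : ℕ → ℝ) (m : ℕ) (E : Finset ℕ) :
    ∃ T : Finset (Fin (m + 1) → ℕ), IsDisjointMonoFamily f E T ∧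
      (∀ x : Fin (m + 1) → ℕ, IsMonoTuple f E x → ∃ i, x i ∈ entries T) ∧
      ∀ x ∈ T, ∀ y ∈ T, x 0 < y 0 → ∀ i j : Fin (m + 1), (i : ℕ) + 1 = j →
        x i < y j → f (x i) < f (y j) → x j ≤ y j := by
  classical
  induction E using Finset.strongInduction with
  | H E ih =>
  by_cases hE : ∃ x : Fin (m + 1) → ℕ, IsMonoTuple f E x
  swap
  · exact ⟨∅, by simp [IsDisjointMonoFamily], fun x hx => (hE ⟨x, hx⟩).elim, by simp⟩
  let F := (Fintype.piFinset fun _ : Fin (m + 1) => E).filter fun x => IsMonoTuple f E x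
  have hF : ∀ x, x ∈ F ↔ IsMonoTuple f E x := by
    intro x
    simp only [F, Finset.mem_filter, Fintype.mem_piFinset, and_iff_right_iff_imp]
    exact fun h => h.1
  -- The lexicographically least tuple is taken; the others come from the induction hypothesis,
  -- applied after deleting its entries.
  obtain ⟨x, hxF, hmin⟩ := Finset.exists_min_image F (fun x => toLex x)
    (hE.imp fun x hx => (hF x).2 hx)
  have hx := (hF x).1 hxF
  obtain ⟨T, hT, hmax, hlex⟩ := ih (E \ Finset.univ.image x) (by
    refine Finset.sdiff_ssubset ?_ ⟨x 0, by simp⟩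
    intro a ha
    obtain ⟨i, -, rfl⟩ := Finset.mem_image.1 ha
    exact hx.1 i)
  have hTE : ∀ y ∈ T, IsMonoTuple f E y := fun y hy =>
    ⟨fun i => (Finset.mem_sdiff.1 ((hT.1 y hy).1 i)).1, (hT.1 y hy).2⟩
  have hxy : ∀ y ∈ T, ∀ i j, x i ≠ y j := by
    intro y hy i j h
    have := (Finset.mem_sdiff.1 ((hT.1 y hy).1 j)).2
    exact this (Finset.mem_image.2 ⟨i, Finset.mem_univ _, h⟩)
  have hnlt : ∀ z, IsMonoTuple f E z → ∀ j, (∀ i < j, z i = x i) → x j ≤ z j := by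
    intro z hz j hj
    by_contra hlt
    push Not at hlt
    exact absurd (hmin z ((hF z).2 hz)) (not_le.2 ⟨j, hj, hlt⟩)
  refine ⟨insert x T, ⟨?_, ?_⟩, ?_, ?_⟩
  · intro y hy
    rcases Finset.mem_insert.1 hy with rfl | hy
    exacts [hx, hTE y hy]
  · intro y hy z hz hne i j
    rcases Finset.mem_insert.1 hy with rfl | hyT <;> rcases Finset.mem_insert.1 hz with rfl | hzT
    · exact (hne rfl).elim
    · exact hxy z hzT i j
    · exact (hxy y hyT j i).symm
    · exact hT.2 y hyT z hzT hne i j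
  · intro y hy
    by_cases h : ∃ i, y i ∈ Finset.univ.image x
    · obtain ⟨i, hi⟩ := h
      obtain ⟨j, -, hj⟩ := Finset.mem_image.1 hi
      exact ⟨i, mem_entries.2 ⟨x, Finset.mem_insert_self _ _, j, hj⟩⟩
    · push Not at h
      obtain ⟨i, hi⟩ := hmax y ⟨fun i => Finset.mem_sdiff.2 ⟨hy.1 i, h i⟩, hy.2⟩
      obtain ⟨z, hz, j, hj⟩ := mem_entries.1 hi
      exact ⟨i, mem_entries.2 ⟨z, Finset.mem_insert_of_mem hz, j, hj⟩⟩
  · intro y hy z hz h0 i j hij hlt hflt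
    rcases Finset.mem_insert.1 hy with rfl | hyT <;> rcases Finset.mem_insert.1 hz with rfl | hzT
    · exact (lt_irrefl _ h0).elim
    · have hz' := hTE z hzT
      have hzm : ∀ b, ¬ b < j → z j ≤ z b ∧ f (z j) ≤ f (z b) := fun b hb =>
        ⟨hz'.2.1.monotone (not_lt.1 hb), hz'.2.2.monotone (not_lt.1 hb)⟩
      have hym : ∀ a, a < j → y a ≤ y i ∧ f (y a) ≤ f (y i) := by
        intro a ha
        have hai : a ≤ i := by rw [Fin.le_def]; rw [Fin.lt_def] at ha; omega
        exact ⟨hx.2.1.monotone hai, hx.2.2.monotone hai⟩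
      -- Splice `y` before `j` with `z` from `j` on. The result agrees with the minimal tuple `y`
      -- before `j`, so minimality compares the entries at `j`.
      let w : Fin (m + 1) → ℕ := fun a => if a < j then y a else z a
      have hw : IsMonoTuple f E w := by
        refine ⟨fun a => ?_, fun a b hab => ?_, fun a b hab => ?_⟩
        · by_cases ha : a < j <;> simp only [w, ha, if_true, if_false]
          exacts [hx.1 a, hz'.1 a]
        · by_cases hb : b < j
          · simp only [w, hb, hab.trans hb, if_true]; exact hx.2.1 hab
          · by_cases ha : a < j <;> simp only [w, ha, hb, if_true, if_false]
            · exact ((hym a ha).1.trans_lt hlt).trans_le (hzm b hb).1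
            · exact hz'.2.1 hab
        · by_cases hb : b < j
          · simp only [w, hb, hab.trans hb, if_true]; exact hx.2.2 hab
          · by_cases ha : a < j <;> simp only [w, ha, hb, if_true, if_false]
            · exact ((hym a ha).2.trans_lt hflt).trans_le (hzm b hb).2
            · exact hz'.2.2 hab
      have := hnlt w hw j fun a ha => by simp [w, ha]
      simpa [w] using this
    · have := hnlt y (hTE y hyT) 0 fun i hi => (Fin.not_lt_zero i hi).elim
      omega
    · exact hlex y hyT z hzT h0 i j hij hlt hflt

/-- A function that is far from free has many disjoint monotone subsequences. -/
lemma exists_family_of_far {n k : ℕ} {ε : ℝ} {f : ℕ → ℝ} (hk : 1 ≤ k) (hε : ε < 1)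
    (hfar : IsFarFromFree n k ε f) :
    ∃ T : Finset (Fin k → ℕ), IsDisjointMonoFamily f (Finset.Icc 1 n) T ∧
      ε * n ≤ k * T.card := by
  classical
  obtain ⟨m, rfl⟩ : ∃ m, k = m + 1 := ⟨k - 1, by omega⟩
  obtain ⟨T, hT, hmax, -⟩ := exists_lex_greedy f m (Finset.Icc 1 n)
  refine ⟨T, hT, ?_⟩
  have hcard : ((entries T).card : ℝ) ≤ ((m + 1 : ℕ) : ℝ) * T.card := by
    exact_mod_cast card_entries_le T
  refine le_trans ?_ hcard
  by_cases hN : (Finset.Icc 1 n \ entries T).Nonempty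
  swap
  · have h1 : Finset.Icc 1 n ⊆ entries T := by
      rwa [Finset.not_nonempty_iff_eq_empty, Finset.sdiff_eq_empty_iff_subset] at hN
    have h2 : (n : ℝ) ≤ (entries T).card := by
      have := Finset.card_le_card h1
      rw [Nat.card_Icc] at this
      exact_mod_cast (by omega : n ≤ (entries T).card)
    nlinarith [(Nat.cast_nonneg n : (0 : ℝ) ≤ n)]
  set N := Finset.Icc 1 n \ entries T with hNdef
  -- `σ i` is the last index `≤ i` outside the family, or the first one outside if none precedes
  -- `i`. As `σ` is monotone, it would send a monotone tuple of `f ∘ σ` to one of `f` that avoids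
  -- the family, against maximality. So `f ∘ σ` is free, and it differs from `f` only on the
  -- entries.
  let σ : ℕ → ℕ := fun i =>
    if h : (N.filter (· ≤ i)).Nonempty then (N.filter (· ≤ i)).max' h else N.min' hN
  have hσN : ∀ i, σ i ∈ N := by
    intro i
    by_cases h : (N.filter (· ≤ i)).Nonempty
    · simp only [σ, h, dif_pos]
      exact (Finset.mem_filter.1 (Finset.max'_mem _ h)).1
    · simp only [σ, h, dif_neg, not_false_eq_true]
      exact Finset.min'_mem _ _
  have hσid : ∀ i ∈ N, σ i = i := by
    intro i hi
    have hmem : i ∈ N.filter (· ≤ i) := by simp [hi]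
    have h : (N.filter (· ≤ i)).Nonempty := ⟨i, hmem⟩
    simp only [σ, h, dif_pos]
    exact le_antisymm (Finset.mem_filter.1 (Finset.max'_mem _ h)).2 (Finset.le_max' _ _ hmem)
  have hσm : Monotone σ := by
    intro i j hij
    by_cases h : (N.filter (· ≤ i)).Nonempty
    · have hsub : N.filter (· ≤ i) ⊆ N.filter (· ≤ j) := by
        intro a ha
        rw [Finset.mem_filter] at ha ⊢
        exact ⟨ha.1, ha.2.trans hij⟩
      have h' : (N.filter (· ≤ j)).Nonempty := h.mono hsub
      simp only [σ, h, h', dif_pos]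
      exact Finset.max'_subset h hsub
    · have : σ i = N.min' hN := by simp only [σ, h, dif_neg, not_false_eq_true]
      rw [this]
      exact Finset.min'_le _ _ (hσN j)
  have hfree : IsFree n (m + 1) (fun i => f (σ i)) := by
    intro x hx
    have hinj : Function.Injective fun i => σ (x i) := fun a b hab =>
      hx.2.2.injective (congrArg f hab)
    have hmono : IsMonoTuple f (Finset.Icc 1 n) fun i => σ (x i) :=
      ⟨fun i => (Finset.mem_sdiff.1 (hσN _)).1,
        (hσm.comp hx.2.1.monotone).strictMono_of_injective hinj, hx.2.2⟩
    obtain ⟨i, hi⟩ := hmax _ hmono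
    exact (Finset.mem_sdiff.1 (hσN (x i))).2 hi
  refine (hfar _ hfree).trans ?_
  norm_cast
  refine Finset.card_le_card fun i hi => ?_
  rw [Finset.mem_filter] at hi
  by_contra hne
  exact hi.2 (by rw [hσid i (Finset.mem_sdiff.2 ⟨hi.1, hne⟩)])

/-! ### Cuts of gaps -/

/-- The indices in the middle part of the gap between the indices `u < v`. -/
def gapCut (u v : ℕ) : Finset ℕ :=
  (Finset.Ico u v).filter fun a => v - u ≤ 4 * (a + 1 - u) ∧ v - u + 1 ≤ 2 * (v - a)

lemma mem_gapCut {u v a : ℕ} :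
    a ∈ gapCut u v ↔ (u ≤ a ∧ a < v) ∧ v - u ≤ 4 * (a + 1 - u) ∧ v - u + 1 ≤ 2 * (v - a) := by
  simp [gapCut]

lemma card_gapCut_le (u v : ℕ) : (gapCut u v).card ≤ v - u :=
  (Finset.card_filter_le _ _).trans (by simp)

/-- A cut leaves about a quarter of the gap on its left but half on its right, because the buffer
`M` is later taken from the right side. The off-by-ones keep the cut nonempty when `v = u + 1`. -/
lemma le_card_gapCut {u v : ℕ} (h : u < v) : v - u ≤ 4 * (gapCut u v).card := by
  have : Finset.Icc (u + (v - u + 3) / 4 - 1) (v - (v - u + 2) / 2) ⊆ gapCut u v := by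
    intro a ha
    rw [Finset.mem_Icc] at ha
    rw [mem_gapCut]
    omega
  have := Finset.card_le_card this
  rw [Nat.card_Icc] at this
  omega

/-! ### First and second moments of the crossing density. -/

section Crossing

variable {ι : Type*} (T : Finset ι) (u v : ι → ℕ)

/-- The elements of `T` whose gap is cut by `a`. -/
def crossing (a : ℕ) : Finset ι := T.filter fun x => a ∈ gapCut (u x) (v x)

/-- The number of the gaps cut by `a`, each weighted by the inverse of its length. -/
noncomputable def crossingDensity (a : ℕ) : ℝ :=
  ∑ x ∈ crossing T u v a, 1 / ((v x - u x : ℕ) : ℝ)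

variable {T u v}

lemma mem_crossing {a : ℕ} {x : ι} :
    x ∈ crossing T u v a ↔ x ∈ T ∧ a ∈ gapCut (u x) (v x) := by
  simp [crossing]

lemma crossingDensity_nonneg (a : ℕ) : 0 ≤ crossingDensity T u v a :=
  Finset.sum_nonneg fun _ _ => by positivity

lemma crossingDensity_eq (a : ℕ) : crossingDensity T u v a =
    ∑ x ∈ T, if a ∈ gapCut (u x) (v x) then 1 / ((v x - u x : ℕ) : ℝ) else 0 := by
  rw [crossingDensity, crossing, Finset.sum_filter]

/-- Each gap contributes its number of cuts divided by its length, which is at least `1 / 4`. -/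
lemma card_le_sum_crossingDensity {I : Finset ℕ} (huv : ∀ x ∈ T, u x < v x)
    (hI : ∀ x ∈ T, Finset.Ico (u x) (v x) ⊆ I) :
    (T.card : ℝ) ≤ 4 * ∑ a ∈ I, crossingDensity T u v a := by
  simp only [crossingDensity_eq]
  rw [Finset.sum_comm, Finset.mul_sum, Finset.card_eq_sum_ones, Nat.cast_sum]
  refine Finset.sum_le_sum fun x hx => ?_
  have hsub : gapCut (u x) (v x) ⊆ I := (Finset.filter_subset _ _).trans (hI x hx)
  rw [← Finset.sum_filter, Finset.filter_mem_eq_inter, Finset.inter_eq_right.2 hsub,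
    Finset.sum_const, nsmul_eq_mul]
  have h1 := le_card_gapCut (huv x hx)
  have h2 : (0 : ℝ) < ((v x - u x : ℕ) : ℝ) := by
    have := huv x hx
    exact_mod_cast (by omega : 0 < v x - u x)
  have h3 : ((v x - u x : ℕ) : ℝ) ≤ 4 * (gapCut (u x) (v x)).card := by exact_mod_cast h1
  rw [mul_one_div, mul_div_assoc', le_div_iff₀ h2]
  simpa using h3

/-- Expand the square into pairs of gaps and charge each pair to its longer gap, of length `g`. A
pair contributes at most `1 / g`. At most `2 * g` gaps no longer than `g` share a cut with the given
one, since their left ends are distinct and lie in a window of length `2 * g`. So each gap is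
charged at most 2, doubled for the two orders of a pair. -/
lemma sum_sq_crossingDensity_le [DecidableEq ι] {I : Finset ℕ} (huv : ∀ x ∈ T, u x < v x)
    (hu : Set.InjOn u T) :
    ∑ a ∈ I, crossingDensity T u v a ^ 2 ≤ 4 * T.card := by
  let g : ι → ℕ := fun x => v x - u x
  have hg : ∀ x ∈ T, (0 : ℝ) < (g x : ℝ) := fun x hx => by
    have := huv x hx
    exact_mod_cast (by simp only [g]; omega : 0 < g x)
  let w : ι → ℕ → ℝ := fun x a => if a ∈ gapCut (u x) (v x) then 1 / (g x : ℝ) else 0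
  let F : ι → ι → ℝ := fun x y => ∑ a ∈ I, w x a * w y a
  have hw : ∀ x a, 0 ≤ w x a := fun x a => by simp only [w]; split_ifs <;> positivity
  have hF : ∀ x y, 0 ≤ F x y := fun x y =>
    Finset.sum_nonneg fun a _ => mul_nonneg (hw x a) (hw y a)
  have hFc : ∀ x y, F x y = F y x := fun x y => Finset.sum_congr rfl fun a _ => mul_comm _ _
  have h1 : ∑ a ∈ I, crossingDensity T u v a ^ 2 = ∑ x ∈ T, ∑ y ∈ T, F x y := by
    simp only [crossingDensity_eq, sq, Finset.sum_mul_sum, F]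
    rw [Finset.sum_comm]
    refine Finset.sum_congr rfl fun x _ => ?_
    rw [Finset.sum_comm]
  have h2 : ∑ x ∈ T, ∑ y ∈ T, F x y ≤
      2 * ∑ x ∈ T, ∑ y ∈ T, if g y ≤ g x then F x y else 0 := by
    have h3 : ∑ x ∈ T, ∑ y ∈ T, (if g y ≤ g x then F x y else 0) =
        ∑ x ∈ T, ∑ y ∈ T, if g x ≤ g y then F x y else 0 := by
      rw [Finset.sum_comm]
      simp only [hFc]
    calc _ ≤ ∑ x ∈ T, ∑ y ∈ T, ((if g y ≤ g x then F x y else 0) +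
            if g x ≤ g y then F x y else 0) := by
          refine Finset.sum_le_sum fun x _ => Finset.sum_le_sum fun y _ => ?_
          have := hF x y
          rcases le_total (g y) (g x) with h | h <;> simp only [h, if_true] <;>
            split_ifs <;> linarith
      _ = _ := by
          simp only [Finset.sum_add_distrib]
          rw [← h3]
          ring
  have h4 : ∀ x ∈ T, ∑ y ∈ T, (if g y ≤ g x then F x y else 0) ≤ 2 := by
    intro x hx
    have hbound : ∀ y ∈ T, F x y ≤ 1 / (g x : ℝ) := by
      intro y hy
      calc F x y ≤ ∑ a ∈ I, (1 / (g x : ℝ)) * w y a := by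
            refine Finset.sum_le_sum fun a _ => mul_le_mul_of_nonneg_right ?_ (hw y a)
            have := hg x hx
            simp only [w]; split_ifs
            · exact le_rfl
            · positivity
        _ = (1 / (g x : ℝ)) * ∑ a ∈ I, w y a := by rw [Finset.mul_sum]
        _ ≤ (1 / (g x : ℝ)) * 1 := by
            have hgx := hg x hx
            refine mul_le_mul_of_nonneg_left ?_ (by positivity)
            simp only [w]
            rw [← Finset.sum_filter, Finset.sum_const, nsmul_eq_mul]
            have hgy := hg y hy
            rw [mul_one_div, div_le_one hgy]
            have : (I.filter (· ∈ gapCut (u y) (v y))).card ≤ g y := by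
              refine le_trans (Finset.card_le_card fun a ha => ?_) (card_gapCut_le (u y) (v y))
              exact (Finset.mem_filter.1 ha).2
            exact_mod_cast this
        _ = _ := mul_one _
    let Y := T.filter fun y => g y ≤ g x ∧ u y < v x ∧ u x < u y + g x
    have hY : (Y.card : ℝ) ≤ 2 * g x := by
      have h5 : (Y.image u) ⊆ Finset.Ico (u x + 1 - g x) (v x) := by
        intro b hb
        obtain ⟨y, hy, rfl⟩ := Finset.mem_image.1 hb
        obtain ⟨-, -, h7, h8⟩ := Finset.mem_filter.1 hy
        rw [Finset.mem_Ico]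
        omega
      have h6 := Finset.card_le_card h5
      have h9 : (Y.image u).card = Y.card :=
        Finset.card_image_of_injOn (hu.mono fun y hy => (Finset.mem_filter.1 hy).1)
      rw [h9, Nat.card_Ico] at h6
      have := huv x hx
      have h8 : g x = v x - u x := rfl
      have h7 : Y.card ≤ 2 * g x := by omega
      exact_mod_cast h7
    have hgx := hg x hx
    calc _ ≤ ∑ y ∈ T, if g y ≤ g x ∧ u y < v x ∧ u x < u y + g x then 1 / (g x : ℝ) else 0 := by
          refine Finset.sum_le_sum fun y hy => ?_
          by_cases h5 : g y ≤ g x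
          · by_cases h6 : u y < v x ∧ u x < u y + g x
            · simp only [h5, h6, if_true, and_self]; exact hbound y hy
            · have : F x y = 0 := by
                refine Finset.sum_eq_zero fun a _ => ?_
                by_contra hne
                have h7 : a ∈ gapCut (u x) (v x) := by
                  by_contra h7; exact hne (by simp [w, h7])
                have h8 : a ∈ gapCut (u y) (v y) := by
                  by_contra h8; exact hne (by simp [w, h8])
                rw [mem_gapCut] at h7 h8
                have := huv y hy
                simp only [g] at h5 h6
                omega
              rw [this]
              split_ifs <;> positivity
          · simp only [h5, if_false, false_and]; exact le_rfl
      _ = Y.card * (1 / (g x : ℝ)) := by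
          rw [← Finset.sum_filter, Finset.sum_const, nsmul_eq_mul]
      _ ≤ 2 := by
          rw [mul_one_div, div_le_iff₀ hgx]
          exact hY
  have h5 := Finset.sum_le_sum h4
  rw [Finset.sum_const, nsmul_eq_mul] at h5
  rw [h1]
  linarith

/-- A constant fraction of the total crossing density is carried by the indices where it is
neither too small nor too large. -/
lemma card_le_sum_moderate [DecidableEq ι] {I : Finset ℕ} (huv : ∀ x ∈ T, u x < v x)
    (hu : Set.InjOn u T) (hI : ∀ x ∈ T, Finset.Ico (u x) (v x) ⊆ I) :
    (T.card : ℝ) ≤ 16 * ∑ a ∈ I.filter fun a =>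
      (T.card : ℝ) / (16 * I.card) ≤ crossingDensity T u v a ∧ crossingDensity T u v a < 32,
      crossingDensity T u v a := by
  set S := crossingDensity T u v
  have hS : ∀ a, 0 ≤ S a := crossingDensity_nonneg
  have h1 : (T.card : ℝ) ≤ 4 * ∑ a ∈ I, S a := card_le_sum_crossingDensity huv hI
  have h2 : ∑ a ∈ I, S a ^ 2 ≤ 4 * T.card := sum_sq_crossingDensity_le huv hu
  -- A value that is too large is at most `S a ^ 2 / 32`, and one that is too small is below the
  -- threshold. These sum to at most `|T| / 8` and `|T| / 16`, out of a total of at least `|T| / 4`.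
  have h3 : ∑ a ∈ I, S a ≤ ∑ a ∈ I, ((if (T.card : ℝ) / (16 * I.card) ≤ S a ∧ S a < 32 then S a
      else 0) + S a ^ 2 / 32 + (T.card : ℝ) / (16 * I.card)) := by
    refine Finset.sum_le_sum fun a _ => ?_
    have := hS a
    have hd : 0 ≤ (T.card : ℝ) / (16 * I.card) := by positivity
    split_ifs with h
    · nlinarith [sq_nonneg (S a)]
    · rw [not_and_or, not_le, not_lt] at h
      rcases h with h | h
      · nlinarith [sq_nonneg (S a)]
      · nlinarith
  rw [Finset.sum_add_distrib, Finset.sum_add_distrib, ← Finset.sum_filter, ← Finset.sum_div,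
    Finset.sum_const, nsmul_eq_mul] at h3
  have h4 : (I.card : ℝ) * ((T.card : ℝ) / (16 * I.card)) ≤ T.card / 16 := by
    rcases Nat.eq_zero_or_pos I.card with h | h
    · rw [h]; simp; positivity
    · have : (0 : ℝ) < I.card := by exact_mod_cast h
      apply le_of_eq
      field_simp
  linarith

end Crossing

/-! ### Growing suffixes from gaps at many scales -/

/-- The elements of `T` whose gap is cut by `a`, with right end in `[a + 2 ^ e, a + 2 ^ (e + 1))`. -/
def crossingAt {ι : Type*} (T : Finset ι) (u v : ι → ℕ) (a e : ℕ) : Finset ι :=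
  (crossing T u v a).filter fun x => Nat.log 2 (v x - a) = e

lemma card_suffixSegment {n a t : ℕ} (ht : 1 ≤ t) (h : a + 2 ^ t ≤ n) :
    (suffixSegment n a t).card = 2 ^ (t - 1) := by
  obtain ⟨e, rfl⟩ : ∃ e, t = e + 1 := ⟨t - 1, by omega⟩
  have h2 : 0 < 2 ^ e := by positivity
  rw [pow_succ] at h
  have : suffixSegment n a (e + 1) = Finset.Ico (a + 2 ^ e) (a + 2 ^ (e + 1)) := by
    rw [suffixSegment, Nat.add_sub_cancel]
    refine Finset.inter_eq_right.2 fun b hb => ?_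
    rw [Finset.mem_Ico, pow_succ] at hb
    rw [Finset.mem_Icc]
    omega
  rw [this, Nat.card_Ico, pow_succ, Nat.add_sub_cancel]
  omega

/-- Families of gaps `(u x, v x)` in `[1, n]`, coming from tuples that start at `lo x`, in which
no right end of a gap can be replaced by an earlier one that belongs to a later tuple. -/
structure IsGapSystem {ι : Type*} (n k : ℕ) (f : ℕ → ℝ) (T : Finset ι) (lo u v : ι → ℕ) :
    Prop where
  one_le : ∀ x ∈ T, 1 ≤ lo x
  lo_le : ∀ x ∈ T, lo x ≤ u x
  lt : ∀ x ∈ T, u x < v x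
  le_n : ∀ x ∈ T, v x ≤ n
  span : ∀ x ∈ T, v x ≤ lo x + k * (v x - u x)
  lt_f : ∀ x ∈ T, f (u x) < f (v x)
  inj_lo : Set.InjOn lo T
  inj_u : Set.InjOn u T
  inj_v : Set.InjOn v T
  lex : ∀ x ∈ T, ∀ y ∈ T, lo x < lo y → u x < v y → f (u x) < f (v y) → v x ≤ v y

/-- If `f (v y) ≤ f (v x)`, then `v x` could follow `u y` in place of `v y`. If `y` starts before
`x`, greediness gives `v y ≤ v x`, contrary to the scales. And `y` cannot start after `x`: from `lo
x` to `v x` there are at most `4 * k * 2 ^ e` steps, whereas `u y` is at least about `2 ^ e' / 4` to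
the left of `a`. -/
lemma IsGapSystem.f_lt {ι : Type*} {n k : ℕ} {f : ℕ → ℝ} {T : Finset ι} {lo u v : ι → ℕ}
    (h : IsGapSystem n k f T lo u v) {a e e' : ℕ} (he : 16 * k * 2 ^ e ≤ 2 ^ e') (hk : 1 ≤ k)
    {x y : ι} (hx : x ∈ crossingAt T u v a e) (hy : y ∈ crossingAt T u v a e') :
    f (v x) < f (v y) := by
  obtain ⟨hxc, hxe⟩ := Finset.mem_filter.1 hx
  obtain ⟨hyc, hye⟩ := Finset.mem_filter.1 hy
  obtain ⟨hxT, hxa⟩ := mem_crossing.1 hxc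
  obtain ⟨hyT, hya⟩ := mem_crossing.1 hyc
  rw [mem_gapCut] at hxa hya
  have hx1 : v x - a < 2 ^ (e + 1) := hxe ▸ Nat.lt_pow_succ_log_self (by norm_num) _
  have hy1 : 2 ^ e' ≤ v y - a := hye ▸ Nat.pow_log_le_self 2 (by omega)
  rw [pow_succ] at hx1
  have hpos : 0 < 2 ^ e := by positivity
  have h16 : 16 * 2 ^ e ≤ 16 * k * 2 ^ e := Nat.mul_le_mul_right _ (by omega)
  refine lt_of_not_ge fun hle => ?_
  have hfy : f (u y) < f (v x) := (h.lt_f y hyT).trans_le hle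
  rcases lt_trichotomy (lo y) (lo x) with hlo | hlo | hlo
  · have := h.lex y hyT x hxT hlo (by omega) hfy
    omega
  · have hxy := h.inj_lo hyT hxT hlo
    subst hxy
    omega
  · have h1 := h.span x hxT
    have h2 := h.lo_le y hyT
    have h3 : v x - u x ≤ 4 * 2 ^ e := by omega
    have h4 : k * (v x - u x) ≤ k * (4 * 2 ^ e) := Nat.mul_le_mul_left _ h3
    have h5 : k * (4 * 2 ^ e) * 4 = 16 * k * 2 ^ e := by ring
    omega

/-- `D t` consists of right ends at scale `t - 1`, for `t - 1` in one residue class modulo `q = 4 +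
clog k`; distinct scales then differ by a factor of at least `16 * k`, as `f_lt` needs. The
densities over all scales sum to at least `s`, of which `s / (2 * q)` survives in the class. The
choice of `K` makes `C * k * α ≤ s / (32 * q)`, and `s < 32` keeps this at most 1. -/
lemma IsGapSystem.startsGrowingSuffix {ι : Type*} [DecidableEq ι] {n k C : ℕ} {f : ℕ → ℝ}
    {T : Finset ι} {lo u v : ι → ℕ} (h : IsGapSystem n k f T lo u v) (hk : 1 ≤ k) (hC : 1 ≤ C)
    {a K : ℕ} (hK : K = 64 * (4 + Nat.clog 2 k) * C * k)
    (hs0 : 0 < crossingDensity T u v a) (hs : crossingDensity T u v a < 32)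
    (hsp : ∀ e, (K : ℝ) * (crossingAt T u v a e).card ≤ crossingDensity T u v a * 2 ^ e)
    {α : ℝ} (hα : crossingDensity T u v a / K ≤ α) (hα' : α ≤ 2 * crossingDensity T u v a / K) :
    StartsGrowingSuffix n f α (C * k * α) a := by
  set s := crossingDensity T u v a with hsdef
  set q := 4 + Nat.clog 2 k with hq
  have hq0 : (4 : ℝ) ≤ q := by rw [hq]; push_cast; linarith [(Nat.cast_nonneg _ : (0 : ℝ) ≤ (Nat.clog 2 k : ℕ))]
  have hk1 : (1 : ℝ) ≤ k := by exact_mod_cast hk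
  have hC1 : (1 : ℝ) ≤ C := by exact_mod_cast hC
  have hCk : (1 : ℝ) ≤ C * k := one_le_mul_of_one_le_of_one_le hC1 hk1
  have hKr : (K : ℝ) = 64 * q * (C * k) := by rw [hK]; push_cast; ring
  have hqC : (0 : ℝ) < q * (C * k) := by positivity
  have hKpos : (0 : ℝ) < K := by rw [hKr]; linarith
  have hK256 : (256 : ℝ) ≤ K := by rw [hKr]; nlinarith
  have hα0 : 0 ≤ α := le_trans (by positivity) hα
  have hβ : C * k * α ≤ s / (2 * q) := by
    calc C * k * α ≤ C * k * (2 * s / K) := by gcongr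
      _ = s / (32 * q) := by rw [hKr]; field_simp; norm_num
      _ ≤ s / (2 * q) := by gcongr; norm_num
  have hβ1 : C * k * α ≤ 1 := by
    calc C * k * α ≤ C * k * (2 * s / K) := by gcongr
      _ = s / (32 * q) := by rw [hKr]; field_simp; norm_num
      _ ≤ 1 := by rw [div_le_one (by positivity)]; linarith
  have hne : (crossing T u v a).Nonempty := by
    by_contra hne
    rw [Finset.not_nonempty_iff_eq_empty] at hne
    rw [hsdef, crossingDensity, hne] at hs0
    simp at hs0
  obtain ⟨x₀, hx₀⟩ := hne
  obtain ⟨hx₀T, hx₀a⟩ := mem_crossing.1 hx₀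
  rw [mem_gapCut] at hx₀a
  have hcross : ∀ x ∈ crossing T u v a, u x ≤ a ∧ a < v x ∧ v x ≤ n := fun x hx => by
    obtain ⟨hxT, hxa⟩ := mem_crossing.1 hx
    rw [mem_gapCut] at hxa
    exact ⟨hxa.1.1, hxa.1.2, h.le_n x hxT⟩
  -- the density at each scale
  let N : ℕ → ℝ := fun e => (crossingAt T u v a e).card / 2 ^ e
  have hN0 : ∀ e, 0 ≤ N e := fun e => by simp only [N]; positivity
  have hNle : ∀ e, N e ≤ s / K := fun e => by
    simp only [N]
    rw [div_le_div_iff₀ (by positivity) hKpos, mul_comm]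
    exact hsp e
  let Es := (crossing T u v a).image fun x => Nat.log 2 (v x - a)
  have hsum : s ≤ ∑ e ∈ Es, N e := by
    have h1 : ∑ e ∈ Es, N e = ∑ x ∈ crossing T u v a, 1 / (2 : ℝ) ^ (Nat.log 2 (v x - a)) := by
      rw [← Finset.sum_fiberwise_of_maps_to (s := crossing T u v a) (t := Es)
        (g := fun x => Nat.log 2 (v x - a)) fun x hx => Finset.mem_image_of_mem _ hx]
      refine Finset.sum_congr rfl fun e _ => ?_
      simp only [N, crossingAt]
      rw [Finset.card_eq_sum_ones, Nat.cast_sum, Finset.sum_div]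
      refine Finset.sum_congr rfl fun x hx => ?_
      rw [(Finset.mem_filter.1 hx).2]
      simp
    rw [h1, hsdef, crossingDensity]
    refine Finset.sum_le_sum fun x hx => ?_
    obtain ⟨h2, h3, -⟩ := hcross x hx
    have h4 : 2 ^ (Nat.log 2 (v x - a)) ≤ v x - u x :=
      (Nat.pow_log_le_self 2 (by omega)).trans (by omega)
    apply one_div_le_one_div_of_le (by positivity)
    exact_mod_cast h4
  -- at most one of the scales is truncated at the end of `[n]`
  let Fs := Es.filter fun e => a + 2 ^ (e + 1) ≤ n
  have hFs : s / 2 ≤ ∑ e ∈ Fs, N e := by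
    have h1 : ∑ e ∈ Es.filter (fun e => ¬ a + 2 ^ (e + 1) ≤ n), N e ≤ s / K := by
      have hc : (Es.filter (fun e => ¬ a + 2 ^ (e + 1) ≤ n)).card ≤ 1 := by
        rw [Finset.card_le_one]
        have key : ∀ e e', e ∈ Es → e' ∈ Es → ¬ a + 2 ^ (e + 1) ≤ n → ¬ e < e' := by
          intro e e' _ he' hn hlt
          obtain ⟨x, hx, rfl⟩ := Finset.mem_image.1 he'
          obtain ⟨h2, h3, h4⟩ := hcross x hx
          have h5 : 2 ^ (Nat.log 2 (v x - a)) ≤ v x - a := Nat.pow_log_le_self 2 (by omega)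
          have h6 : 2 ^ (e + 1) ≤ 2 ^ (Nat.log 2 (v x - a)) :=
            Nat.pow_le_pow_right (by norm_num) hlt
          omega
        intro e he e' he'
        rw [Finset.mem_filter] at he he'
        have h2 := key e e' he.1 he'.1 he.2
        have h3 := key e' e he'.1 he.1 he'.2
        omega
      calc _ ≤ ∑ e ∈ Es.filter (fun e => ¬ a + 2 ^ (e + 1) ≤ n), s / K :=
            Finset.sum_le_sum fun e _ => hNle e
        _ ≤ 1 * (s / K) := by
            rw [Finset.sum_const, nsmul_eq_mul]
            gcongr
            exact_mod_cast hc
        _ = s / K := one_mul _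
    have h2 := Finset.sum_filter_add_sum_filter_not Es (fun e => a + 2 ^ (e + 1) ≤ n) N
    have h3 : s / K ≤ s / 2 := by gcongr; linarith
    simp only [Fs]
    linarith
  -- a residue class of scales
  obtain ⟨r, -, hr⟩ : ∃ r ∈ Finset.range q, s / (2 * q) ≤ ∑ e ∈ Fs with e % q = r, N e := by
    by_contra hcon
    push Not at hcon
    have h1 := Finset.sum_lt_sum_of_nonempty (s := Finset.range q) ⟨0, by simp [hq]⟩ hcon
    rw [Finset.sum_fiberwise_of_maps_to (fun e _ => Finset.mem_range.2 (Nat.mod_lt _ (by omega))),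
      Finset.sum_const, nsmul_eq_mul, Finset.card_range] at h1
    have h2 : (q : ℝ) * (s / (2 * q)) = s / 2 := by field_simp
    linarith
  let D : ℕ → Finset ℕ := fun t =>
    if (t - 1) % q = r ∧ a + 2 ^ t ≤ n then (crossingAt T u v a (t - 1)).image v else ∅
  have hDcard : ∀ t, (D t).card ≤ (crossingAt T u v a (t - 1)).card := fun t => by
    simp only [D]
    split_ifs
    · exact Finset.card_image_le
    · simp
  refine ⟨⟨hα0, le_trans (le_mul_of_one_le_left hα0 hCk) hβ1⟩, ⟨by positivity, hβ1⟩, ?_, D,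
    ?_, ?_, ?_, ?_⟩
  · have := h.one_le x₀ hx₀T
    have := h.lo_le x₀ hx₀T
    have := h.le_n x₀ hx₀T
    rw [Finset.mem_Icc]
    omega
  · intro t ht b hb
    rw [suffixScales, Finset.mem_Icc] at ht
    simp only [D] at hb
    split_ifs at hb with hc
    swap
    · simp at hb
    obtain ⟨x, hx, rfl⟩ := Finset.mem_image.1 hb
    obtain ⟨hxc, hxe⟩ := Finset.mem_filter.1 hx
    obtain ⟨h2, h3, h4⟩ := hcross x hxc
    have h5 : 2 ^ (t - 1) ≤ v x - a := hxe ▸ Nat.pow_log_le_self 2 (by omega)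
    have h6 : v x - a < 2 ^ (t - 1 + 1) := hxe ▸ Nat.lt_pow_succ_log_self (by norm_num) _
    rw [Nat.sub_add_cancel ht.1] at h6
    simp only [suffixSegment, Finset.mem_inter, Finset.mem_Icc, Finset.mem_Ico]
    omega
  · intro t ht
    rw [suffixScales, Finset.mem_Icc] at ht
    by_cases hc : (t - 1) % q = r ∧ a + 2 ^ t ≤ n
    · rw [card_suffixSegment ht.1 hc.2]
      refine le_trans ?_ ((hNle (t - 1)).trans hα)
      simp only [N]
      push_cast
      gcongr
      exact hDcard t
    · simp only [D, hc, if_false]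
      simpa using hα0
  · refine (hβ.trans hr).trans ?_
    have hinj : Set.InjOn (fun e : ℕ => e + 1) ((Fs.filter fun e => e % q = r : Finset ℕ) : Set ℕ) :=
      fun _ _ _ _ hab => Nat.succ_injective hab
    have hmem : ∀ e ∈ Fs.filter fun e => e % q = r, a + 2 ^ (e + 1) ≤ n ∧ e % q = r := fun e he => by
      simp only [Fs, Finset.mem_filter] at he
      exact ⟨he.1.2, he.2⟩
    calc _ = ∑ e ∈ Fs with e % q = r,
            ((D (e + 1)).card : ℝ) / ((suffixSegment n a (e + 1)).card : ℝ) := by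
          refine Finset.sum_congr rfl fun e he => ?_
          obtain ⟨h1, h2⟩ := hmem e he
          rw [card_suffixSegment (by omega) h1]
          simp only [D, N, Nat.add_sub_cancel, h1, h2, and_self, if_true]
          have h3 : ((crossingAt T u v a e).image v).card = (crossingAt T u v a e).card :=
            Finset.card_image_of_injOn (h.inj_v.mono fun x hx =>
              (mem_crossing.1 (Finset.mem_filter.1 hx).1).1)
          rw [h3]
          push_cast
          rfl
      _ = ∑ t ∈ (Fs.filter fun e => e % q = r).image (fun e => e + 1),
            ((D t).card : ℝ) / ((suffixSegment n a t).card : ℝ) := by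
          rw [Finset.sum_image hinj]
      _ ≤ _ := by
          refine Finset.sum_le_sum_of_subset_of_nonneg ?_ fun _ _ _ => by positivity
          intro t ht
          obtain ⟨e, he, rfl⟩ := Finset.mem_image.1 ht
          have h1 := (hmem e he).1
          rw [suffixScales, Finset.mem_Icc]
          refine ⟨by omega, ?_⟩
          have h2 : e + 1 = Nat.clog 2 (2 ^ (e + 1)) := (Nat.clog_pow 2 _ (by norm_num)).symm
          rw [h2]
          exact Nat.clog_mono_right 2 (by omega)
  · intro t ht t' ht' htt b hb b' hb'
    rw [suffixScales, Finset.mem_Icc] at ht ht'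
    simp only [D] at hb hb'
    split_ifs at hb with hc
    swap
    · simp at hb
    split_ifs at hb' with hc'
    swap
    · simp at hb'
    obtain ⟨x, hx, rfl⟩ := Finset.mem_image.1 hb
    obtain ⟨y, hy, rfl⟩ := Finset.mem_image.1 hb'
    refine h.f_lt ?_ hk hx hy
    have h1 : q ≤ (t' - 1) - (t - 1) := by
      refine Nat.le_of_dvd (by omega) ?_
      exact (Nat.modEq_iff_dvd' (by omega)).1 (hc.1.trans hc'.1.symm)
    have h2 : k ≤ 2 ^ Nat.clog 2 k := Nat.le_pow_clog (by norm_num) k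
    calc 16 * k * 2 ^ (t - 1) ≤ 16 * 2 ^ Nat.clog 2 k * 2 ^ (t - 1) := by gcongr
      _ = 2 ^ (q + (t - 1)) := by rw [hq, pow_add, pow_add]; norm_num
      _ ≤ 2 ^ (t' - 1) := Nat.pow_le_pow_right (by norm_num) (by omega)

/-! ### Splitting an interval around a cut -/

/-- Two subfamilies that have at least half of the elements each and are separated by `φ`. -/
lemma exists_median_split {ι : Type*} [DecidableEq ι] (φ : ι → ℝ) (A : Finset ι) :
    ∃ A₁ ⊆ A, ∃ A₂ ⊆ A, (∀ x ∈ A₁, ∀ y ∈ A₂, φ x ≤ φ y) ∧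
      A.card ≤ 2 * A₁.card ∧ A.card ≤ 2 * A₂.card := by
  induction A using Finset.strongInduction with
  | H A ih =>
  rcases le_or_gt A.card 1 with hA | hA
  -- The two subfamilies may overlap, so a singleton is both of them. In the step a minimum joins
  -- `A₁` and a maximum joins `A₂`.
  · refine ⟨A, subset_rfl, A, subset_rfl, fun x hx y hy => ?_, by omega, by omega⟩
    rw [Finset.card_le_one.1 hA x hx y hy]
  obtain ⟨x, hxA, hx⟩ := Finset.exists_min_image A φ (Finset.card_pos.1 (by omega))
  have hc1 := Finset.card_erase_of_mem hxA
  obtain ⟨y, hyA, hy⟩ := Finset.exists_max_image (A.erase x) φ (Finset.card_pos.1 (by omega))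
  have hc2 := Finset.card_erase_of_mem hyA
  set A' := (A.erase x).erase y with hA'
  have hsub : A' ⊆ A := (Finset.erase_subset _ _).trans (Finset.erase_subset _ _)
  have hyA' := (Finset.mem_erase.1 hyA).2
  obtain ⟨A₁, h1, A₂, h2, h12, hc3, hc4⟩ := ih A' (Finset.ssubset_iff_of_subset hsub |>.2
    ⟨x, hxA, by simp [hA']⟩)
  have hxn : x ∉ A₁ := fun h => by have := h1 h; simp [hA'] at this
  have hyn : y ∉ A₂ := fun h => by have := h2 h; simp [hA'] at this
  refine ⟨insert x A₁, Finset.insert_subset hxA (h1.trans hsub), insert y A₂,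
    Finset.insert_subset hyA' (h2.trans hsub), fun a ha b hb => ?_, ?_, ?_⟩
  · rcases Finset.mem_insert.1 hb with rfl | hb
    · rcases Finset.mem_insert.1 ha with rfl | ha
      · exact hx _ hyA'
      · exact hy _ (Finset.mem_of_mem_erase (h1 ha))
    · rcases Finset.mem_insert.1 ha with rfl | ha
      · exact hx _ (hsub (h2 hb))
      · exact h12 a ha b hb
  · rw [Finset.card_insert_of_notMem hxn]; omega
  · rw [Finset.card_insert_of_notMem hyn]; omega

/-- A Vitali covering lemma for finite families of intervals. -/
lemma exists_disjoint_cover (J : ℕ → Finset ℕ) (B : Finset ℕ) (hJ : ∀ a ∈ B, IsInterval (J a))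
    (hmem : ∀ a ∈ B, a ∈ J a) :
    ∃ B' ⊆ B, (∀ a ∈ B', ∀ b ∈ B', a ≠ b → Disjoint (J a) (J b)) ∧
      B.card ≤ 3 * ∑ a ∈ B', (J a).card := by
  induction B using Finset.strongInduction with
  | H B ih =>
  rcases B.eq_empty_or_nonempty with rfl | hB
  · exact ⟨∅, by simp⟩
  obtain ⟨a, haB, ha⟩ := Finset.exists_max_image B (fun a => (J a).card) hB
  have hself : ¬ Disjoint (J a) (J a) := fun h =>
    Finset.disjoint_left.1 h (hmem a haB) (hmem a haB)
  have hss : B.filter (fun b => Disjoint (J a) (J b)) ⊂ B :=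
    Finset.ssubset_iff_of_subset (Finset.filter_subset _ _) |>.2 ⟨a, haB, fun h => hself (Finset.mem_filter.1 h).2⟩
  obtain ⟨B', hB', hdis, hcard⟩ := ih _ hss
    (fun b hb => hJ b (hss.1 hb)) (fun b hb => hmem b (hss.1 hb))
  have hd : ∀ b ∈ B', Disjoint (J a) (J b) := fun b hb => (Finset.mem_filter.1 (hB' hb)).2
  have han : a ∉ B' := fun h => hself (hd a h)
  refine ⟨insert a B', Finset.insert_subset haB (hB'.trans hss.1), ?_, ?_⟩
  · intro b hb b' hb' hne
    rcases Finset.mem_insert.1 hb with rfl | h1 <;> rcases Finset.mem_insert.1 hb' with rfl | h2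
    · exact (hne rfl).elim
    · exact hd _ h2
    · exact (hd _ h1).symm
    · exact hdis b h1 b' h2 hne
  · have h1 : (B.filter (fun b => ¬ Disjoint (J a) (J b))).card ≤ 3 * (J a).card := by
      obtain ⟨p, q, hpq⟩ := hJ a haB
      have ham := hmem a haB
      have hac : (J a).card = q + 1 - p := by rw [hpq, Nat.card_Icc]
      rw [hpq, Finset.mem_Icc] at ham
      -- `J a` is longest, so an interval that meets it has its base point in the threefold
      -- enlargement of `J a`.
      have hsub : B.filter (fun b => ¬ Disjoint (J a) (J b)) ⊆
          Finset.Icc (p - (q - p)) (q + (q - p)) := by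
        intro b hb
        obtain ⟨hbB, hbd⟩ := Finset.mem_filter.1 hb
        obtain ⟨c, hca, hcb⟩ := Finset.not_disjoint_iff.1 hbd
        obtain ⟨p', q', hpq'⟩ := hJ b hbB
        have hle := ha b hbB
        have hbm := hmem b hbB
        simp only [hac] at hle
        rw [hpq', Nat.card_Icc] at hle
        rw [hpq, Finset.mem_Icc] at hca
        rw [hpq', Finset.mem_Icc] at hcb hbm
        rw [Finset.mem_Icc]
        omega
      have := Finset.card_le_card hsub
      rw [Nat.card_Icc] at this
      omega
    have h2 := Finset.card_filter_add_card_filter_not (s := B) (fun b => Disjoint (J a) (J b))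
    rw [Finset.sum_insert han]
    omega

/-- `J` is divided into `L`, `M`, `R` as for a splittable pair, and there are disjoint families of
at least `w` monotone subsequences, of length `c` in `L` and of length `d` in `R`, with entries in
`E`, such that `f` is smaller on the entries of the first family than on those of the second. -/
def IsSplitPiece (f : ℕ → ℝ) (k : ℕ) (E J : Finset ℕ) (w c d : ℕ) : Prop :=
  IsInterval J ∧ ∃ L M R : Finset ℕ, IsThreePartition J L M R ∧
    J.card ≤ 6 * k * L.card ∧ J.card / (6 * k) ≤ M.card ∧ J.card ≤ 6 * k * R.card ∧
    ∃ (A : Finset (Fin c → ℕ)) (B : Finset (Fin d → ℕ)),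
      IsDisjointMonoFamily f L A ∧ IsDisjointMonoFamily f R B ∧ entries A ⊆ E ∧ entries B ⊆ E ∧
      (∀ a ∈ entries A, ∀ b ∈ entries B, f a < f b) ∧ w ≤ A.card ∧ w ≤ B.card

lemma le_add_of_gaps_le {m g : ℕ} {x : Fin m → ℕ}
    (h : ∀ i j : Fin m, (i : ℕ) + 1 = j → x j ≤ x i + g) (e : ℕ) :
    ∀ i j : Fin m, (i : ℕ) + e = j → x j ≤ x i + e * g := by
  induction e with
  | zero => intro i j hij; rw [Fin.ext (by simpa using hij) (a := i) (b := j)]; simp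
  | succ e ih =>
    intro i j hij
    have h1 := ih i ⟨i + e, by omega⟩ rfl
    have h2 := h ⟨i + e, by omega⟩ j (by simp; omega)
    have h3 : (e + 1) * g = e * g + g := by ring
    omega

/-- The gaps have comparable lengths, are the longest in their tuples and are all cut by `a`, so all
tuples lie in an interval of length at most `k` times the largest gap. It is split at `a`, with the
buffer placed just after `a`. Prefixes come from the half with small `f (u x)` and suffixes from the
other half; original tuples are not kept together. -/
lemma exists_splitPiece {f : ℕ → ℝ} {k c d : ℕ} {I : Finset ℕ} (hI : IsInterval I)
    (hk : c + 1 + (d + 1) ≤ k) {A : Finset (Fin (c + 1 + (d + 1)) → ℕ)}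
    (hA : IsDisjointMonoFamily f I A) (hne : A.Nonempty) {a G : ℕ}
    {u v : (Fin (c + 1 + (d + 1)) → ℕ) → ℕ}
    (hu : u = fun x => x (Fin.castAdd (d + 1) (Fin.last c)))
    (hv : v = fun x => x (Fin.natAdd (c + 1) 0))
    (hcut : ∀ x ∈ A, a ∈ gapCut (u x) (v x))
    (hgap : ∀ x ∈ A, ∀ i j : Fin (c + 1 + (d + 1)), (i : ℕ) + 1 = (j : ℕ) → x j ≤ x i + (v x - u x))
    (hratio : ∀ x ∈ A, ∀ y ∈ A, (v x - u x) ^ 2 < 2 * (v y - u y) ^ 2)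
    (hG : ∀ x ∈ A, v x - u x ≤ G) :
    ∃ J ⊆ I, a ∈ J ∧ J.card ≤ k * G ∧ ∃ w, A.card ≤ 2 * w ∧
      IsSplitPiece f k (entries A) J w (c + 1) (d + 1) := by
  classical
  let z : Fin (c + 1 + (d + 1)) := Fin.castAdd (d + 1) 0
  let l : Fin (c + 1 + (d + 1)) := Fin.natAdd (c + 1) (Fin.last d)
  obtain ⟨xl, hxl, hmin⟩ := Finset.exists_min_image A (fun x => x z) hne
  obtain ⟨xr, hxr, hmax⟩ := Finset.exists_max_image A (fun x => x l) hne
  obtain ⟨xm, hxm, hgm⟩ := Finset.exists_max_image A (fun x => v x - u x) hne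
  set lo := xl z with hlo
  set hi := xr l with hhi
  set gm := v xm - u xm with hgmdef
  have hcut' : ∀ x ∈ A, (u x ≤ a ∧ a < v x) ∧ v x - u x ≤ 4 * (a + 1 - u x) ∧
      v x - u x + 1 ≤ 2 * (v x - a) := fun x hx => mem_gapCut.1 (hcut x hx)
  have hux : ∀ x ∈ A, ∀ i : Fin (c + 1), x z ≤ x (Fin.castAdd (d + 1) i) ∧
      x (Fin.castAdd (d + 1) i) ≤ u x := by
    intro x hx i
    have hm := (hA.1 x hx).2.1.monotone
    refine ⟨hm ?_, ?_⟩
    · rw [Fin.le_def]; simp [z]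
    · rw [hu]; exact hm (by rw [Fin.le_def]; simp; omega)
  have hvx : ∀ x ∈ A, ∀ i : Fin (d + 1), v x ≤ x (Fin.natAdd (c + 1) i) ∧
      x (Fin.natAdd (c + 1) i) ≤ x l := by
    intro x hx i
    have hm := (hA.1 x hx).2.1.monotone
    refine ⟨?_, hm ?_⟩
    · rw [hv]; exact hm (by rw [Fin.le_def]; simp)
    · rw [Fin.le_def]; simp [l]; omega
  have hlo_a : a + 1 ≤ lo + (c + 1) * gm := by
    have h1 := le_add_of_gaps_le (hgap xl hxl) (c + 1) z (Fin.natAdd (c + 1) 0) (by simp [z])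
    have h2 : v xl = xl (Fin.natAdd (c + 1) 0) := by rw [hv]
    have h3 := (hcut' xl hxl).1.2
    have h4 : (c + 1) * (v xl - u xl) ≤ (c + 1) * gm := Nat.mul_le_mul_left _ (hgm xl hxl)
    omega
  have hhi_a : hi ≤ a + (d + 1) * gm := by
    have h1 := le_add_of_gaps_le (hgap xr hxr) (d + 1) (Fin.castAdd (d + 1) (Fin.last c)) l
      (by simp [l]; omega)
    have h2 : u xr = xr (Fin.castAdd (d + 1) (Fin.last c)) := by rw [hu]
    have h3 := (hcut' xr hxr).1.1
    have h4 : (d + 1) * (v xr - u xr) ≤ (d + 1) * gm := Nat.mul_le_mul_left _ (hgm xr hxr)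
    omega
  have hlo1 : ∀ x ∈ A, lo ≤ u x := fun x hx => (hmin x hx).trans (hux x hx (Fin.last c)|>.1.trans
    (hux x hx (Fin.last c)).2)
  have hhi1 : ∀ x ∈ A, v x ≤ hi := fun x hx => ((hvx x hx 0).1.trans (hvx x hx 0).2).trans
    (hmax x hx)
  obtain ⟨J, hJ⟩ : ∃ J, J = Finset.Icc lo hi := ⟨_, rfl⟩
  have hJcard : J.card = hi + 1 - lo := by rw [hJ, Nat.card_Icc]
  have hJk : J.card ≤ k * gm := by
    have h1 : (c + 1) * gm + (d + 1) * gm ≤ k * gm := by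
      rw [← Nat.add_mul]; exact Nat.mul_le_mul_right _ hk
    have h2 := hlo1 xm hxm
    have h3 := (hcut' xm hxm).1
    have h4 := hhi1 xm hxm
    omega
  obtain ⟨m, hm⟩ : ∃ m, m = J.card / (6 * k) := ⟨_, rfl⟩
  have hkpos : 0 < k := by omega
  have hm6 : 6 * m ≤ gm := by
    have h1 : 6 * k * m ≤ J.card := hm ▸ Nat.mul_div_le _ _
    have h2 : k * (6 * m) ≤ k * gm := by linarith
    exact Nat.le_of_mul_le_mul_left h2 hkpos
  -- A ratio below `√2` is below `3 / 2`. With `6 * m ≤ gm`, the buffer takes at most a quarter of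
  -- each gap, while at least half of the gap is to the right of `a`.
  have h3g : ∀ x ∈ A, 2 * gm ≤ 3 * (v x - u x) := fun x hx => by
    have := hratio xm hxm x hx
    by_contra hcon
    push Not at hcon
    nlinarith
  have hmg : ∀ x ∈ A, 4 * m ≤ v x - u x := fun x hx => by
    have := h3g x hx
    omega
  have hvm : ∀ x ∈ A, a + m + 1 ≤ v x := fun x hx => by
    have := hmg x hx
    have := hcut' x hx
    omega
  obtain ⟨A₁, hA₁, A₂, hA₂, hsep, hc1, hc2⟩ := exists_median_split (fun x => f (u x)) A
  refine ⟨J, ?_, ?_, hJk.trans (Nat.mul_le_mul_left _ (hG xm hxm)), (A.card + 1) / 2, by omega,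
    ⟨lo, hi, hJ⟩, Finset.Icc lo a,
    Finset.Icc (a + 1) (a + m), Finset.Icc (a + m + 1) hi, ?_, ?_, ?_, ?_,
    A₁.image (fun x i => x (Fin.castAdd (d + 1) i)),
    A₂.image (fun x j => x (Fin.natAdd (c + 1) j)), ?_, ?_, ?_, ?_, ?_, ?_, ?_⟩
  · obtain ⟨p, q, rfl⟩ := hI
    have h1 := (hA.1 xl hxl).1 z
    have h2 := (hA.1 xr hxr).1 l
    rw [Finset.mem_Icc] at h1 h2
    rw [hJ]
    exact Finset.Icc_subset_Icc h1.1 h2.2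
  · have := hlo1 xm hxm
    have := (hcut' xm hxm).1
    have := hhi1 xm hxm
    rw [hJ, Finset.mem_Icc]
    omega
  · refine ⟨⟨_, _, rfl⟩, ⟨_, _, rfl⟩, ⟨_, _, rfl⟩, ?_, ?_, ?_, ?_⟩
    · have := hlo1 xm hxm
      have := (hcut' xm hxm).1
      have := hhi1 xm hxm
      have := hvm xm hxm
      ext b
      simp only [Finset.mem_union, Finset.mem_Icc, hJ]
      omega
    all_goals
      intro b hb b' hb'
      rw [Finset.mem_Icc] at hb hb'
      omega
  · have h1 := h3g xm hxm
    have h2 := hlo1 xm hxm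
    have h3 := hcut' xm hxm
    have h4 : gm ≤ 6 * (a + 1 - lo) := by omega
    rw [Nat.card_Icc]
    calc J.card ≤ k * gm := hJk
      _ ≤ k * (6 * (a + 1 - lo)) := Nat.mul_le_mul_left _ h4
      _ = _ := by ring
  · rw [Nat.card_Icc]; omega
  · have h1 := h3g xm hxm
    have h2 := hhi1 xm hxm
    have h3 := hcut' xm hxm
    have h4 : gm ≤ 6 * (hi + 1 - (a + m + 1)) := by omega
    rw [Nat.card_Icc]
    calc J.card ≤ k * gm := hJk
      _ ≤ k * (6 * (hi + 1 - (a + m + 1))) := Nat.mul_le_mul_left _ h4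
      _ = _ := by ring
  · constructor
    · intro y hy
      obtain ⟨x, hx, rfl⟩ := Finset.mem_image.1 hy
      have hxA := hA₁ hx
      obtain ⟨-, h2, h3⟩ := hA.1 x hxA
      refine ⟨fun i => ?_, fun i j hij => h2 ?_, fun i j hij => h3 ?_⟩
      · have := hux x hxA i
        have := hmin x hxA
        have := hcut' x hxA
        simp only [Finset.mem_Icc]
        omega
      all_goals exact Fin.strictMono_castAdd _ hij
    · intro y hy y' hy' hne' i j
      obtain ⟨x, hx, rfl⟩ := Finset.mem_image.1 hy
      obtain ⟨x', hx', rfl⟩ := Finset.mem_image.1 hy'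
      exact hA.2 x (hA₁ hx) x' (hA₁ hx') (fun h => hne' (by rw [h])) _ _
  · constructor
    · intro y hy
      obtain ⟨x, hx, rfl⟩ := Finset.mem_image.1 hy
      have hxA := hA₂ hx
      obtain ⟨-, h2, h3⟩ := hA.1 x hxA
      refine ⟨fun i => ?_, fun i j hij => h2 ?_, fun i j hij => h3 ?_⟩
      · have := hvx x hxA i
        have := hmax x hxA
        have := hvm x hxA
        simp only [Finset.mem_Icc]
        omega
      all_goals exact Fin.strictMono_natAdd _ hij
    · intro y hy y' hy' hne' i j
      obtain ⟨x, hx, rfl⟩ := Finset.mem_image.1 hy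
      obtain ⟨x', hx', rfl⟩ := Finset.mem_image.1 hy'
      exact hA.2 x (hA₂ hx) x' (hA₂ hx') (fun h => hne' (by rw [h])) _ _
  · intro b hb
    obtain ⟨y, hy, i, rfl⟩ := mem_entries.1 hb
    obtain ⟨x, hx, rfl⟩ := Finset.mem_image.1 hy
    exact mem_entries.2 ⟨x, hA₁ hx, _, rfl⟩
  · intro b hb
    obtain ⟨y, hy, i, rfl⟩ := mem_entries.1 hb
    obtain ⟨x, hx, rfl⟩ := Finset.mem_image.1 hy
    exact mem_entries.2 ⟨x, hA₂ hx, _, rfl⟩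
  · intro b hb b' hb'
    obtain ⟨y, hy, i, rfl⟩ := mem_entries.1 hb
    obtain ⟨x, hx, rfl⟩ := Finset.mem_image.1 hy
    obtain ⟨y', hy', j, rfl⟩ := mem_entries.1 hb'
    obtain ⟨x', hx', rfl⟩ := Finset.mem_image.1 hy'
    have h1 : f (x (Fin.castAdd (d + 1) i)) ≤ f (u x) := by
      rw [hu]
      exact (hA.1 x (hA₁ hx)).2.2.monotone (by rw [Fin.le_def]; simp; omega)
    have h2 : f (u x') < f (x' (Fin.natAdd (c + 1) j)) := by
      rw [hu]
      exact (hA.1 x' (hA₂ hx')).2.2 (by rw [Fin.lt_def]; simp; omega)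
    exact (h1.trans (hsep x hx x' hx')).trans_lt h2
  · rw [Finset.card_image_of_injOn]
    · omega
    · intro x hx x' hx' hxx
      by_contra hne'
      exact hA.2 x (hA₁ hx) x' (hA₁ hx') hne' _ _ (congrFun hxx 0)
  · rw [Finset.card_image_of_injOn]
    · omega
    · intro x hx x' hx' hxx
      by_contra hne'
      exact hA.2 x (hA₂ hx) x' (hA₂ hx') hne' _ _ (congrFun hxx 0)

/-! ### Growing suffixes or splittable intervals -/

lemma IsSplitPiece.mono {f : ℕ → ℝ} {k w c d : ℕ} {E E' J : Finset ℕ}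
    (h : IsSplitPiece f k E J w c d) (hE : E ⊆ E') : IsSplitPiece f k E' J w c d := by
  obtain ⟨hJ, L, M, R, h1, h2, h3, h4, A, B, hA, hB, hAE, hBE, h5⟩ := h
  exact ⟨hJ, L, M, R, h1, h2, h3, h4, A, B, hA, hB, hAE.trans hE, hBE.trans hE, h5⟩

lemma exists_dyadic {y : ℝ} {N : ℕ} (hN : (1 / 2 : ℝ) ^ N ≤ y) (hy : y < 2) :
    ∃ i ≤ N, (1 / 2 : ℝ) ^ i ≤ y ∧ y < 2 * (1 / 2 : ℝ) ^ i := by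
  classical
  have hex : ∃ i, (1 / 2 : ℝ) ^ i ≤ y := ⟨N, hN⟩
  refine ⟨Nat.find hex, Nat.find_min' hex hN, Nat.find_spec hex, ?_⟩
  rcases Nat.eq_zero_or_pos (Nat.find hex) with h | h
  · rw [h]; simpa using hy
  · obtain ⟨j, hj⟩ : ∃ j, Nat.find hex = j + 1 := ⟨Nat.find hex - 1, by omega⟩
    have := Nat.find_min hex (m := j) (by omega)
    rw [hj, pow_succ]
    linarith [not_le.1 this]

lemma exists_max_gap {m : ℕ} (hm : 2 ≤ m) (x : Fin m → ℕ) :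
    ∃ c ∈ Finset.range (m - 1), ∀ i j p q : Fin m, (i : ℕ) + 1 = j → (p : ℕ) = c →
      (q : ℕ) = c + 1 → x j - x i ≤ x q - x p := by
  let g : ℕ → ℕ := fun c =>
    if h : c + 1 < m then x ⟨c + 1, h⟩ - x ⟨c, (Nat.lt_succ_self c).trans h⟩ else 0
  obtain ⟨c, hc, hmax⟩ := Finset.exists_max_image (Finset.range (m - 1)) g
    ⟨0, by rw [Finset.mem_range]; omega⟩
  refine ⟨c, hc, fun i j p q hij hp hq => ?_⟩
  have hg : ∀ i j : Fin m, (i : ℕ) + 1 = j → g i = x j - x i := by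
    intro i j hij
    have h : (i : ℕ) + 1 < m := by omega
    have h2 : (⟨(i : ℕ) + 1, h⟩ : Fin m) = j := Fin.ext hij
    simp only [g, h, dif_pos, h2]
  rw [← hg i j hij, ← hg p q (by omega), hp]
  exact hmax _ (by rw [Finset.mem_range]; omega)

lemma exists_common_max_gap {m : ℕ} (hm : 2 ≤ m) (T : Finset (Fin m → ℕ)) :
    ∃ c d, m = c + 1 + (d + 1) ∧ ∃ T₁ ⊆ T, T.card ≤ m * T₁.card ∧
      ∀ x ∈ T₁, ∀ i j p q : Fin m, (i : ℕ) + 1 = j → (p : ℕ) = c →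
        (q : ℕ) = c + 1 → x j - x i ≤ x q - x p := by
  classical
  choose γ hγ hmax using fun x : Fin m → ℕ => exists_max_gap hm x
  obtain ⟨c, hc, hcard⟩ : ∃ c ∈ Finset.range (m - 1),
      T.card ≤ m * (T.filter fun x => γ x = c).card := by
    by_contra hcon
    push Not at hcon
    have h1 := Finset.card_eq_sum_card_fiberwise (s := T) (f := γ) (t := Finset.range (m - 1))
      (fun x _ => hγ x)
    have h2 := Finset.sum_lt_sum_of_nonempty (s := Finset.range (m - 1))
      ⟨0, by rw [Finset.mem_range]; omega⟩ hcon
    rw [← Finset.mul_sum, ← h1, Finset.sum_const, Finset.card_range, smul_eq_mul] at h2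
    have := Nat.mul_le_mul_right T.card (Nat.sub_le m 1)
    omega
  rw [Finset.mem_range] at hc
  refine ⟨c, m - 2 - c, by omega, _, Finset.filter_subset _ _, hcard, fun x hx => ?_⟩
  rw [← (Finset.mem_filter.1 hx).2]
  exact hmax x

/-- The threshold between the two alternatives of the dichotomy. -/
def concentrationThreshold (k C : ℕ) : ℕ := 64 * (4 + Nat.clog 2 k) * C * k

/-- The loss in one application of the dichotomy. -/
def splitLoss (k C N : ℕ) : ℕ := 6144 * concentrationThreshold k C * k ^ 3 * (N + 1)

/-- Gaps at scale `e` have lengths in `[2 ^ e, 2 ^ (e + 2))`, so their squares have four possible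
binary logarithms. A most frequent one keeps a quarter of the tuples and makes the ratios of lengths
less than `√2`; the median split halves this again. As `J` has length at most `k * 2 ^ (e + 2)`,
concentration gives the factor `4 * 8 * K * k`. -/
lemma exists_splitPiece_of_concentrated {f : ℕ → ℝ} {k c d : ℕ} {I : Finset ℕ} (hI : IsInterval I)
    (hk : c + 1 + (d + 1) ≤ k) {T : Finset (Fin (c + 1 + (d + 1)) → ℕ)}
    (hT : IsDisjointMonoFamily f I T) {a e K : ℕ} {s : ℝ} (hs : 0 ≤ s)
    {u v : (Fin (c + 1 + (d + 1)) → ℕ) → ℕ}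
    (hu : u = fun x => x (Fin.castAdd (d + 1) (Fin.last c)))
    (hv : v = fun x => x (Fin.natAdd (c + 1) 0))
    (hgap : ∀ x ∈ T, ∀ i j : Fin (c + 1 + (d + 1)), (i : ℕ) + 1 = (j : ℕ) →
      x j ≤ x i + (v x - u x))
    (he : s * 2 ^ e < K * (crossingAt T u v a e).card) :
    ∃ J ⊆ I, a ∈ J ∧ ∃ w : ℕ, s * J.card ≤ 32 * K * k * w ∧
      IsSplitPiece f k (entries T) J w (c + 1) (d + 1) := by
  classical
  set X := crossingAt T u v a e with hX
  have hXm : ∀ x ∈ X, x ∈ T ∧ a ∈ gapCut (u x) (v x) ∧ 2 ^ e ≤ v x - u x ∧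
      v x - u x < 2 ^ (e + 2) := by
    intro x hx
    obtain ⟨hxc, hxe⟩ := Finset.mem_filter.1 hx
    obtain ⟨hxT, hxa⟩ := mem_crossing.1 hxc
    have hxa' := mem_gapCut.1 hxa
    have h5 : 2 ^ e ≤ v x - a := hxe ▸ Nat.pow_log_le_self 2 (by omega)
    have h6 : v x - a < 2 ^ (e + 1) := hxe ▸ Nat.lt_pow_succ_log_self (by norm_num) _
    refine ⟨hxT, hxa, by omega, ?_⟩
    rw [pow_succ] at h6 ⊢
    rw [pow_succ]
    omega
  have hXpos : 0 < X.card := by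
    by_contra h0
    have h1 : X.card = 0 := by omega
    rw [h1] at he
    have : 0 ≤ s * 2 ^ e := by positivity
    simp only [Nat.cast_zero, mul_zero] at he
    linarith
  let γ : (Fin (c + 1 + (d + 1)) → ℕ) → ℕ := fun x => Nat.log 2 ((v x - u x) ^ 2)
  have hγ : ∀ x ∈ X, γ x ∈ Finset.Icc (2 * e) (2 * e + 3) := by
    intro x hx
    obtain ⟨-, -, h1, h2⟩ := hXm x hx
    have h3 : (2 ^ e) ^ 2 ≤ (v x - u x) ^ 2 := Nat.pow_le_pow_left h1 2
    have h4 : (v x - u x) ^ 2 < (2 ^ (e + 2)) ^ 2 := Nat.pow_lt_pow_left h2 (by norm_num)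
    rw [← pow_mul] at h3 h4
    have h5 : (v x - u x) ^ 2 ≠ 0 := by
      have : 0 < 2 ^ (e * 2) := by positivity
      omega
    rw [Finset.mem_Icc]
    constructor
    · rw [mul_comm]; exact Nat.le_log_of_pow_le (by norm_num) h3
    · have := Nat.log_lt_of_lt_pow h5 h4
      simp only [γ]
      omega
  obtain ⟨j, -, hj⟩ : ∃ j ∈ Finset.Icc (2 * e) (2 * e + 3),
      X.card ≤ 4 * (X.filter fun x => γ x = j).card := by
    by_contra hcon
    push Not at hcon
    have h1 := Finset.card_eq_sum_card_fiberwise (s := X) (f := γ)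
      (t := Finset.Icc (2 * e) (2 * e + 3)) hγ
    have h2 := Finset.sum_lt_sum_of_nonempty (s := Finset.Icc (2 * e) (2 * e + 3))
      ⟨2 * e, by simp⟩ hcon
    rw [← Finset.mul_sum, ← h1, Finset.sum_const, Nat.card_Icc, smul_eq_mul] at h2
    have : 2 * e + 3 + 1 - 2 * e = 4 := by omega
    rw [this] at h2
    omega
  set A := X.filter fun x => γ x = j with hA
  have hAX : ∀ x ∈ A, x ∈ X := fun x hx => (Finset.mem_filter.1 hx).1
  have hAT : A ⊆ T := fun x hx => (hXm x (hAX x hx)).1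
  obtain ⟨J, hJI, haJ, hJc, w, hw, hsp⟩ := exists_splitPiece (a := a) (G := 2 ^ (e + 2)) hI hk
    (A := A)
    ⟨fun x hx => hT.1 x (hAT hx), fun x hx y hy => hT.2 x (hAT hx) y (hAT hy)⟩
    (Finset.card_pos.1 (by omega)) hu hv (fun x hx => (hXm x (hAX x hx)).2.1)
    (fun x hx => hgap x (hAT hx))
    (by
      intro x hx y hy
      obtain ⟨hxX, hxj⟩ := Finset.mem_filter.1 hx
      obtain ⟨hyX, hyj⟩ := Finset.mem_filter.1 hy
      have h1 : (v x - u x) ^ 2 < 2 ^ (j + 1) :=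
        hxj ▸ Nat.lt_pow_succ_log_self (by norm_num) _
      have h2 : 2 ^ j ≤ (v y - u y) ^ 2 := by
        refine hyj ▸ Nat.pow_log_le_self 2 ?_
        have h3 := (hXm y hyX).2.2.1
        have : 0 < 2 ^ e := by positivity
        have : v y - u y ≠ 0 := by omega
        positivity
      rw [pow_succ 2 j] at h1
      omega)
    (fun x hx => (hXm x (hAX x hx)).2.2.2.le)
  refine ⟨J, hJI, haJ, w, ?_, hsp.mono ?_⟩
  · have h1 : (J.card : ℝ) ≤ k * 2 ^ (e + 2) := by exact_mod_cast hJc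
    have h2 : (X.card : ℝ) ≤ 8 * w := by exact_mod_cast (by omega : X.card ≤ 8 * w)
    calc s * J.card ≤ s * (k * 2 ^ (e + 2)) := by gcongr
      _ = 4 * k * (s * 2 ^ e) := by rw [pow_add]; ring
      _ ≤ 4 * k * (K * X.card) := by gcongr
      _ ≤ 4 * k * (K * (8 * w)) := by gcongr
      _ = _ := by ring
  · exact Finset.biUnion_subset_biUnion_of_subset_left _ hAT

/-- From intervals whose weights are bounded below in terms of a function `S`, one can select
disjoint ones that carry a large part of the sum of `S`. -/
lemma exists_disjoint_of_weighted {Q : Finset ℕ} {S : ℕ → ℝ} {J : ℕ → Finset ℕ} {w : ℕ → ℕ}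
    {N : ℕ} {M : ℝ} (hJ : ∀ a ∈ Q, IsInterval (J a)) (haJ : ∀ a ∈ Q, a ∈ J a)
    (hlow : ∀ a ∈ Q, 16 * (1 / 2 : ℝ) ^ N ≤ S a) (hup : ∀ a ∈ Q, S a < 32)
    (hw : ∀ a ∈ Q, S a * (J a).card ≤ M * w a) :
    ∃ B ⊆ Q, (∀ a ∈ B, ∀ b ∈ B, a ≠ b → Disjoint (J a) (J b)) ∧
      ∑ a ∈ Q, S a ≤ 6 * (N + 1) * M * ∑ a ∈ B, (w a : ℝ) := by
  classical
  have hdy : ∀ a ∈ Q, ∃ i ∈ Finset.range (N + 1), 16 * (1 / 2 : ℝ) ^ i ≤ S a ∧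
      S a < 32 * (1 / 2 : ℝ) ^ i := by
    intro a ha
    have h1 := hlow a ha
    have h3 := hup a ha
    obtain ⟨i, hi, h4, h5⟩ := exists_dyadic (y := S a / 16) (N := N)
      (by rw [le_div_iff₀ (by norm_num)]; linarith)
      (by linarith)
    exact ⟨i, Finset.mem_range.2 (by omega), by linarith, by linarith⟩
  choose! γ hγ hγ1 hγ2 using hdy
  obtain ⟨i, -, hi⟩ : ∃ i ∈ Finset.range (N + 1),
      ∑ a ∈ Q, S a ≤ (N + 1) * ∑ a ∈ Q with γ a = i, S a := by
    by_contra hcon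
    push Not at hcon
    have h2 := Finset.sum_lt_sum_of_nonempty (s := Finset.range (N + 1)) ⟨0, by simp⟩ hcon
    rw [← Finset.mul_sum, Finset.sum_fiberwise_of_maps_to hγ, Finset.sum_const,
      Finset.card_range, nsmul_eq_mul] at h2
    push_cast at h2
    linarith
  have hQiQ : ∀ a ∈ Q.filter fun a => γ a = i, a ∈ Q ∧ γ a = i := fun a ha => Finset.mem_filter.1 ha
  generalize Q.filter (fun a => γ a = i) = Qi at hi hQiQ
  -- Within a dyadic class `S` is constant up to a factor 2, so a covering that controls only
  -- lengths also controls the sum of `S`.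
  obtain ⟨B, hB, hdis, hcov⟩ := exists_disjoint_cover J Qi
    (fun a ha => hJ a (hQiQ a ha).1) (fun a ha => haJ a (hQiQ a ha).1)
  refine ⟨B, fun a ha => (hQiQ a (hB ha)).1, hdis, ?_⟩
  have h1 : ∑ a ∈ Qi, S a ≤ 32 * (1 / 2 : ℝ) ^ i * Qi.card := by
    rw [mul_comm, ← nsmul_eq_mul, ← Finset.sum_const]
    refine Finset.sum_le_sum fun a ha => ?_
    obtain ⟨h2, h3⟩ := hQiQ a ha
    have := hγ2 a h2
    rw [h3] at this
    exact this.le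
  have h2 : (Qi.card : ℝ) ≤ 3 * ∑ a ∈ B, ((J a).card : ℝ) := by exact_mod_cast hcov
  have h3 : 16 * (1 / 2 : ℝ) ^ i * ∑ a ∈ B, ((J a).card : ℝ) ≤ M * ∑ a ∈ B, (w a : ℝ) := by
    rw [Finset.mul_sum, Finset.mul_sum]
    refine Finset.sum_le_sum fun a ha => ?_
    obtain ⟨h4, h5⟩ := hQiQ a (hB ha)
    have h6 := hγ1 a h4
    rw [h5] at h6
    exact (mul_le_mul_of_nonneg_right h6 (by positivity)).trans (hw a h4)
  have h4 : ∑ a ∈ Qi, S a ≤ 6 * M * ∑ a ∈ B, (w a : ℝ) := by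
    calc ∑ a ∈ Qi, S a ≤ 32 * (1 / 2 : ℝ) ^ i * (3 * ∑ a ∈ B, ((J a).card : ℝ)) :=
          h1.trans (by gcongr)
      _ = 6 * (16 * (1 / 2 : ℝ) ^ i * ∑ a ∈ B, ((J a).card : ℝ)) := by ring
      _ ≤ 6 * (M * ∑ a ∈ B, (w a : ℝ)) := by gcongr
      _ = _ := by ring
  calc ∑ a ∈ Q, S a ≤ (N + 1) * (6 * M * ∑ a ∈ B, (w a : ℝ)) := hi.trans (by gcongr)
    _ = _ := by ring

-- One level of the recursion. The function `ω` dominates the densities of the growing suffixes at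
-- each index; it is abstract so that all levels share it. The hypothesis `hN` makes every moderate
-- density at least `K / 2 ^ N`, so `α` can be found among `2 ^ (-i)`, `i ≤ N`. The bound on `(J
-- a).card * T.card` says that each piece is as dense as `I` up to the loss, which lets the
-- recursion continue.
set_option maxHeartbeats 800000 in
theorem growing_or_split {f ω : ℕ → ℝ} {n k C N m : ℕ} {I : Finset ℕ} (hI : IsInterval I)
    (hIn : I ⊆ Finset.Icc 1 n) (hm : 2 ≤ m) (hmk : m ≤ k) (hC : 1 ≤ C) (hω0 : ∀ a, 0 ≤ ω a)
    (hω : ∀ a, ∀ i ≤ N, StartsGrowingSuffix n f ((1 / 2) ^ i) (C * k * (1 / 2) ^ i) a →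
      (1 / 2) ^ i ≤ ω a)
    {T : Finset (Fin m → ℕ)} (hT : IsDisjointMonoFamily f I T) (hne : T.Nonempty)
    (hN : splitLoss k C N * I.card ≤ 2 ^ N * T.card) :
    (T.card : ℝ) ≤ splitLoss k C N * ∑ a ∈ I, ω a ∨
    ∃ c d, m = c + 1 + (d + 1) ∧ ∃ (B : Finset ℕ) (J : ℕ → Finset ℕ) (w : ℕ → ℕ),
      (∀ a ∈ B, ∀ b ∈ B, a ≠ b → Disjoint (J a) (J b)) ∧
      (∀ a ∈ B, J a ⊆ I ∧ IsSplitPiece f k (entries T) (J a) (w a) (c + 1) (d + 1) ∧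
        (J a).card * T.card ≤ splitLoss k C N * w a * I.card) ∧
      T.card ≤ splitLoss k C N * ∑ a ∈ B, w a := by
  classical
  obtain ⟨T₂, hT₂E, hmax, hlex⟩ : ∃ T₂ : Finset (Fin m → ℕ),
      IsDisjointMonoFamily f (entries T) T₂ ∧
      (∀ x : Fin m → ℕ, IsMonoTuple f (entries T) x → ∃ i, x i ∈ entries T₂) ∧
      ∀ x ∈ T₂, ∀ y ∈ T₂, x ⟨0, by omega⟩ < y ⟨0, by omega⟩ → ∀ i j : Fin m, (i : ℕ) + 1 = j →
        x i < y j → f (x i) < f (y j) → x j ≤ y j := by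
    obtain ⟨m, rfl⟩ : ∃ m', m = m' + 1 := ⟨m - 1, by omega⟩
    exact exists_lex_greedy f m (entries T)
  -- By maximality each tuple of `T` contains an entry of `T₂`, and disjoint tuples contain
  -- different ones.
  have hcard₂ : T.card ≤ m * T₂.card := by
    refine le_trans ?_ (card_entries_le T₂)
    have : Nonempty (Fin m) := ⟨⟨0, by omega⟩⟩
    choose! i hi using fun x (hx : x ∈ T) => hmax x
      ⟨fun i => mem_entries.2 ⟨x, hx, i, rfl⟩, (hT.1 x hx).2⟩
    refine Finset.card_le_card_of_injOn (fun x => x (i x)) hi ?_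
    intro x hx y hy hxy
    by_contra hne'
    exact hT.2 x hx y hy hne' _ _ hxy
  have hEI : entries T ⊆ I := by
    intro b hb
    obtain ⟨x, hx, i, rfl⟩ := mem_entries.1 hb
    exact (hT.1 x hx).1 i
  obtain ⟨c, d, rfl, T₁, hT₁, hcard₁, hgap⟩ := exists_common_max_gap hm T₂
  set K := concentrationThreshold k C with hKdef
  have hTT : T.card ≤ k ^ 2 * T₁.card := by
    calc T.card ≤ (c + 1 + (d + 1)) * ((c + 1 + (d + 1)) * T₁.card) :=
          hcard₂.trans (Nat.mul_le_mul_left _ hcard₁)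
      _ ≤ k * (k * T₁.card) := by gcongr
      _ = _ := by ring
  have hT₁E : IsDisjointMonoFamily f (entries T) T₁ :=
    ⟨fun x hx => hT₂E.1 x (hT₁ hx), fun x hx y hy => hT₂E.2 x (hT₁ hx) y (hT₁ hy)⟩
  have hT₁I : IsDisjointMonoFamily f I T₁ :=
    ⟨fun x hx => ⟨fun i => hEI ((hT₁E.1 x hx).1 i), (hT₁E.1 x hx).2⟩, hT₁E.2⟩
  have hT₁sub : entries T₁ ⊆ entries T := by
    intro b hb
    obtain ⟨x, hx, i, rfl⟩ := mem_entries.1 hb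
    exact (hT₁E.1 x hx).1 i
  let lo : (Fin (c + 1 + (d + 1)) → ℕ) → ℕ := fun x => x ⟨0, by omega⟩
  obtain ⟨u, hu⟩ : ∃ u : (Fin (c + 1 + (d + 1)) → ℕ) → ℕ,
    u = fun x => x (Fin.castAdd (d + 1) (Fin.last c)) := ⟨_, rfl⟩
  obtain ⟨v, hv⟩ : ∃ v : (Fin (c + 1 + (d + 1)) → ℕ) → ℕ,
    v = fun x => x (Fin.natAdd (c + 1) 0) := ⟨_, rfl⟩
  have hinj : ∀ i, Set.InjOn (fun x : Fin (c + 1 + (d + 1)) → ℕ => x i) T₁ := by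
    intro i x hx y hy hxy
    by_contra hne'
    exact hT₁I.2 x hx y hy hne' _ _ hxy
  have hgap' : ∀ x ∈ T₁, ∀ i j : Fin (c + 1 + (d + 1)), (i : ℕ) + 1 = (j : ℕ) →
      x j ≤ x i + (v x - u x) := by
    intro x hx i j hij
    have := hgap x hx i j (Fin.castAdd (d + 1) (Fin.last c)) (Fin.natAdd (c + 1) 0) hij
      (by simp) (by simp)
    rw [hu, hv]
    simp only
    omega
  have hk1 : 1 ≤ k := by omega
  have hsys : IsGapSystem n k f T₁ lo u v := by
    have hmem : ∀ x ∈ T₁, ∀ i, 1 ≤ x i ∧ x i ≤ n := fun x hx i =>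
      Finset.mem_Icc.1 (hIn ((hT₁I.1 x hx).1 i))
    refine ⟨fun x hx => (hmem x hx _).1, fun x hx => ?_, fun x hx => ?_, fun x hx => ?_,
      fun x hx => ?_, fun x hx => ?_, hinj _, ?_, ?_, fun x hx y hy hxy h1 h2 => ?_⟩
    · rw [hu]; exact (hT₁I.1 x hx).2.1.monotone (by rw [Fin.le_def]; simp)
    · rw [hu, hv]; exact (hT₁I.1 x hx).2.1 (by rw [Fin.lt_def]; simp)
    · rw [hv]; exact (hmem x hx _).2
    · have h1 := le_add_of_gaps_le (hgap' x hx) (c + 1) ⟨0, by omega⟩ (Fin.natAdd (c + 1) 0)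
        (by simp)
      have h2 : v x = x (Fin.natAdd (c + 1) 0) := by rw [hv]
      have h3 : (c + 1) * (v x - u x) ≤ k * (v x - u x) := Nat.mul_le_mul_right _ (by omega)
      simp only [lo]
      omega
    · rw [hu, hv]; exact (hT₁I.1 x hx).2.2 (by rw [Fin.lt_def]; simp)
    · rw [hu]; exact hinj _
    · rw [hv]; exact hinj _
    · rw [hu, hv] at h1 h2
      rw [hv]
      exact hlex x (hT₁ hx) y (hT₁ hy) hxy _ _ (by simp) h1 h2
  have hIco : ∀ x ∈ T₁, Finset.Ico (u x) (v x) ⊆ I := by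
    intro x hx b hb
    obtain ⟨p, q, rfl⟩ := hI
    have h1 := (hT₁I.1 x hx).1 (Fin.castAdd (d + 1) (Fin.last c))
    have h2 := (hT₁I.1 x hx).1 (Fin.natAdd (c + 1) 0)
    rw [Finset.mem_Icc] at h1 h2
    rw [Finset.mem_Ico, hu, hv] at hb
    rw [Finset.mem_Icc]
    simp only at hb
    omega
  have hmod := card_le_sum_moderate hsys.lt hsys.inj_u hIco
  set S := crossingDensity T₁ u v with hS
  set Mo := I.filter fun a => (T₁.card : ℝ) / (16 * I.card) ≤ S a ∧ S a < 32 with hMo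
  -- numerical facts
  have hkr : (1 : ℝ) ≤ k := by exact_mod_cast hk1
  have hCr : (1 : ℝ) ≤ C := by exact_mod_cast hC
  have hK256 : 256 ≤ K := by
    rw [hKdef, concentrationThreshold]
    have h1 : 64 * 4 ≤ 64 * (4 + Nat.clog 2 k) := Nat.mul_le_mul_left _ (by omega)
    have h2 : 1 ≤ C * k := Nat.one_le_iff_ne_zero.2 (Nat.mul_ne_zero (by omega) (by omega))
    calc 256 = 64 * 4 * 1 := by norm_num
      _ ≤ 64 * (4 + Nat.clog 2 k) * (C * k) := Nat.mul_le_mul h1 h2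
      _ = _ := by ring
  have hKr : (256 : ℝ) ≤ K := by exact_mod_cast hK256
  have hKpos : (0 : ℝ) < K := by linarith
  have hTpos : 0 < T.card := hne.card_pos
  have hT₁pos : 0 < T₁.card := by
    rcases Nat.eq_zero_or_pos T₁.card with h | h
    · rw [h] at hTT; omega
    · exact h
  have hIpos : 0 < I.card := by
    obtain ⟨x, hx⟩ := hne
    exact Finset.card_pos.2 ⟨_, (hT.1 x hx).1 ⟨0, by omega⟩⟩
  have hIr : (0 : ℝ) < I.card := by exact_mod_cast hIpos
  have hT₁r : (0 : ℝ) < T₁.card := by exact_mod_cast hT₁pos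
  have hP : (splitLoss k C N : ℝ) = 6144 * K * k ^ 3 * (N + 1) := by
    rw [splitLoss, ← hKdef]; push_cast; ring
  have hTTr : (T.card : ℝ) ≤ k ^ 2 * T₁.card := by exact_mod_cast hTT
  have hNr : 6144 * K * k ^ 3 * (N + 1) * (I.card : ℝ) ≤ 2 ^ N * T.card := by
    rw [← hP]; exact_mod_cast hN
  have hlow : (K : ℝ) / 2 ^ N ≤ T₁.card / (16 * I.card) := by
    rw [div_le_div_iff₀ (by positivity) (by positivity)]
    have h1 : 6144 * K * k ^ 3 * (N + 1) * (I.card : ℝ) ≤ 2 ^ N * (k ^ 2 * T₁.card) :=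
      hNr.trans (by gcongr)
    have h2 : (K : ℝ) * (16 * I.card) * k ^ 2 ≤ 6144 * K * k ^ 3 * (N + 1) * (I.card : ℝ) := by
      have h3 : (1 : ℝ) ≤ k * (N + 1) :=
        one_le_mul_of_one_le_of_one_le hkr (by linarith [(Nat.cast_nonneg N : (0 : ℝ) ≤ N)])
      have h4 : (0 : ℝ) ≤ K * I.card * k ^ 2 := by positivity
      calc (K : ℝ) * (16 * I.card) * (k : ℝ) ^ 2 = 16 * ((K : ℝ) * I.card * (k : ℝ) ^ 2) := by ring
        _ ≤ 6144 * ((K : ℝ) * I.card * (k : ℝ) ^ 2) * 1 := by linarith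
        _ ≤ 6144 * ((K : ℝ) * I.card * (k : ℝ) ^ 2) * ((k : ℝ) * ((N : ℝ) + 1)) := by gcongr
        _ = _ := by ring
    have h5 : (0 : ℝ) < (k : ℝ) ^ 2 := by positivity
    refine le_of_mul_le_mul_right (h2.trans (h1.trans (le_of_eq ?_))) h5
    ring
  have hMoS : ∀ a ∈ Mo, (K : ℝ) / 2 ^ N ≤ S a ∧ (T₁.card : ℝ) / (16 * I.card) ≤ S a ∧
      S a < 32 := fun a ha => by
    obtain ⟨-, h1, h2⟩ := Finset.mem_filter.1 ha
    exact ⟨hlow.trans h1, h1, h2⟩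
  have hpowN : (0 : ℝ) < (1 / 2) ^ N := by positivity
  have hdiv : (K : ℝ) / 2 ^ N = K * (1 / 2) ^ N := by rw [one_div, inv_pow]; rfl
  -- indices of the two kinds
  set p : ℕ → Prop := fun a => ∀ e, (K : ℝ) * (crossingAt T₁ u v a e).card ≤ S a * 2 ^ e with hp
  have hgrow : ∀ a ∈ Mo.filter p, S a ≤ K * ω a := by
    intro a ha
    obtain ⟨haM, hpa⟩ := Finset.mem_filter.1 ha
    obtain ⟨h1, h2, h3⟩ := hMoS a haM
    rw [hdiv] at h1
    have hS0 : 0 < S a := lt_of_lt_of_le (by positivity) h1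
    -- This puts `α = 2 ^ (-i)` between `S a / K` and `2 * S a / K`, the window that
    -- `startsGrowingSuffix` allows.
    obtain ⟨i, hi, h4, h5⟩ := exists_dyadic (y := 2 * S a / K) (N := N)
      (by rw [le_div_iff₀ hKpos]; linarith)
      (by rw [div_lt_iff₀ hKpos]; linarith)
    have h6 : S a / K ≤ (1 / 2) ^ i := by
      have : 2 * S a / K = 2 * (S a / K) := by ring
      linarith
    have h7 := hω a i hi (hsys.startsGrowingSuffix hk1 hC rfl hS0 h3 hpa h6 h4)
    rw [mul_comm, ← div_le_iff₀ hKpos]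
    exact h6.trans h7
  have hsplit : ∀ a ∈ Mo.filter fun a => ¬ p a, ∃ J ⊆ I, a ∈ J ∧ ∃ w : ℕ,
      S a * J.card ≤ 32 * K * k * w ∧ IsSplitPiece f k (entries T) J w (c + 1) (d + 1) := by
    intro a ha
    obtain ⟨haM, hpa⟩ := Finset.mem_filter.1 ha
    rw [hp] at hpa
    push Not at hpa
    obtain ⟨e, he⟩ := hpa
    obtain ⟨J, h1, h2, w, h3, h4⟩ := exists_splitPiece_of_concentrated hI hmk hT₁I
      (crossingDensity_nonneg a) hu hv hgap' he
    exact ⟨J, h1, h2, w, h3, h4.mono hT₁sub⟩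
  have hsum := Finset.sum_filter_add_sum_filter_not Mo p S
  by_cases hcase : (T₁.card : ℝ) ≤ 32 * ∑ a ∈ Mo.filter p, S a
  · left
    have h1 : ∑ a ∈ Mo.filter p, S a ≤ K * ∑ a ∈ I, ω a := by
      rw [Finset.mul_sum]
      refine (Finset.sum_le_sum hgrow).trans ?_
      refine Finset.sum_le_sum_of_subset_of_nonneg
        ((Finset.filter_subset _ _).trans (Finset.filter_subset _ _)) fun a _ _ => ?_
      have := hω0 a
      positivity
    have hW : 0 ≤ ∑ a ∈ I, ω a := Finset.sum_nonneg fun a _ => hω0 a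
    rw [hP]
    calc (T.card : ℝ) ≤ k ^ 2 * (32 * (K * ∑ a ∈ I, ω a)) :=
          hTTr.trans (by gcongr; linarith)
      _ = 32 * K * (k ^ 2 * 1) * 1 * ∑ a ∈ I, ω a := by ring
      _ ≤ 6144 * K * (k ^ 2 * k) * (N + 1) * ∑ a ∈ I, ω a := by
          gcongr
          · norm_num
          · linarith [(Nat.cast_nonneg N : (0 : ℝ) ≤ N)]
      _ = _ := by ring
  · right
    have hbig : (T₁.card : ℝ) ≤ 32 * ∑ a ∈ Mo.filter (fun a => ¬ p a), S a := by
      rw [← hsum] at hmod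
      linarith [not_le.1 hcase]
    set Q := Mo.filter fun a => ¬ p a with hQ
    have hQM : ∀ a ∈ Q, a ∈ Mo := fun a ha => (Finset.mem_filter.1 ha).1
    choose! J hJI haJ w hw hpiece using hsplit
    obtain ⟨B, hBQ, hdis, hsumB⟩ := exists_disjoint_of_weighted (S := S) (Q := Q) (N := N)
      (fun a ha => (hpiece a ha).1) haJ
      (fun a ha => by have := (hMoS a (hQM a ha)).1; rw [hdiv] at this; nlinarith)
      (fun a ha => (hMoS a (hQM a ha)).2.2) hw
    refine ⟨c, d, rfl, B, J, w, hdis, fun a ha => ⟨hJI a (hBQ ha), hpiece a (hBQ ha), ?_⟩,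
      ?_⟩
    · have h1 := hw a (hBQ ha)
      have h2 := (hMoS a (hQM a (hBQ ha))).2.1
      rw [div_le_iff₀ (by positivity)] at h2
      have h3 : ((J a).card : ℝ) * T.card ≤ splitLoss k C N * w a * I.card := by
        rw [hP]
        calc ((J a).card : ℝ) * T.card ≤ (J a).card * (k ^ 2 * (S a * (16 * I.card))) := by
              gcongr; exact hTTr.trans (by gcongr)
          _ = k ^ 2 * (S a * (J a).card) * (16 * I.card) := by ring
          _ ≤ k ^ 2 * (32 * K * k * w a) * (16 * I.card) := by gcongr
          _ = 512 * K * k ^ 3 * 1 * w a * I.card := by ring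
          _ ≤ 6144 * K * k ^ 3 * (N + 1) * w a * I.card := by
              gcongr
              · norm_num
              · linarith [(Nat.cast_nonneg N : (0 : ℝ) ≤ N)]
      exact_mod_cast h3
    · have h5 : (T.card : ℝ) ≤ splitLoss k C N * ∑ a ∈ B, (w a : ℝ) := by
        rw [hP]
        calc (T.card : ℝ) ≤
              k ^ 2 * (32 * (6 * (N + 1) * (32 * K * k) * ∑ a ∈ B, (w a : ℝ))) := by
              refine hTTr.trans ?_
              gcongr
              exact hbig.trans (by gcongr)
          _ = _ := by ring
      exact_mod_cast h5

/-! ### Tree structures of intervals -/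

/-- Binary trees whose nodes are labeled by natural numbers. -/
inductive LabeledTree : Type
  | leaf (r : ℕ) : LabeledTree
  | node (r : ℕ) (l t : LabeledTree) : LabeledTree

namespace LabeledTree

instance : Inhabited LabeledTree := ⟨leaf 0⟩

/-- The number of leaves. -/
def leaves : LabeledTree → ℕ
  | leaf _ => 1
  | node _ l t => l.leaves + t.leaves

/-- All labels are in `[1, D]`. -/
def LabelsLE (D : ℕ) : LabeledTree → Prop
  | leaf r => 1 ≤ r ∧ r ≤ D
  | node r l t => (1 ≤ r ∧ r ≤ D) ∧ l.LabelsLE D ∧ t.LabelsLE D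

/-- The preorder code of a tree. -/
def code : LabeledTree → List ℕ
  | leaf r => [2 * r]
  | node r l t => (2 * r + 1) :: (l.code ++ t.code)

lemma leaves_pos (t : LabeledTree) : 0 < t.leaves := by
  induction t with
  | leaf r => simp [leaves]
  | node r l t ihl iht => simp only [leaves]; omega

lemma length_code (t : LabeledTree) : t.code.length + 1 = 2 * t.leaves := by
  induction t with
  | leaf r => simp [leaves, code]
  | node r l t ihl iht => simp only [leaves, code, List.length_cons, List.length_append]; omega

/-- The parity of a symbol tells a leaf from an inner node, so the code is prefix-free. Arbitrary
continuations are needed to peel off the left subtree first. -/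
lemma code_append_inj (t : LabeledTree) : ∀ (t' : LabeledTree) (s s' : List ℕ),
    t.code ++ s = t'.code ++ s' → t = t' ∧ s = s' := by
  induction t with
  | leaf r =>
    intro t' s s' h
    cases t' with
    | leaf r' =>
      simp only [code, List.cons_append, List.nil_append, List.cons.injEq] at h
      exact ⟨by rw [show r = r' by omega], h.2⟩
    | node r' l' t' =>
      simp only [code, List.cons_append, List.nil_append, List.cons.injEq] at h
      omega
  | node r l t ihl iht =>
    intro t' s s' h
    cases t' with
    | leaf r' =>
      simp only [code, List.cons_append, List.nil_append, List.cons.injEq] at h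
      omega
    | node r' l' t' =>
      simp only [code, List.cons_append, List.append_assoc, List.cons.injEq] at h
      obtain ⟨rfl, h1⟩ := ihl _ _ _ h.2
      obtain ⟨rfl, h2⟩ := iht _ _ _ h1
      exact ⟨by rw [show r = r' by omega], h2⟩

lemma code_lt {D : ℕ} (t : LabeledTree) (h : t.LabelsLE D) : ∀ a ∈ t.code, a < 2 * D + 2 := by
  induction t with
  | leaf r =>
    intro a ha
    simp only [code, List.mem_singleton] at ha
    simp only [LabelsLE] at h
    omega
  | node r l t ihl iht =>
    intro a ha
    simp only [code, List.mem_cons, List.mem_append] at ha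
    obtain ⟨h1, h2, h3⟩ := h
    rcases ha with rfl | ha | ha
    · omega
    · exact ihl h2 a ha
    · exact iht h3 a ha

lemma card_le_of_labelsLE {D m : ℕ} (X : Finset LabeledTree)
    (hX : ∀ t ∈ X, t.leaves = m ∧ t.LabelsLE D) : X.card ≤ (2 * D + 2) ^ (2 * m) := by
  classical
  have h1 : X.card ≤ (Fintype.piFinset fun _ : Fin (2 * m) => Finset.range (2 * D + 2)).card := by
    -- The code of a tree with `m` leaves has length `2 * m - 1`; the default value pads it to `2 *
    -- m`.
    refine Finset.card_le_card_of_injOn (fun t i => t.code.getD i 0) ?_ ?_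
    · intro t ht
      simp only [Finset.mem_coe, Fintype.mem_piFinset, Finset.mem_range]
      intro i
      rcases lt_or_ge (i : ℕ) t.code.length with h | h
      · rw [List.getD_eq_getElem _ _ h]
        exact code_lt t (hX t ht).2 _ (List.getElem_mem _)
      · rw [List.getD_eq_default _ _ h]; omega
    · intro t ht t' ht' htt
      have hl := length_code t
      have hl' := length_code t'
      rw [(hX t ht).1] at hl
      rw [(hX t' ht').1] at hl'
      have : t.code = t'.code := by
        refine List.ext_getElem (by omega) fun i h h' => ?_
        have := congrFun htt ⟨i, by omega⟩
        simpa only [List.getD_eq_getElem _ _ h, List.getD_eq_getElem _ _ h'] using this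
      exact (code_append_inj t t' [] [] (by rw [this])).1
  refine h1.trans (le_of_eq ?_)
  simp

/-- A weighted pigeonhole principle for maps to trees with bounded labels. -/
lemma exists_class {D m : ℕ} (B : Finset ℕ) (hB : B.Nonempty) (τ : ℕ → LabeledTree)
    (hτ : ∀ a ∈ B, (τ a).leaves = m ∧ (τ a).LabelsLE D) (w : ℕ → ℕ) :
    ∃ B' ⊆ B, (∃ t, ∀ a ∈ B', τ a = t) ∧
      ∑ a ∈ B, w a ≤ (2 * D + 2) ^ (2 * m) * ∑ a ∈ B', w a := by
  classical
  have hcard := card_le_of_labelsLE (B.image τ) fun t ht => by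
    obtain ⟨a, ha, rfl⟩ := Finset.mem_image.1 ht
    exact hτ a ha
  obtain ⟨t, ht, hmax⟩ := Finset.exists_max_image (B.image τ)
    (fun t => ∑ a ∈ B with τ a = t, w a) (hB.image _)
  refine ⟨B.filter fun a => τ a = t, Finset.filter_subset _ _,
    ⟨t, fun a ha => (Finset.mem_filter.1 ha).2⟩, ?_⟩
  rw [← Finset.sum_fiberwise_of_maps_to (s := B) (t := B.image τ) (g := τ)
    fun a ha => Finset.mem_image_of_mem _ ha]
  refine (Finset.sum_le_card_nsmul _ _ _ hmax).trans ?_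
  rw [smul_eq_mul]
  exact Nat.mul_le_mul_right _ hcard

end LabeledTree

/-- A subfamily of powers of two that adds up to a given power of two. -/
lemma exists_subset_sum_two_pow {B : Finset ℕ} {q : ℕ → ℕ} {p : ℕ} (hq : ∀ a ∈ B, q a ≤ p)
    (hsum : 2 ^ p ≤ ∑ a ∈ B, 2 ^ q a) : ∃ B' ⊆ B, ∑ a ∈ B', 2 ^ q a = 2 ^ p := by
  classical
  obtain ⟨B', hB', hmin⟩ := Finset.exists_min_image
    (B.powerset.filter fun X => 2 ^ p ≤ ∑ a ∈ X, 2 ^ q a) Finset.card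
    ⟨B, Finset.mem_filter.2 ⟨Finset.mem_powerset_self _, hsum⟩⟩
  rw [Finset.mem_filter, Finset.mem_powerset] at hB'
  have hpos : 0 < 2 ^ p := by positivity
  have hne : B'.Nonempty := by
    rw [Finset.nonempty_iff_ne_empty]
    rintro rfl
    simp only [Finset.sum_empty] at hB'
    omega
  obtain ⟨a, ha, hamin⟩ := Finset.exists_min_image B' q hne
  refine ⟨B', hB'.1, le_antisymm ?_ hB'.2⟩
  have h1 : ∑ b ∈ B'.erase a, 2 ^ q b < 2 ^ p := by
    by_contra hcon
    have := hmin (B'.erase a) (Finset.mem_filter.2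
      ⟨Finset.mem_powerset.2 ((Finset.erase_subset _ _).trans hB'.1), not_lt.1 hcon⟩)
    rw [Finset.card_erase_of_mem ha] at this
    have := Finset.card_pos.2 hne
    omega
  -- All terms, and `2 ^ p`, are multiples of the smallest term. The sum without that term is below
  -- `2 ^ p` by minimality, hence at most `2 ^ p` minus the term.
  have h2 : 2 ^ q a ∣ ∑ b ∈ B'.erase a, 2 ^ q b :=
    Finset.dvd_sum fun b hb => Nat.pow_dvd_pow 2 (hamin b (Finset.mem_of_mem_erase hb))
  have h3 : 2 ^ q a ∣ 2 ^ p := Nat.pow_dvd_pow 2 (hq a (hB'.1 ha))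
  have h4 := Nat.le_of_dvd (by omega) (Nat.dvd_sub h3 h2)
  have h5 := Finset.add_sum_erase B' (fun b => 2 ^ q b) ha
  omega

/-- This labels an interval of length `M` carrying `2 ^ p` tuples: the density is between `2 ^ (-r)`
and twice that. Labels start at 1, which is allowed even at density 1 thanks to the slack of 2. -/
lemma exists_label {p M : ℕ} (h : 2 ^ p ≤ M) : ∃ r, 1 ≤ r ∧ M ≤ 2 ^ (p + r) ∧ 2 ^ (p + r) ≤ 2 * M := by
  have h1 : M ≤ 2 ^ Nat.clog 2 M := Nat.le_pow_clog (by norm_num) M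
  rcases le_or_gt (Nat.clog 2 M) p with h2 | h2
  · have h3 := Nat.pow_le_pow_right (n := 2) (by norm_num) h2
    refine ⟨1, le_rfl, ?_, ?_⟩ <;> rw [pow_succ] <;> omega
  · refine ⟨Nat.clog 2 M - p, by omega, ?_, ?_⟩
    · rwa [Nat.add_sub_cancel' h2.le]
    · rw [Nat.add_sub_cancel' h2.le]
      have hM : 1 < M := by
        by_contra hM
        have : 0 < 2 ^ p := by positivity
        have hM1 : M = 1 := by omega
        rw [hM1] at h2
        simp at h2
      have h3 := Nat.pow_pred_clog_lt_self (b := 2) (by norm_num) hM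
      obtain ⟨e, he⟩ : ∃ e, Nat.clog 2 M = e + 1 := ⟨Nat.clog 2 M - 1, by omega⟩
      rw [he] at h3 ⊢
      simp only [Nat.pred_succ] at h3
      rw [pow_succ]
      omega

/-- `J` is divided into `L`, `M`, `R` as for a splittable pair, and there are sets of indices
`E₁, E₂ ⊆ E`, with `f` smaller on `E₁` than on `E₂`, such that `Φ L E₁` and `Ψ R E₂` hold. -/
def IsSplitBy (f : ℕ → ℝ) (k : ℕ) (J E : Finset ℕ) (Φ Ψ : Finset ℕ → Finset ℕ → Prop) : Prop :=
  ∃ L M R E₁ E₂ : Finset ℕ, IsThreePartition J L M R ∧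
    J.card ≤ 6 * k * L.card ∧ J.card / (6 * k) ≤ M.card ∧ J.card ≤ 6 * k * R.card ∧
    E₁ ⊆ E ∧ E₂ ⊆ E ∧ (∀ a ∈ E₁, ∀ b ∈ E₂, f a < f b) ∧ Φ L E₁ ∧ Ψ R E₂

/-- In the interval `I` there is a collection of intervals organized by the tree, from which
`2 ^ p` disjoint monotone subsequences with entries in `E` can be formed. At every node, the
number of subsequences in an interval is a power of two that is comparable to the length of the
interval times `2 ^ (-r)`, where `r` is the label of the node. -/
def HasTreeFamily (f : ℕ → ℝ) (k : ℕ) : LabeledTree → ℕ → Finset ℕ → Finset ℕ → Prop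
  | .leaf r, p, I, E => (∃ S ⊆ I, S ⊆ E ∧ S.card = 2 ^ p) ∧
      I.card ≤ 2 ^ (p + r) ∧ 2 ^ (p + r) ≤ 2 * I.card
  | .node r l t, p, I, E => ∃ (B : Finset ℕ) (J : ℕ → Finset ℕ) (q : ℕ → ℕ),
      (∀ a ∈ B, ∀ b ∈ B, a ≠ b → Disjoint (J a) (J b)) ∧ ∑ a ∈ B, 2 ^ q a = 2 ^ p ∧
      ∀ a ∈ B, J a ⊆ I ∧ IsInterval (J a) ∧
        (J a).card ≤ 2 ^ (q a + r) ∧ 2 ^ (q a + r) ≤ 2 * (J a).card ∧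
        IsSplitBy f k (J a) E (HasTreeFamily f k l (q a)) (HasTreeFamily f k t (q a))

lemma IsThreePartition.subset {J L M R : Finset ℕ} (h : IsThreePartition J L M R) :
    L ⊆ J ∧ R ⊆ J := by
  obtain ⟨-, -, -, h, -⟩ := h
  subst h
  exact ⟨Finset.subset_union_left.trans Finset.subset_union_left, Finset.subset_union_right⟩

lemma HasTreeFamily.two_pow_le {f : ℕ → ℝ} {k : ℕ} (t : LabeledTree) :
    ∀ {p : ℕ} {I E : Finset ℕ}, HasTreeFamily f k t p I E → 2 ^ p ≤ I.card := by
  classical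
  induction t with
  | leaf r =>
    rintro p I E ⟨⟨S, hS, -, hc⟩, -⟩
    rw [← hc]
    exact Finset.card_le_card hS
  | node r l t ihl iht =>
    rintro p I E ⟨B, J, q, hdis, hsum, h⟩
    rw [← hsum]
    calc ∑ a ∈ B, 2 ^ q a ≤ ∑ a ∈ B, (J a).card := by
          refine Finset.sum_le_sum fun a ha => ?_
          obtain ⟨-, -, -, -, L, M, R, E₁, E₂, h1, -, -, -, -, -, -, h2, -⟩ := h a ha
          exact (ihl h2).trans (Finset.card_le_card h1.subset.1)
      _ = (B.biUnion J).card := (Finset.card_biUnion hdis).symm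
      _ ≤ I.card := Finset.card_le_card (Finset.biUnion_subset.2 fun a ha => (h a ha).1)

/-- The number of subsequences can be decreased to any smaller power of two. -/
lemma HasTreeFamily.truncate {f : ℕ → ℝ} {k D : ℕ} (t : LabeledTree) :
    ∀ {p p' : ℕ} {I E : Finset ℕ}, HasTreeFamily f k t p I E → p' ≤ p →
      2 * I.card ≤ 2 ^ (D + p') → t.LabelsLE D →
      ∃ t' : LabeledTree, t'.leaves = t.leaves ∧ t'.LabelsLE D ∧ HasTreeFamily f k t' p' I E := by
  classical
  induction t with
  | leaf r =>
    rintro p p' I E ⟨⟨S, hS, hSE, hc⟩, h1, h2⟩ hp hI hD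
    obtain ⟨S', hS', hc'⟩ := Finset.exists_subset_card_eq (s := S) (n := 2 ^ p')
      (by rw [hc]; exact Nat.pow_le_pow_right (by norm_num) hp)
    have h3 : p' + (r + (p - p')) = p + r := by omega
    have h4 := (Nat.pow_le_pow_iff_right (a := 2) (by norm_num)).1 (h2.trans hI)
    refine ⟨.leaf (r + (p - p')), rfl, ⟨by have := hD.1; omega, by omega⟩,
      ⟨S', hS'.trans hS, hS'.trans hSE, hc'⟩, ?_, ?_⟩ <;> rwa [h3]
  | node r l t ihl iht =>
    rintro p p' I E ⟨B, J, q, hdis, hsum, h⟩ hp hI hD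
    -- If no interval carries more than `2 ^ p'`, it suffices to drop intervals, and the tree is
    -- unchanged. Otherwise a single interval is enough: both of its sides are thinned recursively,
    -- and its label grows by `q a - p'`.
    by_cases hq : ∀ a ∈ B, q a ≤ p'
    · obtain ⟨B', hB', hsum'⟩ := exists_subset_sum_two_pow hq
        (by rw [hsum]; exact Nat.pow_le_pow_right (by norm_num) hp)
      exact ⟨.node r l t, rfl, hD, B', J, q, fun a ha b hb => hdis a (hB' ha) b (hB' hb), hsum',
        fun a ha => h a (hB' ha)⟩
    · push Not at hq
      obtain ⟨a, ha, hqa⟩ := hq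
      obtain ⟨h1, h2, h3, h4, L, M, R, E₁, E₂, h5, h6, h7, h8, h9, h10, h11, h12, h13⟩ := h a ha
      have hJ : 2 * (J a).card ≤ 2 ^ (D + p') :=
        (Nat.mul_le_mul_left _ (Finset.card_le_card h1)).trans hI
      obtain ⟨l', hl1, hl2, hl3⟩ := ihl h12 hqa.le
        ((Nat.mul_le_mul_left _ (Finset.card_le_card h5.subset.1)).trans hJ) hD.2.1
      obtain ⟨t', ht1, ht2, ht3⟩ := iht h13 hqa.le
        ((Nat.mul_le_mul_left _ (Finset.card_le_card h5.subset.2)).trans hJ) hD.2.2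
      have h14 : p' + (r + (q a - p')) = q a + r := by omega
      have h15 := (Nat.pow_le_pow_iff_right (a := 2) (by norm_num)).1 (h4.trans hJ)
      refine ⟨.node (r + (q a - p')) l' t', by simp only [LabeledTree.leaves, hl1, ht1],
        ⟨⟨by have := hD.1.1; omega, by omega⟩, hl2, ht2⟩, {a}, J, fun _ => p', ?_, by simp, ?_⟩
      · intro b hb b' hb' hne
        rw [Finset.mem_singleton] at hb hb'
        exact (hne (hb.trans hb'.symm)).elim
      · intro b hb
        rw [Finset.mem_singleton] at hb
        subst hb
        rw [h14]
        exact ⟨h1, h2, h3, h4, L, M, R, E₁, E₂, h5, h6, h7, h8, h9, h10, h11, hl3, ht3⟩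

/-! ### Growing suffixes or a tree structure -/

/-- The loss in one step of the construction of a tree structure. -/
def treeLoss (k C N D : ℕ) : ℕ := 4 * splitLoss k C N * (2 * D + 2) ^ (2 * k)

lemma splitLoss_pos {k C : ℕ} (hk : 1 ≤ k) (hC : 1 ≤ C) (N : ℕ) : 1 ≤ splitLoss k C N := by
  have : 0 < splitLoss k C N := by unfold splitLoss concentrationThreshold; positivity
  exact this

lemma treeLoss_ge {k C N D : ℕ} : 4 * splitLoss k C N ≤ treeLoss k C N D :=
  Nat.le_mul_of_pos_right _ (by positivity)

lemma exists_leaf {f : ℕ → ℝ} {k D : ℕ} {I : Finset ℕ} {T : Finset (Fin 1 → ℕ)}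
    (hT : IsDisjointMonoFamily f I T) (hne : T.Nonempty) (hD : 4 * I.card ≤ 2 ^ D * T.card) :
    ∃ t p, LabeledTree.leaves t = 1 ∧ t.LabelsLE D ∧ HasTreeFamily f k t p I (entries T) ∧
      T.card ≤ 2 ^ p * 2 := by
  classical
  have hsub : T.image (fun x => x 0) ⊆ entries T := by
    intro b hb
    obtain ⟨x, hx, rfl⟩ := Finset.mem_image.1 hb
    exact mem_entries.2 ⟨x, hx, 0, rfl⟩
  have hI : entries T ⊆ I := by
    intro b hb
    obtain ⟨x, hx, i, rfl⟩ := mem_entries.1 hb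
    exact (hT.1 x hx).1 i
  have hcard : T.card ≤ (entries T).card := by
    rw [← Finset.card_image_of_injOn (s := T) (f := fun x => x 0)]
    · exact Finset.card_le_card hsub
    · intro x hx y hy hxy
      by_contra hne'
      exact hT.2 x hx y hy hne' _ _ hxy
  have hpos := hne.card_pos
  have h1 : 2 ^ Nat.log 2 T.card ≤ T.card := Nat.pow_log_le_self 2 (by omega)
  have h2 : T.card < 2 ^ (Nat.log 2 T.card + 1) := Nat.lt_pow_succ_log_self (by norm_num) _
  set p := Nat.log 2 T.card
  obtain ⟨S, hS, hSc⟩ := Finset.exists_subset_card_eq (s := entries T) (n := 2 ^ p) (by omega)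
  have h3 : 2 ^ p ≤ I.card := hSc ▸ Finset.card_le_card (hS.trans hI)
  obtain ⟨r, hr1, hr2, hr3⟩ := exists_label h3
  refine ⟨.leaf r, p, rfl, ⟨hr1, ?_⟩, ⟨⟨S, hS.trans hI, hS, hSc⟩, hr2, hr3⟩, ?_⟩
  · have h4 : 2 * 2 ^ (p + r) < 2 * 2 ^ (p + (D + 1)) := by
      calc 2 * 2 ^ (p + r) ≤ 2 * (2 * I.card) := Nat.mul_le_mul_left _ hr3
        _ = 4 * I.card := by ring
        _ ≤ 2 ^ D * T.card := hD
        _ < 2 ^ D * 2 ^ (p + 1) := Nat.mul_lt_mul_of_pos_left h2 (by positivity)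
        _ = 2 ^ (p + (D + 1)) := by rw [← pow_add]; congr 1; omega
        _ ≤ 2 * 2 ^ (p + (D + 1)) := by omega
    have := (Nat.pow_lt_pow_iff_right (a := 2) (by norm_num)).1 (Nat.lt_of_mul_lt_mul_left h4)
    omega
  · rw [pow_succ] at h2; omega

/-- The hypotheses on the density of `T` in `I` pass to the pieces with the exponent lowered by one.
A level costs `2 * splitLoss` in the first alternative. In the second it costs `treeLoss`: the
split, a factor 2 for giving up the pieces with growing suffixes, the pigeonhole over trees, and a
factor 2 for rounding to a power of two. -/
theorem growing_or_tree {f ω : ℕ → ℝ} {n k C N D : ℕ} (hC : 1 ≤ C) (hω0 : ∀ a, 0 ≤ ω a)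
    (hω : ∀ a, ∀ i ≤ N, StartsGrowingSuffix n f ((1 / 2) ^ i) (C * k * (1 / 2) ^ i) a →
      (1 / 2) ^ i ≤ ω a) :
    ∀ m, 1 ≤ m → m ≤ k → ∀ (I : Finset ℕ) (T : Finset (Fin m → ℕ)), IsInterval I →
      I ⊆ Finset.Icc 1 n → IsDisjointMonoFamily f I T → T.Nonempty →
      splitLoss k C N ^ m * I.card ≤ 2 ^ N * T.card →
      4 * treeLoss k C N D ^ m * I.card ≤ 2 ^ D * T.card →
      (T.card : ℝ) ≤ (2 * splitLoss k C N) ^ m * ∑ a ∈ I, ω a ∨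
      ∃ t p, LabeledTree.leaves t = m ∧ t.LabelsLE D ∧ HasTreeFamily f k t p I (entries T) ∧
        T.card ≤ 2 ^ p * treeLoss k C N D ^ m := by
  classical
  intro m
  induction m using Nat.strong_induction_on with
  | _ m ih =>
  intro hm1 hmk I T hI hIn hT hne hN hD
  set P := splitLoss k C N with hP
  set Q := treeLoss k C N D with hQ
  have hP1 : 1 ≤ P := splitLoss_pos (by omega) hC N
  have hPQ : 4 * P ≤ Q := treeLoss_ge
  have hQ1 : 1 ≤ Q := by omega
  have hPr : (1 : ℝ) ≤ P := by exact_mod_cast hP1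
  have hW : ∀ X : Finset ℕ, 0 ≤ ∑ a ∈ X, ω a := fun X => Finset.sum_nonneg fun a _ => hω0 a
  rcases Nat.lt_or_ge m 2 with hm | hm
  · obtain rfl : m = 1 := by omega
    right
    rw [pow_one] at hD
    obtain ⟨t, p, h1, h2, h3, h4⟩ := exists_leaf (k := k) (D := D) hT hne
      (le_trans (Nat.mul_le_mul_right _ (by omega)) hD)
    refine ⟨t, p, h1, h2, h3, h4.trans (Nat.mul_le_mul_left _ ?_)⟩
    rw [pow_one]; omega
  have hTpos := hne.card_pos
  rcases growing_or_split hI hIn hm hmk hC hω0 hω hT hne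
    (le_trans (Nat.mul_le_mul_right _ (Nat.le_self_pow (by omega) P)) hN) with hgrow | hsplit
  · left
    refine hgrow.trans (mul_le_mul_of_nonneg_right ?_ (hW I))
    calc (P : ℝ) ≤ 2 * P := by linarith
      _ ≤ (2 * P) ^ m := le_self_pow₀ (by linarith) (by omega)
  obtain ⟨c, d, rfl, B₀, J, w, hdis₀, hpiece₀, hsum₀⟩ := hsplit
  set e := c + 1 + d with he
  have hee : c + 1 + (d + 1) = e + 1 := rfl
  -- discard the empty pieces
  set B := B₀.filter fun a => 0 < w a with hB
  have hBB : ∀ a ∈ B, a ∈ B₀ ∧ 0 < w a := fun a ha => Finset.mem_filter.1 ha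
  have hsum : T.card ≤ P * ∑ a ∈ B, w a := by
    refine hsum₀.trans (le_of_eq ?_)
    rw [hB, Finset.sum_filter]
    congr 1
    refine Finset.sum_congr rfl fun a _ => ?_
    split_ifs with h <;> omega
  have hpos : ∀ {x y : ℕ}, 0 < y → ∀ {z}, x * y ≤ z * y → x ≤ z := fun hy _ h =>
    Nat.le_of_mul_le_mul_right h hy
  have key : ∀ a ∈ B, (w a : ℝ) ≤ (2 * P) ^ e * ∑ b ∈ J a, ω b ∨
      ∃ p r l t, (LabeledTree.node r l t).leaves = c + 1 + (d + 1) ∧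
        (LabeledTree.node r l t).LabelsLE D ∧
        (J a).card ≤ 2 ^ (p + r) ∧ 2 ^ (p + r) ≤ 2 * (J a).card ∧ w a ≤ 2 ^ p * Q ^ e ∧
        IsSplitBy f k (J a) (entries T) (HasTreeFamily f k l p) (HasTreeFamily f k t p) := by
    intro a ha
    obtain ⟨haB, hwa⟩ := hBB a ha
    obtain ⟨hJI, ⟨hJ, L, M, R, h3, hL, hM, hR, A, A', hA, hA', hAE, hAE', hlt, hwA, hwA'⟩, hdens⟩ :=
      hpiece₀ a haB
    have hNJ : P ^ e * (J a).card ≤ 2 ^ N * w a := by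
      apply hpos hTpos
      calc P ^ e * (J a).card * T.card = P ^ e * ((J a).card * T.card) := by ring
        _ ≤ P ^ e * (P * w a * I.card) := Nat.mul_le_mul_left _ hdens
        _ = (P ^ (e + 1) * I.card) * w a := by ring
        _ ≤ (2 ^ N * T.card) * w a := Nat.mul_le_mul_right _ hN
        _ = _ := by ring
    have hDJ : 4 * Q ^ e * (4 * (J a).card) ≤ 2 ^ D * w a := by
      apply hpos hTpos
      calc 4 * Q ^ e * (4 * (J a).card) * T.card = 16 * Q ^ e * ((J a).card * T.card) := by ring
        _ ≤ 16 * Q ^ e * (P * w a * I.card) := Nat.mul_le_mul_left _ hdens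
        _ = 4 * Q ^ e * (4 * P) * I.card * w a := by ring
        _ ≤ 4 * Q ^ e * Q * I.card * w a := by gcongr
        _ = (4 * Q ^ (e + 1) * I.card) * w a := by ring
        _ ≤ (2 ^ D * T.card) * w a := Nat.mul_le_mul_right _ hD
        _ = _ := by ring
    have hLJ := Finset.card_le_card h3.subset.1
    have hRJ := Finset.card_le_card h3.subset.2
    have hbig : ∀ (m' : ℕ) (X : Finset ℕ) (V : Finset (Fin m' → ℕ)), m' ≤ e → X.card ≤ (J a).card →
        w a ≤ V.card → P ^ m' * X.card ≤ 2 ^ N * V.card ∧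
          4 * Q ^ m' * X.card ≤ 2 ^ D * V.card := by
      intro m' X V hm' hX hV
      constructor
      · calc P ^ m' * X.card ≤ P ^ e * (J a).card := by gcongr
          _ ≤ 2 ^ N * w a := hNJ
          _ ≤ _ := Nat.mul_le_mul_left _ hV
      · calc 4 * Q ^ m' * X.card ≤ 4 * Q ^ e * (4 * (J a).card) := by
              gcongr
              omega
          _ ≤ 2 ^ D * w a := hDJ
          _ ≤ _ := Nat.mul_le_mul_left _ hV
    have hωJ : ∀ (m' : ℕ) (X : Finset ℕ) (v : ℕ), m' ≤ e → X ⊆ J a → w a ≤ v →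
        (v : ℝ) ≤ (2 * P) ^ m' * ∑ b ∈ X, ω b → (w a : ℝ) ≤ (2 * P) ^ e * ∑ b ∈ J a, ω b := by
      intro m' X v hm' hX hv h
      calc (w a : ℝ) ≤ v := by exact_mod_cast hv
        _ ≤ _ := h
        _ ≤ _ := by
          have := hW X
          have h1 : ∑ b ∈ X, ω b ≤ ∑ b ∈ J a, ω b :=
            Finset.sum_le_sum_of_subset_of_nonneg hX fun b _ _ => hω0 b
          gcongr
          linarith
    have hiL := hbig (c + 1) L A (by omega) hLJ hwA
    have hiR := hbig (d + 1) R A' (by omega) hRJ hwA'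
    rcases ih (c + 1) (by omega) (by omega) (by omega) L A h3.1 ((h3.subset.1.trans hJI).trans hIn)
      hA (Finset.card_pos.1 (by omega)) hiL.1 hiL.2 with h | ⟨l, p₁, hl1, hl2, hl3, hl4⟩
    · exact Or.inl (hωJ _ _ _ (by omega) h3.subset.1 hwA h)
    rcases ih (d + 1) (by omega) (by omega) (by omega) R A' h3.2.2.1
      ((h3.subset.2.trans hJI).trans hIn)
      hA' (Finset.card_pos.1 (by omega)) hiR.1 hiR.2 with h | ⟨t, p₂, ht1, ht2, ht3, ht4⟩
    · exact Or.inl (hωJ _ _ _ (by omega) h3.subset.2 hwA' h)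
    right
    -- The sides can be paired only at equal size, so both are cut down to the smaller of `2 ^ p₁`
    -- and `2 ^ p₂`.
    obtain ⟨p, hp1, hp2, hwp⟩ : ∃ p, p ≤ p₁ ∧ p ≤ p₂ ∧ w a ≤ 2 ^ p * Q ^ e := by
      have h1 : w a ≤ 2 ^ p₁ * Q ^ e := hwA.trans (hl4.trans (Nat.mul_le_mul_left _
        (Nat.pow_le_pow_right hQ1 (by omega))))
      have h2 : w a ≤ 2 ^ p₂ * Q ^ e := hwA'.trans (ht4.trans (Nat.mul_le_mul_left _
        (Nat.pow_le_pow_right hQ1 (by omega))))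
      rcases le_total p₁ p₂ with h | h
      · exact ⟨p₁, le_rfl, h, h1⟩
      · exact ⟨p₂, h, le_rfl, h2⟩
    have hJD : 2 * (J a).card ≤ 2 ^ (D + p) := by
      have h1 : 4 * (4 * (J a).card) ≤ 2 ^ (D + p) := by
        apply hpos (y := Q ^ e) (by positivity)
        calc 4 * (4 * (J a).card) * Q ^ e = 4 * Q ^ e * (4 * (J a).card) := by ring
          _ ≤ 2 ^ D * w a := hDJ
          _ ≤ 2 ^ D * (2 ^ p * Q ^ e) := Nat.mul_le_mul_left _ hwp
          _ = _ := by rw [pow_add]; ring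
      omega
    obtain ⟨l', hl1', hl2', hl3'⟩ := hl3.truncate l hp1 (by omega) hl2
    obtain ⟨t', ht1', ht2', ht3'⟩ := ht3.truncate t hp2 (by omega) ht2
    obtain ⟨r, hr1, hr2, hr3⟩ := exists_label ((hl3'.two_pow_le l').trans hLJ)
    refine ⟨p, r, l', t', ?_, ⟨⟨hr1, ?_⟩, hl2', ht2'⟩, hr2, hr3, hwp, L, M, R, entries A, entries A',
      h3, hL, hM, hR, hAE, hAE', hlt, hl3', ht3'⟩
    · simp only [LabeledTree.leaves]; omega
    · have := (Nat.pow_le_pow_iff_right (a := 2) (by norm_num)).1 (hr3.trans hJD)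
      omega
  set bad : ℕ → Prop := fun a => (w a : ℝ) ≤ (2 * P) ^ e * ∑ b ∈ J a, ω b with hbad
  have hdis : ∀ a ∈ B, ∀ b ∈ B, a ≠ b → Disjoint (J a) (J b) := fun a ha b hb =>
    hdis₀ a (hBB a ha).1 b (hBB b hb).1
  have hsplit := Finset.sum_filter_add_sum_filter_not B bad w
  by_cases hcase : ∑ a ∈ B, w a ≤ 2 * ∑ a ∈ B with bad a, w a
  · left
    have h1 : ((∑ a ∈ B with bad a, w a : ℕ) : ℝ) ≤ (2 * P) ^ e * ∑ b ∈ I, ω b := by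
      push_cast
      calc ∑ a ∈ B with bad a, (w a : ℝ) ≤
            ∑ a ∈ B with bad a, (2 * (P : ℝ)) ^ e * ∑ b ∈ J a, ω b :=
            Finset.sum_le_sum fun a ha => (Finset.mem_filter.1 ha).2
        _ = (2 * (P : ℝ)) ^ e * ∑ b ∈ (B.filter bad).biUnion J, ω b := by
            rw [← Finset.mul_sum, Finset.sum_biUnion]
            intro a ha b hb hab
            exact hdis a (Finset.mem_filter.1 ha).1 b (Finset.mem_filter.1 hb).1 hab
        _ ≤ _ := by
            refine mul_le_mul_of_nonneg_left ?_ (by positivity)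
            refine Finset.sum_le_sum_of_subset_of_nonneg
              (Finset.biUnion_subset.2 fun a ha => ?_) fun b _ _ => hω0 b
            exact (hpiece₀ a (hBB a (Finset.mem_filter.1 ha).1).1).1
    have h2 : (T.card : ℝ) ≤ P * (2 * ((∑ a ∈ B with bad a, w a : ℕ) : ℝ)) := by
      exact_mod_cast hsum.trans (Nat.mul_le_mul_left _ hcase)
    calc (T.card : ℝ) ≤ P * (2 * ((2 * P) ^ e * ∑ b ∈ I, ω b)) := h2.trans (by gcongr)
      _ = _ := by rw [hee, pow_succ]; ring
  right
  set G := B.filter fun a => ¬ bad a with hG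
  have hGB : ∀ a ∈ G, a ∈ B := fun a ha => (Finset.mem_filter.1 ha).1
  have hgood := fun a (ha : a ∈ G) => (key a (hGB a ha)).resolve_left (Finset.mem_filter.1 ha).2
  choose! p r l t hleaves hlabels hJ1 hJ2 hwp hsp using hgood
  have hGsum : T.card ≤ P * (2 * ∑ a ∈ G, w a) :=
    hsum.trans (Nat.mul_le_mul_left _ (by omega))
  have hGne : G.Nonempty := by
    rw [Finset.nonempty_iff_ne_empty]
    intro h
    rw [h] at hGsum
    simp only [Finset.sum_empty, mul_zero] at hGsum
    omega
  -- A descriptor has one tree and one label per node, common to all intervals.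
  obtain ⟨G', hG', ⟨τ, hτ⟩, hclass⟩ := LabeledTree.exists_class G hGne
    (fun a => LabeledTree.node (r a) (l a) (t a)) (fun a ha => ⟨hleaves a ha, hlabels a ha⟩)
    (fun a => 2 ^ p a)
  have hGw : ∑ a ∈ G, w a ≤ (∑ a ∈ G, 2 ^ p a) * Q ^ e := by
    rw [Finset.sum_mul]
    exact Finset.sum_le_sum hwp
  have hcl : (2 * D + 2) ^ (2 * (c + 1 + (d + 1))) ≤ (2 * D + 2) ^ (2 * k) :=
    Nat.pow_le_pow_right (by omega) (by omega)
  set s := ∑ a ∈ G', 2 ^ p a with hs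
  -- The factor 2 on the left pays for rounding `s` down to a power of two.
  have hTs : 2 * T.card ≤ s * Q ^ (e + 1) := by
    calc 2 * T.card ≤ 2 * (P * (2 * ((2 * D + 2) ^ (2 * k) * s * Q ^ e))) := by
          refine Nat.mul_le_mul_left _ (hGsum.trans ?_)
          gcongr
          exact hGw.trans (Nat.mul_le_mul_right _ (hclass.trans (Nat.mul_le_mul_right _ hcl)))
      _ = s * (Q ^ e * (4 * P * (2 * D + 2) ^ (2 * k))) := by ring
      _ = _ := by rw [pow_succ, hQ, treeLoss]
  have hspos : s ≠ 0 := by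
    intro h
    rw [h, zero_mul] at hTs
    omega
  have hplog : 2 ^ Nat.log 2 s ≤ s := Nat.pow_log_le_self 2 hspos
  have hplog' : s < 2 ^ (Nat.log 2 s + 1) := Nat.lt_pow_succ_log_self (by norm_num) _
  obtain ⟨B', hB', hB's⟩ := exists_subset_sum_two_pow (B := G') (q := p) (p := Nat.log 2 s)
    (fun a ha => Nat.le_log_of_pow_le (by norm_num)
      (Finset.single_le_sum (f := fun a => 2 ^ p a) (fun _ _ => Nat.zero_le _) ha)) hplog
  have hG'ne : G'.Nonempty := by
    rw [Finset.nonempty_iff_ne_empty]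
    intro h
    rw [hs, h] at hspos
    simp at hspos
  obtain ⟨a₀, ha₀⟩ := hG'ne
  have hrlt : ∀ a ∈ B', r a = r a₀ ∧ l a = l a₀ ∧ t a = t a₀ := fun a ha => by
    have := (hτ a (hB' ha)).trans (hτ a₀ ha₀).symm
    simpa using this
  refine ⟨.node (r a₀) (l a₀) (t a₀), Nat.log 2 s, hleaves a₀ (hG' ha₀), hlabels a₀ (hG' ha₀),
    ⟨B', J, p, fun a ha b hb => hdis a (hGB a (hG' (hB' ha))) b (hGB b (hG' (hB' hb))), hB's,
      fun a ha => ?_⟩, ?_⟩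
  · have haG := hG' (hB' ha)
    have haB := (hBB a (hGB a haG)).1
    obtain ⟨h1, h2, h3⟩ := hrlt a ha
    refine ⟨(hpiece₀ a haB).1, (hpiece₀ a haB).2.1.1, h1 ▸ hJ1 a haG, h1 ▸ hJ2 a haG, ?_⟩
    rw [← h2, ← h3]
    exact hsp a haG
  · have h1 : 2 * T.card ≤ 2 * (2 ^ Nat.log 2 s * Q ^ (e + 1)) := by
      calc 2 * T.card ≤ s * Q ^ (e + 1) := hTs
        _ ≤ 2 ^ (Nat.log 2 s + 1) * Q ^ (e + 1) := Nat.mul_le_mul_right _ hplog'.le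
        _ = _ := by rw [pow_succ]; ring
    exact Nat.le_of_mul_le_mul_left h1 (by norm_num)

/-! ### From tree structures to tree descriptors -/

namespace LabeledTree

/-- The underlying binary tree. -/
def toBinTree : (t : LabeledTree) → BinTree t.leaves
  | leaf _ => BinTree.leaf
  | node _ l t => BinTree.node l.toBinTree t.toBinTree

/-- The label of the node with the given address. -/
def labelAt : LabeledTree → List Bool → ℕ
  | leaf r, _ => r
  | node r _ _, [] => r
  | node _ l _, false :: v => l.labelAt v
  | node _ _ t, true :: v => t.labelAt v

lemma LabelsLE.labelAt {D : ℕ} (t : LabeledTree) (h : t.LabelsLE D) :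
    ∀ v, t.toBinTree.IsNode v → 1 ≤ t.labelAt v ∧ t.labelAt v ≤ D := by
  induction t with
  | leaf r => exact fun v _ => h
  | node r l t ihl iht =>
    intro v hv
    match v, hv with
    | [], _ => exact h.1
    | false :: v, hv => exact ihl h.2.1 v hv
    | true :: v, hv => exact iht h.2.2 v hv

end LabeledTree

/-- Any bijection between the two families will do, since every left entry precedes every right
entry and has a smaller value. -/
lemma exists_paired_family {f : ℕ → ℝ} {c d : ℕ} {J L R : Finset ℕ} {A : Finset (Fin c → ℕ)}
    {A' : Finset (Fin d → ℕ)} (hA : IsDisjointMonoFamily f L A) (hA' : IsDisjointMonoFamily f R A')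
    (hL : L ⊆ J) (hR : R ⊆ J) (hLR : ∀ a ∈ L, ∀ b ∈ R, a < b)
    (hf : ∀ a ∈ entries A, ∀ b ∈ entries A', f a < f b) (hcard : A.card = A'.card) :
    ∃ T : Finset (Fin (c + d) → ℕ), IsDisjointMonoFamily f J T ∧ T.card = A.card ∧
      prefixes T = A ∧ suffixes T = A' ∧ entries T ⊆ entries A ∪ entries A' := by
  classical
  let φ : A ≃ A' := Finset.equivOfCardEq hcard
  let g : A → (Fin (c + d) → ℕ) := fun x => Fin.append x.1 (φ x).1
  have hgl : ∀ x i, g x (Fin.castAdd d i) = x.1 i := fun x i => Fin.append_left _ _ i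
  have hgr : ∀ x j, g x (Fin.natAdd c j) = (φ x).1 j := fun x j => Fin.append_right _ _ j
  have hginj : Function.Injective g := by
    intro x y hxy
    apply Subtype.ext
    funext i
    rw [← hgl, hxy, hgl]
  have hmemL : ∀ (x : A) i, x.1 i ∈ L := fun x i => (hA.1 x.1 x.2).1 i
  have hmemR : ∀ (x : A') i, x.1 i ∈ R := fun x i => (hA'.1 x.1 x.2).1 i
  have hcases : ∀ i : Fin (c + d), (∃ i', i = Fin.castAdd d i') ∨ ∃ j, i = Fin.natAdd c j :=
    fun i => Fin.addCases (fun i' => Or.inl ⟨i', rfl⟩) (fun j => Or.inr ⟨j, rfl⟩) i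
  refine ⟨Finset.univ.image g, ⟨?_, ?_⟩, ?_, ?_, ?_, ?_⟩
  · intro y hy
    obtain ⟨x, -, rfl⟩ := Finset.mem_image.1 hy
    have hx := hA.1 x.1 x.2
    have hx' := hA'.1 (φ x).1 (φ x).2
    refine ⟨fun i => ?_, fun i j hij => ?_, fun i j hij => ?_⟩
    · rcases hcases i with ⟨i, rfl⟩ | ⟨i, rfl⟩
      · rw [hgl]; exact hL (hx.1 i)
      · rw [hgr]; exact hR (hx'.1 i)
    · rcases hcases i with ⟨i, rfl⟩ | ⟨i, rfl⟩ <;> rcases hcases j with ⟨j, rfl⟩ | ⟨j, rfl⟩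
      · rw [hgl, hgl]; exact hx.2.1 (by rw [Fin.lt_def] at hij ⊢; simpa using hij)
      · rw [hgl, hgr]; exact hLR _ (hx.1 i) _ (hx'.1 j)
      · rw [Fin.lt_def] at hij; simp at hij; omega
      · rw [hgr, hgr]; exact hx'.2.1 (by rw [Fin.lt_def] at hij ⊢; simpa using hij)
    · simp only
      rcases hcases i with ⟨i, rfl⟩ | ⟨i, rfl⟩ <;> rcases hcases j with ⟨j, rfl⟩ | ⟨j, rfl⟩
      · rw [hgl, hgl]; exact hx.2.2 (by rw [Fin.lt_def] at hij ⊢; simpa using hij)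
      · rw [hgl, hgr]
        exact hf _ (mem_entries.2 ⟨_, x.2, i, rfl⟩) _ (mem_entries.2 ⟨_, (φ x).2, j, rfl⟩)
      · rw [Fin.lt_def] at hij; simp at hij; omega
      · rw [hgr, hgr]; exact hx'.2.2 (by rw [Fin.lt_def] at hij ⊢; simpa using hij)
  · intro y hy z hz hne i j
    obtain ⟨x, -, rfl⟩ := Finset.mem_image.1 hy
    obtain ⟨x', -, rfl⟩ := Finset.mem_image.1 hz
    have hxx : x ≠ x' := fun h => hne (by rw [h])
    rcases hcases i with ⟨i, rfl⟩ | ⟨i, rfl⟩ <;> rcases hcases j with ⟨j, rfl⟩ | ⟨j, rfl⟩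
    · rw [hgl, hgl]; exact hA.2 _ x.2 _ x'.2 (fun h => hxx (Subtype.ext h)) i j
    · rw [hgl, hgr]; exact (hLR _ (hmemL x i) _ (hmemR (φ x') j)).ne
    · rw [hgl, hgr]; exact (hLR _ (hmemL x' j) _ (hmemR (φ x) i)).ne'
    · rw [hgr, hgr]
      exact hA'.2 _ (φ x).2 _ (φ x').2 (fun h => hxx (φ.injective (Subtype.ext h))) i j
  · rw [Finset.card_image_of_injective _ hginj]
    simp
  · ext y
    simp only [prefixes, Finset.mem_image, Finset.mem_univ, true_and, exists_exists_eq_and]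
    constructor
    · rintro ⟨x, rfl⟩
      simp only [hgl]
      exact x.2
    · exact fun hy => ⟨⟨y, hy⟩, funext fun i => hgl _ i⟩
  · ext y
    simp only [suffixes, Finset.mem_image, Finset.mem_univ, true_and, exists_exists_eq_and]
    constructor
    · rintro ⟨x, rfl⟩
      simp only [hgr]
      exact (φ x).2
    · intro hy
      refine ⟨φ.symm ⟨y, hy⟩, funext fun i => ?_⟩
      rw [hgr, Equiv.apply_symm_apply]
  · intro b hb
    obtain ⟨y, hy, i, rfl⟩ := mem_entries.1 hb
    obtain ⟨x, -, rfl⟩ := Finset.mem_image.1 hy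
    rw [Finset.mem_union]
    rcases hcases i with ⟨i, rfl⟩ | ⟨i, rfl⟩
    · rw [hgl]; exact Or.inl (mem_entries.2 ⟨_, x.2, i, rfl⟩)
    · rw [hgr]; exact Or.inr (mem_entries.2 ⟨_, (φ x).2, i, rfl⟩)

lemma half_pow_le_div {q r M : ℕ} (hM : 0 < M) (h : M ≤ 2 ^ (q + r)) :
    (1 / 2 : ℝ) ^ r ≤ ((2 ^ q : ℕ) : ℝ) / M := by
  have h1 : (M : ℝ) ≤ 2 ^ q * 2 ^ r := by rw [← pow_add]; exact_mod_cast h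
  have h2 : (0 : ℝ) < M := by exact_mod_cast hM
  rw [one_div, inv_pow, le_div_iff₀ h2, inv_mul_le_iff₀ (by positivity)]
  push_cast
  linarith

lemma two_pow_le_half_pow {q r M : ℕ} (h : 2 ^ (q + r) ≤ 2 * M) :
    (2 : ℝ) ^ q ≤ 2 * (1 / 2 : ℝ) ^ r * M := by
  have h1 : (2 : ℝ) ^ q * 2 ^ r ≤ 2 * M := by rw [← pow_add]; exact_mod_cast h
  rw [one_div, inv_pow, mul_assoc, mul_left_comm, le_inv_mul_iff₀ (by positivity)]
  linarith

/-- Tuples are paired from the leaves upwards. In each interval their number is within a factor 2 of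
`2 ^ (-r)` times the length, so the lower bound on the total length of the intervals needs only
`hδ`. -/
lemma HasTreeFamily.exists_describes {f : ℕ → ℝ} {k c₀ : ℕ} {δ : ℝ} (hk : 1 ≤ k)
    (hδ : 2 ≤ polyLog c₀ k δ ^ k) (t : LabeledTree) :
    ∀ {p : ℕ} {I E : Finset ℕ}, HasTreeFamily f k t p I E →
      ∃ (T : Finset (Fin t.leaves → ℕ)) (Iv : List Bool → Finset (Finset ℕ)),
        IsDisjointMonoFamily f I T ∧ entries T ⊆ E ∧ T.card = 2 ^ p ∧
        (∀ v, ∀ K ∈ Iv v, K.Nonempty ∧ IsInterval K ∧ K ⊆ I) ∧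
        t.toBinTree.Describes c₀ k δ f t.labelAt Iv T I := by
  classical
  induction t with
  | leaf r =>
    rintro p I E ⟨⟨S, hSI, hSE, hc⟩, h1, h2⟩
    have hpos : 0 < I.card := by
      have : 0 < 2 ^ (p + r) := by positivity
      omega
    have hposr : (0 : ℝ) < I.card := by exact_mod_cast hpos
    let T : Finset (Fin 1 → ℕ) := S.image fun s _ => s
    have hT : ∀ x ∈ T, x 0 ∈ S := fun x hx => by
      obtain ⟨s, hs, rfl⟩ := Finset.mem_image.1 hx
      exact hs
    have hTc : T.card = 2 ^ p := by
      rw [← hc]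
      exact Finset.card_image_of_injective _ fun a b hab => congrFun hab 0
    -- The type of the tuples depends on `leaves`, which is reduced here to `1`.
    change ∃ (T : Finset (Fin 1 → ℕ)) (Iv : List Bool → Finset (Finset ℕ)),
      IsDisjointMonoFamily f I T ∧ entries T ⊆ E ∧ T.card = 2 ^ p ∧
      (∀ v, ∀ K ∈ Iv v, K.Nonempty ∧ IsInterval K ∧ K ⊆ I) ∧
      BinTree.leaf.Describes c₀ k δ f (fun _ => r) Iv T I
    refine ⟨T, fun _ => T.image fun x => {x 0}, ⟨fun x hx => ⟨fun i => ?_, ?_, ?_⟩, ?_⟩, ?_, hTc, ?_,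
      ?_, ?_, rfl⟩
    · rw [Subsingleton.elim i 0]; exact hSI (hT x hx)
    · exact Subsingleton.strictMono _
    · exact Subsingleton.strictMono _
    · intro x hx y hy hne i j hxy
      rw [Subsingleton.elim i 0, Subsingleton.elim j 0] at hxy
      exact hne (funext fun i => by rw [Subsingleton.elim i 0]; exact hxy)
    · intro b hb
      obtain ⟨x, hx, i, rfl⟩ := mem_entries.1 hb
      rw [Subsingleton.elim i 0]
      exact hSE (hT x hx)
    · intro v K hK
      obtain ⟨x, hx, rfl⟩ := Finset.mem_image.1 hK
      exact ⟨Finset.singleton_nonempty _, ⟨x 0, x 0, by simp⟩,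
        Finset.singleton_subset_iff.2 (hSI (hT x hx))⟩
    · rw [hTc]
      exact half_pow_le_div hpos h1
    · rw [hTc, div_le_iff₀ hposr]
      push_cast
      exact two_pow_le_half_pow h2
  | node r l t ihl iht =>
    rintro p I E ⟨B, J, q, hdis, hsum, h⟩
    have key : ∀ a ∈ B, ∃ (L M R : Finset ℕ) (T : Finset (Fin (l.leaves + t.leaves) → ℕ))
        (IL IR : List Bool → Finset (Finset ℕ)),
        IsDisjointMonoFamily f (J a) T ∧ entries T ⊆ E ∧ T.card = 2 ^ q a ∧
        L ⊆ J a ∧ R ⊆ J a ∧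
        (∀ v, ∀ K ∈ IL v, K.Nonempty ∧ IsInterval K ∧ K ⊆ L) ∧
        (∀ v, ∀ K ∈ IR v, K.Nonempty ∧ IsInterval K ∧ K ⊆ R) ∧
        SplitsVia f (1 / (6 * (k : ℝ))) (((1 : ℝ) / 2) ^ r) (J a) T L M R ∧
        l.toBinTree.Describes c₀ k δ f l.labelAt IL (prefixes T) L ∧
        t.toBinTree.Describes c₀ k δ f t.labelAt IR (suffixes T) R := by
      intro a ha
      obtain ⟨h1, h2, h3, h4, L, M, R, E₁, E₂, h5, h6, h7, h8, h9, h10, h11, h12, h13⟩ := h a ha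
      obtain ⟨A, IL, hA, hAE, hAc, hIL, hAd⟩ := ihl h12
      obtain ⟨A', IR, hA', hAE', hAc', hIR, hAd'⟩ := iht h13
      obtain ⟨T, hT, hTc, hTA, hTA', hTE⟩ := exists_paired_family hA hA' h5.subset.1 h5.subset.2
        h5.2.2.2.2.2.2 (fun b hb b' hb' => h11 b (hAE hb) b' (hAE' hb')) (hAc.trans hAc'.symm)
      have hpos : 0 < (J a).card := by
        have : 0 < 2 ^ (q a + r) := by positivity
        omega
      have hkr : (0 : ℝ) < 6 * (k : ℝ) := by
        have : (1 : ℝ) ≤ k := by exact_mod_cast hk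
        linarith
      have hle : ∀ X : Finset ℕ, (J a).card ≤ 6 * k * X.card →
          1 / (6 * (k : ℝ)) * (J a).card ≤ X.card := by
        intro X hX
        rw [one_div, inv_mul_le_iff₀ hkr]
        exact_mod_cast hX
      refine ⟨L, M, R, T, IL, IR, hT, ?_, hTc.trans hAc, h5.subset.1, h5.subset.2,
        hIL, hIR, ⟨?_, ?_, h5, hle L h6, ?_, hle R h8, ?_, ?_⟩, ?_, ?_⟩
      · exact hTE.trans (Finset.union_subset (hAE.trans h9) (hAE'.trans h10))
      · rw [hTc, hAc]
        exact half_pow_le_div hpos h3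
      · rw [hTA, hTA']
        intro x hx y hy i j _ _
        exact h11 _ (hAE (mem_entries.2 ⟨x, hx, i, rfl⟩)) _ (hAE' (mem_entries.2 ⟨y, hy, j, rfl⟩))
      · have : 1 / (6 * (k : ℝ)) * (J a).card = ((J a).card : ℝ) / ((6 * k : ℕ) : ℝ) := by
          push_cast
          ring
        rw [this, Nat.floor_div_eq_div]
        exact h7
      · rw [hTA]; exact fun x hx i => (hA.1 x hx).1 i
      · rw [hTA']; exact fun x hx i => (hA'.1 x hx).1 i
      · rw [hTA]; exact hAd
      · rw [hTA']; exact hAd'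
    choose! L M R TT IL IR hT hTE hTc hLJ hRJ hIL hIR hsp hdl hdr using key
    have hJI : ∀ a ∈ B, J a ⊆ I := fun a ha => (h a ha).1
    have hJne : ∀ a ∈ B, (J a).Nonempty := fun a ha => by
      have h1 := (h a ha).2.2.2.1
      have : 0 < 2 ^ (q a + r) := by positivity
      exact Finset.card_pos.1 (by omega)
    have hJinj : Set.InjOn J B := by
      intro a ha b hb hab
      by_contra hne
      have := hdis a ha b hb hne
      rw [hab, disjoint_self] at this
      exact (hJne b hb).ne_empty this
    let z : Fin (l.leaves + t.leaves) := ⟨0, by have := l.leaves_pos; omega⟩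
    have htuples : ∀ a ∈ B, tuplesIn (B.biUnion TT) (J a) = TT a := by
      intro a ha
      ext x
      rw [tuplesIn, Finset.mem_filter, Finset.mem_biUnion]
      constructor
      · rintro ⟨⟨b, hb, hx⟩, hxJ⟩
        by_cases hab : a = b
        · rwa [hab]
        · exact (Finset.disjoint_left.1 (hdis a ha b hb hab) (hxJ z)
            (((hT b hb).1 x hx).1 z)).elim
      · exact fun hx => ⟨⟨a, ha, hx⟩, ((hT a ha).1 x hx).1⟩
    have hTTdis : ∀ a ∈ B, ∀ b ∈ B, a ≠ b → Disjoint (TT a) (TT b) := by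
      intro a ha b hb hab
      refine Finset.disjoint_left.2 fun x hx hx' => ?_
      exact Finset.disjoint_left.1 (hdis a ha b hb hab) (((hT a ha).1 x hx).1 z)
        (((hT b hb).1 x hx').1 z)
    -- Filtering the union by containment in `X a` recovers the labeling for `a`: a nonempty set
    -- inside both `X a` and `X b` would make `J a` and `J b` meet. This is why nonemptiness is
    -- carried along.
    have hfilter : ∀ (X : ℕ → Finset ℕ) (Y : ℕ → List Bool → Finset (Finset ℕ)),
        (∀ a ∈ B, X a ⊆ J a) → (∀ a ∈ B, ∀ v, ∀ K ∈ Y a v, K.Nonempty ∧ IsInterval K ∧ K ⊆ X a) →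
        ∀ a ∈ B, (fun v => (B.biUnion fun b => Y b v).filter fun K => K ⊆ X a) = Y a := by
      intro X Y hX hY a ha
      funext v
      ext K
      rw [Finset.mem_filter, Finset.mem_biUnion]
      constructor
      · rintro ⟨⟨b, hb, hK⟩, hKX⟩
        by_cases hab : a = b
        · rwa [hab]
        · obtain ⟨⟨i, hi⟩, -, hKb⟩ := hY b hb v K hK
          exact (Finset.disjoint_left.1 (hdis a ha b hb hab) (hX a ha (hKX hi))
            (hX b hb (hKb hi))).elim
      · exact fun hK => ⟨⟨a, ha, hK⟩, (hY a ha v K hK).2.2⟩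
    let Iv : List Bool → Finset (Finset ℕ) := fun v =>
      match v with
      | [] => B.image J
      | false :: v => B.biUnion fun b => IL b v
      | true :: v => B.biUnion fun b => IR b v
    have hcard : (B.biUnion TT).card = 2 ^ p := by
      rw [Finset.card_biUnion hTTdis, ← hsum]
      exact Finset.sum_congr rfl hTc
    change ∃ (T : Finset (Fin (l.leaves + t.leaves) → ℕ)) (Iv : List Bool → Finset (Finset ℕ)),
      IsDisjointMonoFamily f I T ∧ entries T ⊆ E ∧ T.card = 2 ^ p ∧
      (∀ v, ∀ K ∈ Iv v, K.Nonempty ∧ IsInterval K ∧ K ⊆ I) ∧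
      (BinTree.node l.toBinTree t.toBinTree).Describes c₀ k δ f
        (LabeledTree.node r l t).labelAt Iv T I
    refine ⟨B.biUnion TT, Iv, ⟨?_, ?_⟩, ?_, hcard, ?_, ?_, ⟨?_, ?_, ?_⟩, ?_, ?_⟩
    · intro x hx
      obtain ⟨a, ha, hx⟩ := Finset.mem_biUnion.1 hx
      have := (hT a ha).1 x hx
      exact ⟨fun i => hJI a ha (this.1 i), this.2⟩
    · intro x hx y hy hne i j hij
      obtain ⟨a, ha, hx⟩ := Finset.mem_biUnion.1 hx
      obtain ⟨b, hb, hy⟩ := Finset.mem_biUnion.1 hy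
      by_cases hab : a = b
      · subst hab
        exact (hT a ha).2 x hx y hy hne i j hij
      · have := ((hT a ha).1 x hx).1 i
        rw [hij] at this
        exact Finset.disjoint_left.1 (hdis a ha b hb hab) this (((hT b hb).1 y hy).1 j)
    · intro b hb
      obtain ⟨x, hx, i, rfl⟩ := mem_entries.1 hb
      obtain ⟨a, ha, hx⟩ := Finset.mem_biUnion.1 hx
      exact hTE a ha (mem_entries.2 ⟨x, hx, i, rfl⟩)
    · intro v K hK
      match v, hK with
      | [], hK =>
        obtain ⟨a, ha, rfl⟩ := Finset.mem_image.1 hK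
        exact ⟨hJne a ha, (h a ha).2.1, hJI a ha⟩
      | false :: v, hK =>
        obtain ⟨a, ha, hK⟩ := Finset.mem_biUnion.1 hK
        obtain ⟨h1, h2, h3⟩ := hIL a ha v K hK
        exact ⟨h1, h2, h3.trans ((hLJ a ha).trans (hJI a ha))⟩
      | true :: v, hK =>
        obtain ⟨a, ha, hK⟩ := Finset.mem_biUnion.1 hK
        obtain ⟨h1, h2, h3⟩ := hIR a ha v K hK
        exact ⟨h1, h2, h3.trans ((hRJ a ha).trans (hJI a ha))⟩
    · intro K hK
      obtain ⟨a, ha, rfl⟩ := Finset.mem_image.1 hK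
      exact hJI a ha
    · intro K hK K' hK' hne
      obtain ⟨a, ha, rfl⟩ := Finset.mem_image.1 hK
      obtain ⟨b, hb, rfl⟩ := Finset.mem_image.1 hK'
      exact hdis a ha b hb fun hab => hne (by rw [hab])
    · intro K hK
      obtain ⟨a, ha, rfl⟩ := Finset.mem_image.1 hK
      rw [htuples a ha]
      exact ⟨(h a ha).2.1, L a, M a, R a, hsp a ha⟩
    · intro x hx
      obtain ⟨a, ha, hxa⟩ := Finset.mem_biUnion.1 hx
      exact ⟨J a, Finset.mem_image_of_mem _ ha, by rwa [htuples a ha]⟩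
    · change _ ≤ ((1 : ℝ) / 2) ^ r * ∑ K ∈ B.image J, (K.card : ℝ)
      rw [Finset.sum_image hJinj, div_le_iff₀ (by linarith)]
      have h1 : ((B.biUnion TT).card : ℝ) ≤ 2 * (((1 : ℝ) / 2) ^ r * ∑ a ∈ B, ((J a).card : ℝ)) := by
        rw [hcard, ← hsum, ← mul_assoc, Finset.mul_sum]
        push_cast
        exact Finset.sum_le_sum fun a ha => two_pow_le_half_pow (h a ha).2.2.2.1
      have h2 : 0 ≤ ((1 : ℝ) / 2) ^ r * ∑ a ∈ B, ((J a).card : ℝ) := by positivity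
      linarith [mul_le_mul_of_nonneg_left hδ h2]
    · intro K hK
      obtain ⟨a, ha, rfl⟩ := Finset.mem_image.1 hK
      refine ⟨L a, M a, R a, ?_, ?_, ?_⟩
      · rw [htuples a ha]; exact hsp a ha
      · rw [htuples a ha]
        have := hfilter L IL hLJ hIL a ha
        change l.toBinTree.Describes c₀ k δ f l.labelAt
          (fun v => (B.biUnion fun b => IL b v).filter fun K => K ⊆ L a) _ _
        rw [this]
        exact hdl a ha
      · rw [htuples a ha]
        have := hfilter R IR hRJ hIR a ha
        change t.toBinTree.Describes c₀ k δ f t.labelAt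
          (fun v => (B.biUnion fun b => IR b v).filter fun K => K ⊆ R a) _ _
        rw [this]
        exact hdr a ha

/-! ### The structure theorem -/

lemma exists_two_pow_near {y : ℝ} (hy : 1 ≤ y) :
    ∃ N : ℕ, (2 : ℝ) ^ N ≤ y ∧ y ≤ 2 * 2 ^ N ∧ (N : ℝ) ≤ Real.logb 2 y := by
  obtain ⟨N, h1, h2⟩ := exists_nat_pow_near hy (by norm_num : (1 : ℝ) < 2)
  refine ⟨N, h1, ?_, ?_⟩
  · rw [pow_succ] at h2; linarith
  · rw [Real.le_logb_iff_rpow_le (by norm_num) (by linarith), Real.rpow_natCast]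
    exact h1

lemma logb_two_le {x : ℝ} (hx : 0 < x) : Real.logb 2 x ≤ 2 * x := by
  have h1 := Real.log_le_sub_one_of_pos hx
  have h2 := Real.log_two_gt_d9
  rw [Real.logb, div_le_iff₀ (by linarith)]
  nlinarith

lemma clog_le_self (k : ℕ) : Nat.clog 2 k ≤ k :=
  (Nat.clog_le_iff_le_pow (by norm_num)).2 Nat.lt_two_pow_self.le

lemma splitLoss_le {k C N : ℕ} {Λ B : ℝ} (hk : 1 ≤ k) (hkΛ : (k : ℝ) ≤ Λ)
    (hN : ((N : ℝ) + 1) ≤ B) : (splitLoss k C N : ℝ) ≤ 1966080 * C * Λ ^ 5 * B := by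
  have hΛ0 : 0 ≤ Λ := k.cast_nonneg.trans hkΛ
  have h1 : 4 + Nat.clog 2 k ≤ 5 * k := by have := clog_le_self k; omega
  have h2 : splitLoss k C N ≤ 1966080 * C * k ^ 5 * (N + 1) := by
    calc splitLoss k C N = 6144 * (64 * (4 + Nat.clog 2 k) * C * k) * k ^ 3 * (N + 1) := rfl
      _ ≤ 6144 * (64 * (5 * k) * C * k) * k ^ 3 * (N + 1) := by gcongr
      _ = _ := by ring
  calc (splitLoss k C N : ℝ) ≤ 1966080 * C * k ^ 5 * (N + 1) := by exact_mod_cast h2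
    _ ≤ _ := by gcongr

lemma polyLog_eq_mul_pow (c k : ℕ) (ε : ℝ) :
    polyLog c k ε = (c : ℝ) ^ c * ((k : ℝ) + Real.logb 2 (1 / ε)) ^ c := by
  rw [polyLog, mul_pow]

lemma logb_inv_pos {ε : ℝ} (hε : 0 < ε) (hε1 : ε < 1) : 0 < Real.logb 2 (1 / ε) :=
  Real.logb_pos (by norm_num) (by rw [lt_div_iff₀ hε]; linarith)

/-- The numerical parameters of the construction. -/
lemma exists_parameters (C : ℕ) : ∃ c : ℕ, 17 ≤ c ∧ ∀ (k : ℕ) (ε : ℝ), 1 ≤ k → 0 < ε → ε < 1 →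
    ∃ N D : ℕ, 1 ≤ D ∧ ε * 2 ^ N ≤ polyLog c k ε ^ k ∧ polyLog c k ε ^ k ≤ 2 * (ε * 2 ^ N) ∧
      ε * 2 ^ D ≤ polyLog c k ε ^ k ^ 2 ∧ polyLog c k ε ^ k ^ 2 ≤ 2 * (ε * 2 ^ D) ∧
      32 * (splitLoss k C N : ℝ) * (2 * D + 2) ^ 2 * (N + 1) ≤ polyLog c k ε := by
  -- `N` and `D` depend on `c` through `P = (c * Λ) ^ c`, but only logarithmically: they are of
  -- order `c ^ 2 * Λ ^ 2` and `c ^ 2 * Λ ^ 3`. The losses are then a constant, absorbed by one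
  -- factor `c`, times `c ^ 8 * Λ ^ 15`, and `c ≥ 17` makes `P` larger.
  obtain ⟨c, hc17, hcC⟩ : ∃ c : ℕ, 17 ≤ c ∧ 32 * 1966080 * 16 * 64 * C ≤ c :=
    ⟨17 + 32 * 1966080 * 16 * 64 * C, by omega, by omega⟩
  refine ⟨c, hc17, fun k ε hk hε hε1 => ?_⟩
  have hl := logb_inv_pos hε hε1
  set P := polyLog c k ε with hP
  have hPmul := polyLog_eq_mul_pow c k ε
  rw [← hP] at hPmul
  have hPdef : P = ((c : ℝ) * ((k : ℝ) + Real.logb 2 (1 / ε))) ^ c := rfl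
  have hk1 : (1 : ℝ) ≤ k := by exact_mod_cast hk
  obtain ⟨Λ, hΛ⟩ : ∃ Λ, Λ = (k : ℝ) + Real.logb 2 (1 / ε) := ⟨_, rfl⟩
  rw [← hΛ] at hPmul hPdef
  have hΛ1 : 1 ≤ Λ := by linarith
  have hkΛ : (k : ℝ) ≤ Λ := by linarith
  have hlΛ : Real.logb 2 (1 / ε) ≤ Λ := by linarith
  have hcr : (17 : ℝ) ≤ c := by exact_mod_cast hc17
  have hc1 : (1 : ℝ) ≤ c := by linarith
  have hcΛ : 17 ≤ c * Λ := by nlinarith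
  have hP17 : 17 ≤ P := by
    rw [hPdef]
    exact hcΛ.trans (le_self_pow₀ (by linarith) (by omega))
  have hP1 : 1 ≤ P := by linarith
  have hlogP : Real.logb 2 P ≤ 2 * c ^ 2 * Λ := by
    rw [hPdef, Real.logb_pow]
    calc (c : ℝ) * Real.logb 2 (c * Λ) ≤ c * (2 * (c * Λ)) := by
          gcongr
          exact logb_two_le (by linarith)
      _ = _ := by ring
  have hdiv : ∀ e : ℕ, 1 ≤ e → 17 ≤ P ^ e / ε := fun e he => by
    rw [le_div_iff₀ hε]
    have : P ≤ P ^ e := le_self_pow₀ hP1 (by omega)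
    nlinarith
  have hlogdiv : ∀ e : ℕ, Real.logb 2 (P ^ e / ε) ≤ Λ + e * (2 * c ^ 2 * Λ) := fun e => by
    rw [div_eq_mul_one_div, Real.logb_mul (by positivity) (by positivity), Real.logb_pow]
    have : (e : ℝ) * Real.logb 2 P ≤ e * (2 * c ^ 2 * Λ) := by gcongr
    linarith
  obtain ⟨N, hN1, hN2, hN3⟩ := exists_two_pow_near (y := P ^ k / ε) (by linarith [hdiv k hk])
  obtain ⟨D, hD1, hD2, hD3⟩ := exists_two_pow_near (y := P ^ k ^ 2 / ε)
    (by linarith [hdiv (k ^ 2) (Nat.one_le_pow _ _ (by omega))])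
  have hc2 : (1 : ℝ) ≤ (c : ℝ) ^ 2 := one_le_pow₀ hc1
  have hN4 : (N : ℝ) + 1 ≤ 4 * c ^ 2 * Λ ^ 2 := by
    have h1 : (k : ℝ) * (2 * c ^ 2 * Λ) ≤ Λ * (2 * c ^ 2 * Λ) := by gcongr
    have h2 := hlogdiv k
    have h3 : Λ ≤ Λ ^ 2 := le_self_pow₀ hΛ1 (by norm_num)
    have h4 : Λ ^ 2 ≤ c ^ 2 * Λ ^ 2 := le_mul_of_one_le_left (by positivity) hc2
    nlinarith
  have hD4 : 2 * (D : ℝ) + 2 ≤ 8 * c ^ 2 * Λ ^ 3 := by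
    have h1 : ((k ^ 2 : ℕ) : ℝ) * (2 * c ^ 2 * Λ) ≤ Λ ^ 2 * (2 * c ^ 2 * Λ) := by
      push_cast
      gcongr
    have h2 := hlogdiv (k ^ 2)
    have h3 : Λ ≤ Λ ^ 3 := le_self_pow₀ hΛ1 (by norm_num)
    have h4 : Λ ^ 3 ≤ c ^ 2 * Λ ^ 3 := le_mul_of_one_le_left (by positivity) hc2
    nlinarith
  have hflip : ∀ {x y : ℝ}, x ≤ y / ε ↔ ε * x ≤ y := fun {x y} => by
    rw [le_div_iff₀ hε, mul_comm]
  refine ⟨N, D, ?_, hflip.1 hN1, ?_, hflip.1 hD1, ?_, ?_⟩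
  · by_contra h0
    have h1 := hdiv (k ^ 2) (Nat.one_le_pow _ _ (by omega))
    rw [show D = 0 by omega] at hD2
    norm_num at hD2
    linarith
  · rw [div_le_iff₀ hε] at hN2; linarith
  · rw [div_le_iff₀ hε] at hD2; linarith
  · calc 32 * (splitLoss k C N : ℝ) * (2 * D + 2) ^ 2 * (N + 1) ≤
          32 * (1966080 * C * Λ ^ 5 * (4 * c ^ 2 * Λ ^ 2)) * (8 * c ^ 2 * Λ ^ 3) ^ 2 *
            (4 * c ^ 2 * Λ ^ 2) := by
          gcongr
          exact splitLoss_le hk hkΛ hN4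
      _ = ((32 * 1966080 * 16 * 64 * C : ℕ) : ℝ) * c ^ 8 * Λ ^ 15 := by push_cast; ring
      _ ≤ c * c ^ 8 * Λ ^ 15 := by
          gcongr
      _ = c ^ 9 * Λ ^ 15 := by ring
      _ ≤ c ^ c * Λ ^ c := by
          gcongr <;> omega
      _ = P := hPmul.symm

lemma StartsGrowingSuffix.mono {n : ℕ} {f : ℕ → ℝ} {α β β' : ℝ} {a : ℕ}
    (h : StartsGrowingSuffix n f α β a) (h0 : 0 ≤ β') (hβ : β' ≤ β) :
    StartsGrowingSuffix n f α β' a := by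
  obtain ⟨h1, h2, h3, D, h4, h5, h6, h7⟩ := h
  exact ⟨h1, ⟨h0, hβ.trans h2.2⟩, h3, D, h4, h5, hβ.trans h6, h7⟩

lemma le_two_pow_self (k : ℕ) : (k : ℝ) ≤ 2 ^ k := by exact_mod_cast Nat.lt_two_pow_self.le

/-- Pigeonhole over the dyadic densities of growing suffixes. -/
lemma exists_growing_density {n k N : ℕ} {S : ℕ → ℕ → Prop} {w : ℝ} (P : ℝ) (hk : 1 ≤ k)
    [∀ i a, Decidable (S i a)] (hP : 1 ≤ P)
    (hw : w ≤ (2 * P) ^ k * ∑ a ∈ Finset.Icc 1 n, ∑ i ∈ Finset.range (N + 1),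
      if S i a then (1 / 2 : ℝ) ^ i else 0) :
    ∃ i ≤ N, k * w ≤ (4 * P * (N + 1)) ^ k *
      ((1 / 2 : ℝ) ^ i * ((Finset.Icc 1 n).filter (S i)).card) := by
  rw [Finset.sum_comm] at hw
  have h1 : ∀ i, (∑ a ∈ Finset.Icc 1 n, if S i a then (1 / 2 : ℝ) ^ i else 0) =
      (1 / 2 : ℝ) ^ i * ((Finset.Icc 1 n).filter (S i)).card := fun i => by
    rw [← Finset.sum_filter, Finset.sum_const, nsmul_eq_mul, mul_comm]
  simp only [h1] at hw
  obtain ⟨i, hi, hmax⟩ := Finset.exists_max_image (Finset.range (N + 1))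
    (fun i => (1 / 2 : ℝ) ^ i * ((Finset.Icc 1 n).filter (S i)).card) ⟨0, by simp⟩
  have h2 := Finset.sum_le_card_nsmul _ _ _ hmax
  rw [Finset.card_range, nsmul_eq_mul] at h2
  push_cast at h2
  refine ⟨i, by rw [Finset.mem_range] at hi; omega, ?_⟩
  set y := (1 / 2 : ℝ) ^ i * ((Finset.Icc 1 n).filter (S i)).card with hy
  have hy0 : 0 ≤ y := by positivity
  have hN1 : (1 : ℝ) ≤ N + 1 := by linarith [(Nat.cast_nonneg N : (0 : ℝ) ≤ N)]
  have h3 : w ≤ (2 * P) ^ k * ((N + 1) ^ k * y) := hw.trans <| by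
    gcongr
    refine h2.trans ?_
    gcongr
    exact le_self_pow₀ hN1 (by omega)
  calc k * w ≤ k * ((2 * P) ^ k * ((N + 1) ^ k * y)) := by gcongr
    _ ≤ 2 ^ k * ((2 * P) ^ k * ((N + 1) ^ k * y)) := by
        gcongr
        exact le_two_pow_self k
    _ = _ := by
        rw [← mul_assoc, ← mul_assoc, ← mul_pow, ← mul_pow]
        ring_nf

lemma eight_mul_le_pow {k : ℕ} (hk : 1 ≤ k) : (8 : ℝ) * k ≤ 8 ^ k := by
  have : 8 * k ≤ 8 ^ k := by
    induction k, hk using Nat.le_induction with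
    | base => norm_num
    | succ m hm ih => rw [pow_succ]; omega
  exact_mod_cast this

theorem theorem2p7 :
    ∀ C : ℝ, 0 < C → ∃ c : ℕ, ∀ (k : ℕ) (ε : ℝ) (n : ℕ) (f : ℕ → ℝ),
      1 ≤ k → 0 < ε → ε < 1 → IsFarFromFree n k ε f →
      (∃ (α : ℝ) (H : Finset ℕ),
        ε / polyLog c k ε ^ k ≤ α ∧
        H ⊆ Finset.Icc 1 n ∧
        (∀ a ∈ H, StartsGrowingSuffix n f α (C * (k : ℝ) * α) a) ∧
        ε * (n : ℝ) / polyLog c k ε ^ k ≤ α * (H.card : ℝ)) ∨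
      (∃ (T : Finset (Fin k → ℕ)) (β : ℝ) (G : BinTree k) (ϱ : List Bool → ℕ)
          (Iv : List Bool → Finset (Finset ℕ)),
        IsDisjointMonoFamily f (Finset.Icc 1 n) T ∧
        ε * (n : ℝ) / polyLog c k ε ^ (k ^ 2) ≤ (T.card : ℝ) ∧
        0 < β ∧ β < 1 ∧ ε / polyLog c k ε ^ (k ^ 2) ≤ β ∧
        IsTreeDescriptor c k β f G ϱ Iv T (Finset.Icc 1 n)) := by
  classical
  intro C hC
  obtain ⟨C', hC'⟩ : ∃ C' : ℕ, C' = max 1 ⌈C⌉₊ := ⟨_, rfl⟩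
  have hC'1 : 1 ≤ C' := by omega
  have hCC' : C ≤ C' := (Nat.le_ceil C).trans (by rw [hC']; exact_mod_cast le_max_right _ _)
  obtain ⟨c, hc, hparam⟩ := exists_parameters C'
  refine ⟨c, fun k ε n f hk hε hε1 hfar => ?_⟩
  obtain ⟨N, D, hD, hN1, hN2, hD1, hD2, hbig⟩ := hparam k ε hk hε hε1
  set P := polyLog c k ε with hP
  set s : ℝ := (splitLoss k C' N : ℝ) with hs
  have hs1 : 1 ≤ s := by rw [hs]; exact_mod_cast splitLoss_pos hk hC'1 N
  have hd1 : (1 : ℝ) ≤ (2 * D + 2) ^ 2 := one_le_pow₀ (by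
    linarith [(Nat.cast_nonneg D : (0 : ℝ) ≤ D)])
  have hN0 : (1 : ℝ) ≤ N + 1 := by linarith [(Nat.cast_nonneg N : (0 : ℝ) ≤ N)]
  have hsd : 32 * s * (2 * D + 2) ^ 2 ≤ P :=
    (le_mul_of_one_le_right (by positivity) hN0).trans hbig
  have hsN : 4 * s * (N + 1) ≤ P := by
    refine le_trans ?_ hbig
    refine mul_le_mul_of_nonneg_right ?_ (by linarith)
    calc 4 * s ≤ 32 * s := by linarith
      _ ≤ _ := le_mul_of_one_le_right (by positivity) hd1
  have hs4 : 4 * s ≤ P := (le_mul_of_one_le_right (by positivity) hN0).trans hsN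
  have hP0 : 0 < P := by linarith
  have hk0 : (0 : ℝ) ≤ k := k.cast_nonneg
  rcases Nat.eq_zero_or_pos n with rfl | hn
  · exact Or.inl ⟨ε / P ^ k, ∅, le_rfl, by simp, by simp, by simp⟩
  obtain ⟨T, hT, hTcard⟩ := exists_family_of_far hk hε1 hfar
  have hn0 : (0 : ℝ) < n := by exact_mod_cast hn
  have ht0 : (0 : ℝ) < T.card := by
    by_contra h
    have : (k : ℝ) * T.card ≤ 0 := mul_nonpos_of_nonneg_of_nonpos hk0 (not_lt.1 h)
    nlinarith [mul_pos hε hn0]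
  have hTne : T.Nonempty := Finset.card_pos.1 (by exact_mod_cast ht0)
  have hks : 2 * k * s ^ k ≤ P ^ k := by
    calc 2 * k * s ^ k ≤ 2 ^ k * 2 ^ k * s ^ k := by
          gcongr
          · exact le_self_pow₀ (by norm_num) (by omega)
          · exact le_two_pow_self k
      _ = (4 * s) ^ k := by rw [← mul_pow, ← mul_pow]; norm_num
      _ ≤ P ^ k := by gcongr
  set Q : ℝ := (treeLoss k C' N D : ℝ) with hQ
  have hQeq : Q = 4 * s * (2 * D + 2) ^ (2 * k) := by rw [hQ, treeLoss, hs]; push_cast; rfl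
  -- `Q` contains `(2 * D + 2) ^ (2 * k)`, so its `k`-th power requires the exponent `k ^ 2`.
  have hkQ : 8 * k * Q ^ k ≤ P ^ k ^ 2 := by
    calc 8 * k * Q ^ k ≤ 8 ^ k * Q ^ k := by
          gcongr
          exact eight_mul_le_pow hk
      _ = (32 * s) ^ k * ((2 * (D : ℝ) + 2) ^ 2) ^ k ^ 2 := by
          rw [hQeq, mul_pow, ← mul_assoc, ← mul_pow, ← pow_mul, ← pow_mul]
          ring_nf
      _ ≤ (32 * s) ^ k ^ 2 * ((2 * (D : ℝ) + 2) ^ 2) ^ k ^ 2 := by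
          gcongr
          · linarith
          · nlinarith
      _ = (32 * s * (2 * D + 2) ^ 2) ^ k ^ 2 := (mul_pow _ _ _).symm
      _ ≤ _ := by gcongr
  have hsmall : ∀ {x y : ℝ}, 0 ≤ x → k * x ≤ ε * y → x * n ≤ y * T.card := by
    intro x y hx hxy
    refine le_of_mul_le_mul_left ?_ hε
    calc ε * (x * n) = x * (ε * n) := by ring
      _ ≤ x * (k * T.card) := by gcongr
      _ = k * x * T.card := by ring
      _ ≤ ε * y * T.card := by gcongr
      _ = _ := by ring
  obtain ⟨S, hS⟩ : ∃ S : ℕ → ℕ → Prop, S = fun i a =>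
      StartsGrowingSuffix n f ((1 / 2) ^ i) (C' * k * (1 / 2) ^ i) a := ⟨_, rfl⟩
  have hcard : (Finset.Icc 1 n).card = n := by simp
  have hhalf : ∀ i a, (0 : ℝ) ≤ if S i a then (1 / 2 : ℝ) ^ i else 0 := fun i a => by
    split_ifs <;> positivity
  -- Here `ω a` sums all dyadic densities `2 ^ (-i)`, `i ≤ N`, at which `a` starts a growing suffix;
  -- `exists_growing_density` later extracts a single one.
  rcases growing_or_tree (n := n) (f := f) (k := k) (C := C') (N := N) (D := D)
      (ω := fun a => ∑ i ∈ Finset.range (N + 1), if S i a then (1 / 2 : ℝ) ^ i else 0)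
      hC'1 (fun a => Finset.sum_nonneg fun i _ => hhalf i a)
      (fun a i hi h => by
        have h1 := Finset.single_le_sum (f := fun i => if S i a then (1 / 2 : ℝ) ^ i else 0)
          (fun j _ => hhalf j a) (Finset.mem_range.2 (Nat.lt_succ_of_le hi))
        have h2 : S i a := by rw [hS]; exact h
        simpa only [h2, if_true] using h1)
      k hk le_rfl (Finset.Icc 1 n) T ⟨1, n, rfl⟩ le_rfl hT hTne
      (by
        rw [hcard]
        have := hsmall (x := s ^ k) (y := 2 ^ N) (by positivity) (by linarith)
        rw [hs] at this
        exact_mod_cast this)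
      (by
        rw [hcard]
        have := hsmall (x := 4 * Q ^ k) (y := 2 ^ D) (by positivity) (by linarith)
        rw [hQ] at this
        exact_mod_cast this) with hgrow | ⟨τ, p, hτ, hlab, hfam, hp⟩
  · left
    obtain ⟨i, hi, hle⟩ := exists_growing_density s hk hs1 hgrow
    refine ⟨(1 / 2) ^ i, (Finset.Icc 1 n).filter (S i), ?_, Finset.filter_subset _ _, ?_, ?_⟩
    · rw [div_le_iff₀ (by positivity), one_div, inv_pow, inv_mul_eq_div,
        le_div_iff₀ (by positivity)]
      refine le_trans ?_ hN1
      gcongr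
      norm_num
    · intro a ha
      have h1 := (Finset.mem_filter.1 ha).2
      rw [hS] at h1
      exact h1.mono (by positivity) (by gcongr)
    · rw [div_le_iff₀ (by positivity), mul_comm _ (P ^ k)]
      refine hTcard.trans (hle.trans ?_)
      gcongr
  · right
    subst hτ
    -- With `β = 2 ^ (-D)` the permitted labels are exactly `1, …, D`.
    have hβlog : Real.logb 2 (1 / (1 / 2 : ℝ) ^ D) = D := by
      rw [one_div_pow, one_div_one_div, Real.logb_pow, Real.logb_self_eq_one (by norm_num), mul_one]
    have hpoly : 2 ≤ polyLog c τ.leaves ((1 / 2 : ℝ) ^ D) ^ τ.leaves := by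
      have h1 : (17 : ℝ) ≤ c := by exact_mod_cast hc
      have h2 : (1 : ℝ) ≤ τ.leaves := by exact_mod_cast hk
      have h3 : (17 : ℝ) ≤ c * (τ.leaves + D) := by
        nlinarith [(Nat.cast_nonneg D : (0 : ℝ) ≤ D)]
      have h4 : (17 : ℝ) ≤ polyLog c τ.leaves ((1 / 2 : ℝ) ^ D) := by
        rw [polyLog, hβlog]
        exact h3.trans (le_self_pow₀ (by linarith) (by omega))
      exact le_trans (by linarith) (h4.trans (le_self_pow₀ (by linarith) (by omega)))
    obtain ⟨T', Iv, hT', -, hT'card, hIv, hdesc⟩ := hfam.exists_describes hk hpoly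
    refine ⟨T', (1 / 2) ^ D, τ.toBinTree, τ.labelAt, Iv, hT', ?_, by positivity,
      pow_lt_one₀ (by norm_num) (by norm_num) (by omega), ?_, ?_,
      fun v _ J hJ => (hIv v J hJ).2, hdesc⟩
    · rw [div_le_iff₀ (by positivity), hT'card]
      have hp' : (T.card : ℝ) ≤ 2 ^ p * Q ^ τ.leaves := by
        rw [hQ]
        exact_mod_cast hp
      have hQ0 : 0 ≤ (τ.leaves : ℝ) * Q ^ τ.leaves := by positivity
      calc ε * n ≤ τ.leaves * T.card := hTcard
        _ ≤ τ.leaves * (2 ^ p * Q ^ τ.leaves) := by gcongr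
        _ = 2 ^ p * (τ.leaves * Q ^ τ.leaves) := by ring
        _ ≤ 2 ^ p * P ^ τ.leaves ^ 2 := by
            gcongr
            linarith
        _ = _ := by push_cast; rfl
    · rw [div_le_iff₀ (by positivity), one_div, inv_pow, inv_mul_eq_div,
        le_div_iff₀ (by positivity)]
      exact hD1
    · intro v hv
      rw [hβlog, Nat.ceil_natCast]
      exact hlab.labelAt τ v hv
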